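/- Let $n\ge 2$ be an integer and $Q=n+2$ (so $Q\ge4$). For $(x,t)\in\mathbb R^n\times\mathbb R=\mathbb R^{n+1}$ with origin $o$ let $$\mathcal L_G=\Delta_x+|x|^2\partial_t^2,\qquad \nabla_G=(\nabla_x,|x|\partial_t),\qquad \varrho(x,t)=(|x|^4+4t^2)^{1/4},\qquad \psi=|\nabla_G\varrho|^2 .$$ With the dilations $\delta_s(x,t)=(sx,s^2t)$, every point $p\neq o$ is $p=\delta_\varrho\sigma$ with $\varrho=\varrho(p)$ and $\sigma$ in $\Omega=\{\varrho=1\}$. Let $u_\varrho=\partial_\varrho u$ be the derivative of $u$ in $\varrho$ at fixed $\sigma$, and $$\mathcal L_{\varrho,G}u=\psi\Bigl(\partial_\varrho^2u+\tfrac{Q-1}{\varrho}\,\partial_\varrho u\Bigr).$$ Parametrize $\Omega$ by $\sigma=\bigl(\sin^{1/2}(\phi)\,w,\tfrac12\cos\phi\bigr)$ with $0<\phi<\pi$ and $w\in\mathbb S^{n-1}$, and put $d\Omega=(\sin\phi)^{n/2}\,d\phi\,dw$, where $dw$ is the surface measure of $\mathbb S^{n-1}$. For $k=0,1,2,\dots$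 let $\mathcal H_k$ be the span of the functions $$\sin^{l/2}(\phi)\;C^{\frac l2+\frac n4}_{\frac{k-l}{2}}(\cos\phi)\;Y(w),\qquad 0\le l\le k,\quad l\equiv k\ (\mathrm{mod}\ 2),$$ where $C^{\alpha}_m$ is the Gegenbauer polynomial and $Y$ is any spherical harmonic of degree $l$ on $\mathbb S^{n-1}$. For a function $f$ that is continuous on $\mathbb R^{n+1}\setminus\{o\}$ let $\mathcal P_kf$ be the function on $\mathbb R^{n+1}\setminus\{o\}$ such that, for each $\varrho>0$, $\sigma\mapsto(\mathcal P_kf)(\delta_\varrho\sigma)$ is the orthogonal projection of $\sigma\mapsto f(\delta_\varrho\sigma)$ onto $\mathcal H_k$ in $L^2(\Omega,d\Omega)$. Put $\lambda_k=k(k+n)/4$, and let $\|\cdot\|$ be the norm of $L^2(\mathbb R^{n+1},dx\,dt)$, with value $+\infty$ for a measurable function that is not square integrable. Then every real-valued $u\in C_c^\infty(\mathbb R^{n+1}\setminus\{o\})$ satisfies, in $[0,\infty]$, $$\Bigl\|\frac{\mathcal L_Gu}{\psi^{1/2}}\Bigr\|^2=\Bigl\|\frac{\mathcal L_{\varrho,G}u}{\psi^{1/2}}\Bigr\|^2+16\sum_{k=0}^\infty\lambda_k^2\Bigl\|\frac{(\mathcal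 P_ku)\psi^{1/2}}{\varrho^2}\Bigr\|^2+8\sum_{k=0}^\infty\lambda_k\Bigl\|\frac{(\mathcal P_ku_\varrho)\psi^{1/2}}{\varrho}\Bigr\|^2+8(Q-4)\sum_{k=0}^\infty\lambda_k\Bigl\|\frac{(\mathcal P_ku)\psi^{1/2}}{\varrho^2}\Bigr\|^2 .$$ Moreover $\|\mathcal L_{\varrho,G}u/\psi^{1/2}\|<\infty$ always, and $\|\mathcal L_Gu/\psi^{1/2}\|<\infty$ if $Q\ge5$ (for $Q=4$ both sides of the identity may be $+\infty$). In particular $$\Bigl\|\frac{\mathcal L_{\varrho,G}u}{\psi^{1/2}}\Bigr\|\le\Bigl\|\frac{\mathcal L_Gu}{\psi^{1/2}}\Bigr\| .$$ -/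

import Mathlib

open MeasureTheory Set
open scoped ContDiff

noncomputable section

namespace Grushin

/-- The Grushin space `ℝⁿ × ℝ`, with points `(x, t)`; `ℝⁿ` carries the Euclidean norm and the
product carries the Lebesgue measure `dx dt`. -/
abbrev Space (n : ℕ) : Type := EuclideanSpace ℝ (Fin n) × ℝ

/-- The homogeneous dimension `Q = n + 2`. -/
def homDim (n : ℕ) : ℕ := n + 2

/-- The anisotropic dilation `δ_s (x, t) = (s x, s² t)`. -/
def dil {n : ℕ} (s : ℝ) (p : Space n) : Space n := (s • p.1, s ^ 2 * p.2)

/-- The homogeneous norm `ϱ(x, t) = (|x|⁴ + 4 t²)^{1/4}`. -/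
def rho {n : ℕ} (p : Space n) : ℝ := (‖p.1‖ ^ 4 + 4 * p.2 ^ 2) ^ (1 / 4 : ℝ)

/-- `|∇_G f|² = |∇_x f|² + (|x| ∂_t f)²`. -/
def normGradSq {n : ℕ} (f : Space n → ℝ) (p : Space n) : ℝ :=
  ‖gradient (fun y => f (y, p.2)) p.1‖ ^ 2 + (‖p.1‖ * deriv (fun s => f (p.1, s)) p.2) ^ 2

/-- `ψ = |∇_G ϱ|²`. -/
def psi {n : ℕ} (p : Space n) : ℝ := normGradSq rho p

/-- The Grushin operator `L_G f = Δ_x f + |x|² ∂_t² f`. -/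
def grushinOp {n : ℕ} (f : Space n → ℝ) (p : Space n) : ℝ :=
  Laplacian.laplacian (fun y => f (y, p.2)) p.1 + ‖p.1‖ ^ 2 * iteratedDeriv 2 (fun s => f (p.1, s)) p.2

/-- The radial derivative `f_ϱ = ∂f/∂ϱ`: with `p = δ_ϱ σ`, `ϱ = ϱ(p)`, it is the derivative of
`s ↦ f (δ_s σ)` at `s = ϱ`, where `δ_s σ = δ_{s/ϱ} p`. -/
def radialDeriv {n : ℕ} (f : Space n → ℝ) (p : Space n) : ℝ :=
  deriv (fun s => f (dil (s / rho p) p)) (rho p)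

/-- The radial part `L_{ϱ,G} f = ψ (∂²f/∂ϱ² + ((Q - 1)/ϱ) ∂f/∂ϱ)` of the Grushin operator. -/
def radialGrushinOp {n : ℕ} (f : Space n → ℝ) (p : Space n) : ℝ :=
  psi p * (radialDeriv (radialDeriv f) p + ((homDim n : ℝ) - 1) / rho p * radialDeriv f p)

/-- The point `σ = (√(sin φ) w, (cos φ)/2)` with polar coordinates `φ` and `w` on the `ϱ`-sphere
`Ω = {ϱ = 1}`. -/
def spherePoint {n : ℕ} (q : ℝ × Metric.sphere (0 : EuclideanSpace ℝ (Fin n)) 1) : Space n :=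
  (√(Real.sin q.1) • (q.2 : EuclideanSpace ℝ (Fin n)), Real.cos q.1 / 2)

/-- The measure `dΩ = (sin φ)^{n/2} dφ dw` on the `ϱ`-sphere `Ω = {ϱ = 1}`, as a measure on the
whole space that is carried by `Ω`; `0 < φ < π` and `dw` is the surface measure of the round unit
sphere of `ℝⁿ`. -/
def sphereMeasure (n : ℕ) : Measure (Space n) :=
  ((((volume : Measure ℝ).restrict (Ioo 0 Real.pi)).prod
    (volume : Measure (EuclideanSpace ℝ (Fin n))).toSphere).withDensity
      (fun q => ENNReal.ofReal (Real.sin q.1 ^ ((n : ℝ) / 2)))).map spherePoint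

/-- The value at `x` of the Gegenbauer polynomial `C_m^α`, by the three-term recurrence
`m C_m = 2 x (m + α - 1) C_{m-1} - (m + 2 α - 2) C_{m-2}`, `C_0 = 1`, `C_1 = 2 α x`. -/
def gegenbauer (α x : ℝ) : ℕ → ℝ
  | 0 => 1
  | 1 => 2 * α * x
  | m + 2 => (2 * x * ((m : ℝ) + 1 + α) * gegenbauer α x (m + 1)
      - ((m : ℝ) + 2 * α) * gegenbauer α x m) / ((m : ℝ) + 2)

/-- `Y` is a homogeneous harmonic polynomial of degree `l` on `ℝⁿ`; the spherical harmonics of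
degree `l` on the unit sphere of `ℝⁿ` are the restrictions of these polynomials. -/
def IsSolidHarmonic {n : ℕ} (l : ℕ) (Y : MvPolynomial (Fin n) ℝ) : Prop :=
  Y.IsHomogeneous l ∧ ∑ i, MvPolynomial.pderiv i (MvPolynomial.pderiv i Y) = 0

/-- The function `g_{l,k} = (sin φ)^{l/2} C_m^{l/2+n/4}(cos φ) Y(w)`, `m = (k-l)/2`, on `Ω`.
At the point `(x, t)` of `Ω` one has `x = (sin φ)^{1/2} w` and `cos φ = 2 t`, so that
`(sin φ)^{l/2} Y(w) = Y(x)` by homogeneity. -/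
def harmonicFn {n : ℕ} (l m : ℕ) (Y : MvPolynomial (Fin n) ℝ) (σ : Space n) : ℝ :=
  gegenbauer ((l : ℝ) / 2 + (n : ℝ) / 4) (2 * σ.2) m * MvPolynomial.eval (fun i => σ.1 i) Y

/-- The space `H_k` of spherical harmonics of order `k` on `Ω`: the span of the `g_{l,k}` with
`0 ≤ l ≤ k` and `l ≡ k (mod 2)`, that is `k = l + 2 m`. Its elements are used on `Ω` only. -/
def sphHarm (n k : ℕ) : Submodule ℝ (Space n → ℝ) :=
  Submodule.span ℝ {g | ∃ (l m : ℕ) (Y : MvPolynomial (Fin n) ℝ),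
    l + 2 * m = k ∧ IsSolidHarmonic l Y ∧ g = harmonicFn l m Y}

/-- `g` is the orthogonal projection of `f` onto `H_k` in `L²(Ω, dΩ)`. -/
def IsSphProj {n : ℕ} (k : ℕ) (f g : Space n → ℝ) : Prop :=
  g ∈ sphHarm n k ∧ ∀ h ∈ sphHarm n k, ∫ σ, (f σ - g σ) * h σ ∂(sphereMeasure n) = 0

theorem measurable_spherePoint {n : ℕ} : Measurable (spherePoint (n := n)) := by
  have : Continuous (spherePoint (n := n)) := by unfold spherePoint; fun_prop
  exact this.measurable

instance isFiniteMeasure_sphereMeasure (n : ℕ) : IsFiniteMeasure (sphereMeasure n) := by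
  unfold sphereMeasure
  have : IsFiniteMeasure (((((volume : Measure ℝ).restrict (Ioo 0 Real.pi)).prod
    (volume : Measure (EuclideanSpace ℝ (Fin n))).toSphere).withDensity
      (fun q => ENNReal.ofReal (Real.sin q.1 ^ ((n : ℝ) / 2))))) := by
    apply isFiniteMeasure_withDensity
    refine ne_top_of_le_ne_top (b := ∫⁻ _, 1 ∂((((volume : Measure ℝ).restrict (Ioo 0 Real.pi)).prod
      (volume : Measure (EuclideanSpace ℝ (Fin n))).toSphere))) ?_ ?_
    · rw [lintegral_one]
      have : IsFiniteMeasure ((volume : Measure ℝ).restrict (Ioo 0 Real.pi)) := ⟨by simp⟩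
      exact measure_ne_top _ _
    · apply lintegral_mono
      intro q
      simp only
      rw [← ENNReal.ofReal_one]
      apply ENNReal.ofReal_le_ofReal
      calc Real.sin q.1 ^ ((n : ℝ) / 2) ≤ |Real.sin q.1| ^ ((n : ℝ) / 2) :=
            (le_abs_self _).trans (Real.abs_rpow_le_abs_rpow _ _)
        _ ≤ 1 := Real.rpow_le_one (abs_nonneg _) (Real.abs_sin_le_one _) (by positivity)
  infer_instance

theorem ae_mem_closedBall (n : ℕ) : ∀ᵐ σ ∂(sphereMeasure n), σ ∈ Metric.closedBall (0 : Space n) 1 := by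
  unfold sphereMeasure
  refine (ae_map_iff measurable_spherePoint.aemeasurable
    (p := fun σ => σ ∈ Metric.closedBall (0 : Space n) 1)
    Metric.isClosed_closedBall.measurableSet).2 ?_
  refine Filter.Eventually.of_forall fun q => ?_
  rw [mem_closedBall_zero_iff, Prod.norm_def]
  simp only [spherePoint, norm_smul, sup_le_iff]
  constructor
  · have : ‖(q.2 : EuclideanSpace ℝ (Fin n))‖ = 1 := by simp
    rw [this, mul_one, Real.norm_eq_abs, abs_of_nonneg (Real.sqrt_nonneg _)]
    exact Real.sqrt_le_one.mpr (Real.sin_le_one _)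
  · rw [Real.norm_eq_abs, abs_div, abs_two]
    have := Real.abs_cos_le_one q.1
    linarith

theorem continuous_gegenbauer (α : ℝ) : ∀ m, Continuous (fun x => gegenbauer α x m)
  | 0 => by simp only [gegenbauer]; fun_prop
  | 1 => by simp only [gegenbauer]; fun_prop
  | m + 2 => by
    have h1 := continuous_gegenbauer α (m+1)
    have h2 := continuous_gegenbauer α m
    simp only [gegenbauer]; fun_prop

theorem continuous_of_mem_sphHarm {n k : ℕ} {g : Space n → ℝ} (hg : g ∈ sphHarm n k) :
    Continuous g := by
  induction hg using Submodule.span_induction with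
  | mem x h =>
    obtain ⟨l, m, Y, -, -, rfl⟩ := h
    unfold harmonicFn
    have h1 := (continuous_gegenbauer ((l : ℝ) / 2 + (n : ℝ) / 4) m).comp
      (f := fun σ : Space n => 2 * σ.2) (by fun_prop)
    have h2 : Continuous fun σ : Space n => MvPolynomial.eval (fun i => σ.1 i) Y :=
      (MvPolynomial.continuous_eval Y).comp (by fun_prop)
    exact h1.mul h2
  | zero => exact continuous_zero
  | add x y _ _ hx hy => exact hx.add hy
  | smul a x _ hx => exact hx.const_smul a

theorem memLp_of_mem {n k : ℕ} {g : Space n → ℝ} (hg : g ∈ sphHarm n k) :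
    MemLp g 2 (sphereMeasure n) := by
  have hc := continuous_of_mem_sphHarm hg
  obtain ⟨C, hC⟩ := (isCompact_closedBall (0 : Space n) 1).exists_bound_of_continuousOn hc.continuousOn
  exact MemLp.of_bound hc.aestronglyMeasurable C ((ae_mem_closedBall n).mono fun σ h => hC σ h)

instance finiteDimensional_sphHarm (n k : ℕ) : FiniteDimensional ℝ (sphHarm n k) := by
  let T : Set (Space n → ℝ) :=
    (fun q : ℕ × ℕ × (Fin n →₀ ℕ) => harmonicFn q.1 q.2.1 (MvPolynomial.monomial q.2.2 1)) ''
      ((Iic k) ×ˢ (Iic k) ×ˢ (⋃ l ∈ Iic k, ((Finset.univ.finsuppAntidiag l : Finset (Fin n →₀ ℕ)) : Set (Fin n →₀ ℕ))))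
  have hT : T.Finite := by
    apply Set.Finite.image
    refine (finite_Iic k).prod ((finite_Iic k).prod ?_)
    exact (finite_Iic k).biUnion fun l _ => Finset.finite_toSet _
  have := FiniteDimensional.span_of_finite ℝ hT
  apply Submodule.finiteDimensional_of_le (S₂ := Submodule.span ℝ T)
  unfold sphHarm
  rw [Submodule.span_le]
  rintro g ⟨l, m, Y, hk, ⟨hY, -⟩, rfl⟩
  have : harmonicFn l m Y = ∑ d ∈ Y.support, (Y.coeff d) • harmonicFn l m (MvPolynomial.monomial d 1) := by
    funext σ
    conv_lhs => rw [Y.as_sum]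
    simp only [harmonicFn, map_sum, Finset.mul_sum, Finset.sum_apply, Pi.smul_apply, smul_eq_mul,
      MvPolynomial.eval_monomial]
    refine Finset.sum_congr rfl fun d _ => by ring
  rw [this]
  refine Submodule.sum_mem _ fun d hd => Submodule.smul_mem _ _ (Submodule.subset_span ?_)
  refine ⟨(l, m, d), ?_, rfl⟩
  have hl : d.degree = l := by
    rw [Finsupp.degree_eq_weight_one]
    exact hY (by simpa using hd)
  simp only [mem_prod, mem_Iic, mem_iUnion]
  refine ⟨by omega, by omega, l, by omega, ?_⟩
  simp only [Finset.mem_coe, Finset.mem_finsuppAntidiag]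
  refine ⟨?_, by simp⟩
  rw [← hl, Finsupp.degree_eq_sum]

/-- An element of `H_k` as an element of `L²(Ω, dΩ)`. -/
def toLpHarm (n k : ℕ) : sphHarm n k →ₗ[ℝ] Lp ℝ 2 (sphereMeasure n) where
  toFun g := (memLp_of_mem g.2).toLp
  map_add' _ _ := MemLp.toLp_add _ _
  map_smul' _ _ := MemLp.toLp_const_smul _ _

/-- The orthogonal projection onto `H_k` exists for every `f` in `L²(Ω, dΩ)`. -/
theorem exists_isSphProj {n k : ℕ} {f : Space n → ℝ} (hf : MemLp f 2 (sphereMeasure n)) :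
    ∃ g, IsSphProj k f g := by
  let S := LinearMap.range (toLpHarm n k)
  let F := hf.toLp
  obtain ⟨⟨g, hg⟩, hgF⟩ : ∃ g, toLpHarm n k g = S.starProjection F := by
    have : S.starProjection F ∈ S := Submodule.starProjection_apply_mem _ _
    exact this
  refine ⟨g, hg, fun h hh => ?_⟩
  have h1 : inner ℝ (F - S.starProjection F) (toLpHarm n k ⟨h, hh⟩) = 0 :=
    Submodule.starProjection_inner_eq_zero _ _ ⟨_, rfl⟩
  rw [← hgF, L2.inner_def] at h1
  rw [← h1]
  apply integral_congr_ae
  filter_upwards [Lp.coeFn_sub F (toLpHarm n k ⟨g, hg⟩), hf.coeFn_toLp, (memLp_of_mem hg).coeFn_toLp,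
    (memLp_of_mem hh).coeFn_toLp] with σ a b c d
  simp only [toLpHarm, LinearMap.coe_mk, AddHom.coe_mk] at a ⊢
  rw [a, Pi.sub_apply, c, d, show F σ = f σ from b]
  simp; ring

open Classical in
/-- The orthogonal projection of `f` onto `H_k` in `L²(Ω, dΩ)`. It exists for every `f` in
`L²(Ω, dΩ)`, and its values on `Ω` are determined by `f`, since the elements of `H_k` are
continuous. -/
def sphProj {n : ℕ} (k : ℕ) (f : Space n → ℝ) : Space n → ℝ :=
  if h : ∃ g, IsSphProj k f g then h.choose else 0

/-- The projection `P_k f (ϱ, σ)`: for each `ϱ > 0` the function `σ ↦ f (δ_ϱ σ)` is projected onto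
`H_k`. The polar coordinates of `p` are `ϱ = ϱ(p)` and `σ = δ_{1/ϱ} p`. -/
def harmProj {n : ℕ} (k : ℕ) (f : Space n → ℝ) (p : Space n) : ℝ :=
  sphProj k (fun σ => f (dil (rho p) σ)) (dil (1 / rho p) p)

/-- `λ_k = k (k + n) / 4`. -/
def sphEigenvalue (n k : ℕ) : ℝ := (k : ℝ) * ((k : ℝ) + (n : ℝ)) / 4

/-- The squared norm `‖f‖²` in `L²(ℝⁿ⁺¹, dx dt)`, a value in `[0, ∞]`. -/
def normSq {n : ℕ} (f : Space n → ℝ) : ENNReal := eLpNorm f 2 volume ^ 2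

end Grushin

end

/-! Let E = x·∂_x + 2t ∂_t be the generator of the dilations, so that E = ϱ∂_ϱ. Since Q − 2 = n and
ψ = |x|²/ϱ², the radial part is L_{ϱ,G}u = (|x|²/ϱ⁴)(E²u + nEu) (`radialGrushinOp_eq`). The full
operator subtracts k(k+n) = 4λ_k on the component of u in H_k: for h in H_k, the pairing of L_G
u/|x|² with h on the sphere of radius r is r⁻⁴(A − 4λ_k α), where α and A are the pairings of u and
E²u + nEu with h (`ae_sphInt_grushinQuot`).

No angular operator on Ω is constructed for this; the formula is obtained weakly. An element of H_k
is the trace on Ω of a function H that is L_G-harmonic and homogeneous of degree k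
(`exists_isGrushinHarmonic`). Because the horizontal gradient of ϱ⁴ pairs with any gradient through
E alone (`carre_quartic`), L_G(χ(ϱ⁴)H) is |x|²H times a function of ϱ⁴. Symmetry of L_G, the polar
formula |x|² dx dt = (ϱ^{n+3}/2) dϱ dΩ (`lintegral_polar`), a radial Green identity
(`setIntegral_radial_eq`) and the fundamental lemma of the calculus of variations then give the
formula for a.e. r. Applied to a cut-off harmonic function, it also shows that H_j and H_k are
orthogonal for j ≠ k.

The spaces H_k are total: the Gegenbauer recurrence reaches all polynomials in t times solid
harmonics, the relation |x|² = √(1 − 4t²) on Ω and the decomposition of homogeneous polynomials into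
harmonic ones reach all polynomials in (x, t), and Stone–Weierstrass finishes
(`ae_eq_zero_of_orthogonal`). The argument works for integrable functions, not only square
integrable ones. This matters because L_G u/|x|² need not be in L²(Ω) when n = 2; Parseval's
identity is therefore proved in [0, ∞] for integrable functions (`lintegral_sq_eq_tsum`).

Parseval on each sphere turns every norm of the theorem into a sum over an orthonormal basis of
integrals with weight r^{n−3}/2. With β = rα' the pairing of Eu, what remains is the one-dimensional
identity ∫ r^{n−3}(Aα + β² + (n − 2)α²) dr = 0 (`setIntegral_radial_identity`), whose integrand is
the derivative of r^{n−2}(αβ + α²). It evaluates the cross term of (A − 4λα)² as 8λ∫β² + 8(Q −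
4)λ∫α², up to the common weight (`radNormSq_identity`). All terms are nonnegative as Q ≥ 4, so
summation in [0, ∞] needs no convergence argument, and dropping terms yields the inequality. -/

noncomputable section

namespace Grushin

variable {n : ℕ}

/-! ### Calculus of the Grushin operator: product and chain rules. -/

/-- The directional derivative of `f` along the constant vector `v`. -/
def dirDeriv (v : Space n) (f : Space n → ℝ) (p : Space n) : ℝ := fderiv ℝ f p v

/-- The coordinate vector of `x_i`. -/
def vecX (i : Fin n) : Space n := (EuclideanSpace.single i 1, 0)

/-- The coordinate vector of `t`. -/
def vecT : Space n := (0, 1)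

/-- The generator `x · ∂_x + 2 t ∂_t` of the dilations. -/
def euler (f : Space n → ℝ) (p : Space n) : ℝ := fderiv ℝ f p (p.1, 2 * p.2)

/-- The Grushin operator in terms of directional derivatives. -/
def grushin (f : Space n → ℝ) (p : Space n) : ℝ :=
  ∑ i, dirDeriv (vecX i) (dirDeriv (vecX i) f) p + ‖p.1‖ ^ 2 * dirDeriv vecT (dirDeriv vecT f) p

/-- The carré du champ `⟨∇_G f, ∇_G g⟩`. -/
def carre (f g : Space n → ℝ) (p : Space n) : ℝ :=
  ∑ i, dirDeriv (vecX i) f p * dirDeriv (vecX i) g p + ‖p.1‖ ^ 2 * (dirDeriv vecT f p * dirDeriv vecT g p)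

/-- `ϱ⁴ = |x|⁴ + 4 t²`. -/
def quartic (p : Space n) : ℝ := ‖p.1‖ ^ 4 + 4 * p.2 ^ 2

theorem contDiff_dirDeriv {f : Space n → ℝ} (hf : ContDiff ℝ ∞ f) (v : Space n) :
    ContDiff ℝ ∞ (dirDeriv v f) := by
  unfold dirDeriv
  exact (hf.fderiv_right (m := ∞) (by simp)).clm_apply contDiff_const

theorem contDiff_euler {f : Space n → ℝ} (hf : ContDiff ℝ ∞ f) : ContDiff ℝ ∞ (euler f) := by
  unfold euler
  exact (hf.fderiv_right (m := ∞) (by simp)).clm_apply (by fun_prop)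

theorem contDiff_normSq_fst : ContDiff ℝ ∞ (fun p : Space n => ‖p.1‖ ^ 2) :=
  contDiff_fst.norm_sq ℝ

theorem contDiff_quartic : ContDiff ℝ ∞ (quartic (n := n)) := by
  have : quartic (n := n) = fun p => (‖p.1‖ ^ 2) ^ 2 + 4 * p.2 ^ 2 := by
    funext p; simp only [quartic]; ring
  rw [this]
  exact (contDiff_normSq_fst.pow 2).add (contDiff_const.mul (contDiff_snd.pow 2))

theorem dirDeriv_mul {f g : Space n → ℝ} (hf : ContDiff ℝ ∞ f) (hg : ContDiff ℝ ∞ g)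
    (v : Space n) (p : Space n) :
    dirDeriv v (fun q => f q * g q) p = f p * dirDeriv v g p + dirDeriv v f p * g p := by
  unfold dirDeriv
  rw [fderiv_fun_mul (hf.differentiable (by simp) p) (hg.differentiable (by simp) p)]
  simp; ring

theorem dirDeriv_add {f g : Space n → ℝ} (hf : ContDiff ℝ ∞ f) (hg : ContDiff ℝ ∞ g)
    (v : Space n) (p : Space n) :
    dirDeriv v (fun q => f q + g q) p = dirDeriv v f p + dirDeriv v g p := by
  unfold dirDeriv
  rw [fderiv_fun_add (hf.differentiable (by simp) p) (hg.differentiable (by simp) p)]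
  simp

theorem dirDeriv_const_mul {f : Space n → ℝ} (hf : ContDiff ℝ ∞ f) (c : ℝ)
    (v : Space n) (p : Space n) :
    dirDeriv v (fun q => c * f q) p = c * dirDeriv v f p := by
  unfold dirDeriv
  rw [fderiv_const_mul (hf.differentiable (by simp) p)]
  simp

theorem dirDeriv_const (c : ℝ) (v p : Space n) : dirDeriv v (fun _ => c) p = 0 := by
  simp [dirDeriv]

theorem dirDeriv_comp {f : Space n → ℝ} (hf : ContDiff ℝ ∞ f) {χ : ℝ → ℝ} (hχ : ContDiff ℝ ∞ χ)
    (v p : Space n) : dirDeriv v (fun q => χ (f q)) p = deriv χ (f p) * dirDeriv v f p := by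
  unfold dirDeriv
  have h1 : HasDerivAt χ (deriv χ (f p)) (f p) := (hχ.differentiable (by simp) _).hasDerivAt
  have h2 := (hf.differentiable (by simp) p).hasFDerivAt
  have := (h1.comp_hasFDerivAt p h2).fderiv
  simp only [Function.comp_def] at this
  rw [this]; simp

theorem dirDeriv_dirDeriv_mul {f g : Space n → ℝ} (hf : ContDiff ℝ ∞ f) (hg : ContDiff ℝ ∞ g)
    (v p : Space n) :
    dirDeriv v (dirDeriv v (fun q => f q * g q)) p =
      f p * dirDeriv v (dirDeriv v g) p + dirDeriv v (dirDeriv v f) p * g p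
        + 2 * (dirDeriv v f p * dirDeriv v g p) := by
  have h : dirDeriv v (fun q => f q * g q) = fun q => f q * dirDeriv v g q + dirDeriv v f q * g q :=
    funext fun q => dirDeriv_mul hf hg v q
  have hf' := contDiff_dirDeriv hf v
  have hg' := contDiff_dirDeriv hg v
  rw [h, dirDeriv_add (hf.mul hg') (hf'.mul hg), dirDeriv_mul hf hg', dirDeriv_mul hf' hg]
  ring

theorem grushin_mul {f g : Space n → ℝ} (hf : ContDiff ℝ ∞ f) (hg : ContDiff ℝ ∞ g) (p : Space n) :
    grushin (fun q => f q * g q) p = f p * grushin g p + grushin f p * g p + 2 * carre f g p := by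
  simp only [grushin, carre, dirDeriv_dirDeriv_mul hf hg, Finset.sum_add_distrib,
    ← Finset.mul_sum, ← Finset.sum_mul]
  ring

theorem grushin_add {f g : Space n → ℝ} (hf : ContDiff ℝ ∞ f) (hg : ContDiff ℝ ∞ g) (p : Space n) :
    grushin (fun q => f q + g q) p = grushin f p + grushin g p := by
  have h : ∀ v, dirDeriv v (fun q => f q + g q) = fun q => dirDeriv v f q + dirDeriv v g q :=
    fun v => funext fun q => dirDeriv_add hf hg v q
  simp only [grushin, h, dirDeriv_add (contDiff_dirDeriv hf _) (contDiff_dirDeriv hg _),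
    Finset.sum_add_distrib]
  ring

theorem grushin_const_mul {f : Space n → ℝ} (hf : ContDiff ℝ ∞ f) (c : ℝ) (p : Space n) :
    grushin (fun q => c * f q) p = c * grushin f p := by
  have h : ∀ v, dirDeriv v (fun q => c * f q) = fun q => c * dirDeriv v f q :=
    fun v => funext fun q => dirDeriv_const_mul hf c v q
  simp only [grushin, h, dirDeriv_const_mul (contDiff_dirDeriv hf _), ← Finset.mul_sum]
  ring

theorem contDiff_grushin {f : Space n → ℝ} (hf : ContDiff ℝ ∞ f) : ContDiff ℝ ∞ (grushin f) := by
  unfold grushin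
  refine (ContDiff.sum fun i _ => contDiff_dirDeriv (contDiff_dirDeriv hf _) _).add ?_
  exact contDiff_normSq_fst.mul (contDiff_dirDeriv (contDiff_dirDeriv hf _) _)

theorem euler_eq (f : Space n → ℝ) (p : Space n) :
    euler f p = ∑ i, p.1 i * dirDeriv (vecX i) f p + 2 * p.2 * dirDeriv vecT f p := by
  have h : ((p.1, 2 * p.2) : Space n) = ∑ i, p.1 i • vecX i + (2 * p.2) • vecT := by
    have h1 : p.1 = ∑ i, p.1 i • EuclideanSpace.single i (1 : ℝ) := by
      ext j; simp [Finset.sum_apply, Pi.single_apply]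
    refine Prod.ext ?_ ?_
    · simp only [vecX, vecT, Prod.fst_add, Prod.fst_sum, Prod.smul_fst, smul_zero, add_zero]
      exact h1
    · simp [vecX, vecT, Prod.snd_sum]
  simp only [euler, h, map_add, map_sum, map_smul, smul_eq_mul, dirDeriv]

theorem carre_comp {f g : Space n → ℝ} (hf : ContDiff ℝ ∞ f) {χ : ℝ → ℝ} (hχ : ContDiff ℝ ∞ χ)
    (p : Space n) : carre (fun q => χ (f q)) g p = deriv χ (f p) * carre f g p := by
  simp only [carre, dirDeriv_comp hf hχ, mul_add, Finset.mul_sum]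
  congr 1
  · exact Finset.sum_congr rfl fun i _ => by ring
  · ring

theorem grushin_comp {f : Space n → ℝ} (hf : ContDiff ℝ ∞ f) {χ : ℝ → ℝ} (hχ : ContDiff ℝ ∞ χ)
    (p : Space n) : grushin (fun q => χ (f q)) p =
      deriv (deriv χ) (f p) * carre f f p + deriv χ (f p) * grushin f p := by
  have hχ' : ContDiff ℝ ∞ (deriv χ) := hχ.deriv'
  have h : ∀ v, dirDeriv v (fun q => χ (f q)) = fun q => deriv χ (f q) * dirDeriv v f q :=
    fun v => funext fun q => dirDeriv_comp hf hχ v q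
  simp only [grushin, carre, h]
  simp only [dirDeriv_mul (f := fun q => deriv χ (f q)) (hχ'.comp hf) (contDiff_dirDeriv hf _),
    dirDeriv_comp hf hχ', mul_add, Finset.mul_sum, Finset.sum_add_distrib, mul_assoc]
  ring

/-! ### Explicit derivatives of |x|², t and ϱ⁴. -/

theorem dirDeriv_vecX_normSq (i : Fin n) (p : Space n) :
    dirDeriv (vecX i) (fun q => ‖q.1‖ ^ 2) p = 2 * p.1 i := by
  have h : HasFDerivAt (fun q : Space n => ‖q.1‖ ^ 2) _ p :=
    (hasFDerivAt_fst (𝕜 := ℝ) (p := p)).norm_sq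
  rw [dirDeriv, h.fderiv]
  simp [vecX, EuclideanSpace.inner_single_right]

theorem dirDeriv_vecT_normSq (p : Space n) :
    dirDeriv vecT (fun q : Space n => ‖q.1‖ ^ 2) p = 0 := by
  have h : HasFDerivAt (fun q : Space n => ‖q.1‖ ^ 2) _ p :=
    (hasFDerivAt_fst (𝕜 := ℝ) (p := p)).norm_sq
  rw [dirDeriv, h.fderiv]
  simp [vecT]

theorem dirDeriv_vecX_snd (i : Fin n) (p : Space n) : dirDeriv (vecX i) (fun q => q.2) p = 0 := by
  simp [dirDeriv, vecX, fderiv_snd]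

theorem dirDeriv_vecT_snd (p : Space n) : dirDeriv vecT (fun q : Space n => q.2) p = 1 := by
  simp [dirDeriv, vecT, fderiv_snd]

theorem dirDeriv_vecX_coord (i j : Fin n) (p : Space n) :
    dirDeriv (vecX i) (fun q => q.1 j) p = if i = j then 1 else 0 := by
  have h : HasFDerivAt (fun q : Space n => q.1 j)
      ((EuclideanSpace.proj j : EuclideanSpace ℝ (Fin n) →L[ℝ] ℝ) ∘L (ContinuousLinearMap.fst ℝ _ ℝ)) p :=
    ((EuclideanSpace.proj j : EuclideanSpace ℝ (Fin n) →L[ℝ] ℝ) ∘L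
      (ContinuousLinearMap.fst ℝ _ ℝ)).hasFDerivAt
  rw [dirDeriv, h.fderiv]
  simp [vecX, eq_comm]

theorem dirDeriv_vecT_coord (j : Fin n) (p : Space n) :
    dirDeriv vecT (fun q : Space n => q.1 j) p = 0 := by
  have h : HasFDerivAt (fun q : Space n => q.1 j)
      ((EuclideanSpace.proj j : EuclideanSpace ℝ (Fin n) →L[ℝ] ℝ) ∘L (ContinuousLinearMap.fst ℝ _ ℝ)) p :=
    ((EuclideanSpace.proj j : EuclideanSpace ℝ (Fin n) →L[ℝ] ℝ) ∘L
      (ContinuousLinearMap.fst ℝ _ ℝ)).hasFDerivAt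
  rw [dirDeriv, h.fderiv]
  simp [vecT]

theorem quartic_eq : quartic (n := n) = fun p => ‖p.1‖ ^ 2 * ‖p.1‖ ^ 2 + 4 * (p.2 * p.2) := by
  funext p; simp only [quartic]; ring

theorem dirDeriv_quartic (v p : Space n) : dirDeriv v quartic p =
    2 * ‖p.1‖ ^ 2 * dirDeriv v (fun q => ‖q.1‖ ^ 2) p + 8 * p.2 * dirDeriv v (fun q => q.2) p := by
  have h1 := contDiff_normSq_fst (n := n)
  have h2 : ContDiff ℝ ∞ (fun q : Space n => q.2) := contDiff_snd
  rw [quartic_eq, dirDeriv_add (h1.mul h1) (contDiff_const.mul (h2.mul h2)), dirDeriv_mul h1 h1,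
    dirDeriv_const_mul (h2.mul h2), dirDeriv_mul h2 h2]
  ring

theorem dirDeriv_vecX_quartic (i : Fin n) (p : Space n) :
    dirDeriv (vecX i) quartic p = 4 * ‖p.1‖ ^ 2 * p.1 i := by
  rw [dirDeriv_quartic, dirDeriv_vecX_normSq, dirDeriv_vecX_snd]; ring

theorem dirDeriv_vecT_quartic (p : Space n) : dirDeriv vecT quartic p = 8 * p.2 := by
  rw [dirDeriv_quartic, dirDeriv_vecT_normSq, dirDeriv_vecT_snd]; ring

theorem contDiff_coord (i : Fin n) : ContDiff ℝ ∞ (fun q : Space n => q.1 i) := by fun_prop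

theorem norm_sq_fst (p : Space n) : ‖p.1‖ ^ 2 = ∑ i, p.1 i ^ 2 := by
  rw [EuclideanSpace.norm_sq_eq]; simp

/-- The horizontal gradient of ϱ⁴ is (4|x|²x, 8t|x|), so pairing with it produces exactly the Euler
field. This is what keeps angular derivatives out of L_G(χ(ϱ⁴)H). -/
theorem carre_quartic (f : Space n → ℝ) (p : Space n) :
    carre quartic f p = 4 * ‖p.1‖ ^ 2 * euler f p := by
  simp only [carre, dirDeriv_vecX_quartic, dirDeriv_vecT_quartic, euler_eq, mul_add, Finset.mul_sum]
  congr 1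
  · exact Finset.sum_congr rfl fun i _ => by ring
  · ring

theorem euler_quartic (p : Space n) : euler quartic p = 4 * quartic p := by
  rw [euler_eq]
  simp only [dirDeriv_vecX_quartic, dirDeriv_vecT_quartic]
  have : ∑ i, p.1 i * (4 * ‖p.1‖ ^ 2 * p.1 i) = 4 * ‖p.1‖ ^ 2 * ‖p.1‖ ^ 2 := by
    nth_rewrite 3 [norm_sq_fst]
    rw [Finset.mul_sum]
    exact Finset.sum_congr rfl fun i _ => by ring
  rw [this, quartic]; ring

theorem grushin_quartic (p : Space n) : grushin quartic p = (4 * n + 16) * ‖p.1‖ ^ 2 := by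
  have hX : ∀ i, dirDeriv (vecX i) (quartic (n := n)) = fun q => 4 * (‖q.1‖ ^ 2 * q.1 i) :=
    fun i => funext fun q => by rw [dirDeriv_vecX_quartic]; ring
  have hT : dirDeriv vecT (quartic (n := n)) = fun q => 8 * q.2 :=
    funext fun q => dirDeriv_vecT_quartic q
  have h1 := contDiff_normSq_fst (n := n)
  have h2 : ContDiff ℝ ∞ (fun q : Space n => q.2) := contDiff_snd
  simp only [grushin, hX, hT, dirDeriv_const_mul h2, dirDeriv_vecT_snd,
    dirDeriv_const_mul (h1.mul (contDiff_coord _)), dirDeriv_mul h1 (contDiff_coord _),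
    dirDeriv_vecX_normSq, dirDeriv_vecX_coord]
  simp only [if_true, mul_add, Finset.sum_add_distrib]
  have : ∑ i, 4 * (2 * p.1 i * p.1 i) = 8 * ‖p.1‖ ^ 2 := by
    rw [norm_sq_fst, Finset.mul_sum]
    exact Finset.sum_congr rfl fun i _ => by ring
  rw [this]
  simp
  ring

theorem carre_snd (f : Space n → ℝ) (p : Space n) :
    carre (fun q => q.2) f p = ‖p.1‖ ^ 2 * dirDeriv vecT f p := by
  simp [carre, dirDeriv_vecX_snd, dirDeriv_vecT_snd]

theorem grushin_snd (p : Space n) : grushin (fun q : Space n => q.2) p = 0 := by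
  have h1 : ∀ i, dirDeriv (vecX i) (fun q : Space n => q.2) = fun _ => 0 :=
    fun i => funext (dirDeriv_vecX_snd i)
  have h2 : dirDeriv vecT (fun q : Space n => q.2) = fun _ => 1 := funext dirDeriv_vecT_snd
  simp [grushin, h1, h2, dirDeriv_const]

/-- The Grushin operator on `χ(ϱ⁴) H` for an `L_G`-harmonic `H` of degree `k`. -/
theorem grushin_comp_quartic_mul {k : ℕ} {H : Space n → ℝ} (hH : ContDiff ℝ ∞ H)
    (hE : ∀ p, euler H p = k * H p) (hL : ∀ p, grushin H p = 0)
    {χ : ℝ → ℝ} (hχ : ContDiff ℝ ∞ χ) (p : Space n) :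
    grushin (fun q => χ (quartic q) * H q) p = ‖p.1‖ ^ 2 * H p *
      (16 * quartic p * deriv (deriv χ) (quartic p)
        + (4 * n + 16 + 8 * k) * deriv χ (quartic p)) := by
  -- The term 16ϱ⁴χ'' is Γ(ϱ⁴, ϱ⁴) = 4|x|²·4ϱ⁴, the coefficient 4n + 16 is L_G ϱ⁴/|x|², and 8k is
  -- the cross term 2Γ(ϱ⁴, H) = 8|x|²·kH.
  rw [grushin_mul (f := fun q => χ (quartic q)) (hχ.comp contDiff_quartic) hH, hL,
    grushin_comp contDiff_quartic hχ, carre_comp contDiff_quartic hχ, carre_quartic, carre_quartic,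
    hE, euler_quartic, grushin_quartic]
  ring

/-! ### Integration by parts and symmetry of the Grushin operator. -/

theorem hasCompactSupport_dirDeriv {f : Space n → ℝ} (hc : HasCompactSupport f) (v : Space n) :
    HasCompactSupport (dirDeriv v f) := by
  unfold dirDeriv
  exact hc.fderiv_apply ℝ v

instance : (volume : Measure (Space n)).IsAddHaarMeasure :=
  Measure.prod.instIsAddHaarMeasure _ _

theorem integral_dirDeriv_mul {f g : Space n → ℝ} (hf : ContDiff ℝ ∞ f) (hg : ContDiff ℝ ∞ g)
    (hc : HasCompactSupport f) (v : Space n) :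
    ∫ p, dirDeriv v f p * g p = - ∫ p, f p * dirDeriv v g p := by
  have hf' := contDiff_dirDeriv hf v
  have hg' := contDiff_dirDeriv hg v
  rw [eq_neg_iff_add_eq_zero, ← neg_eq_zero, neg_add, ← sub_eq_add_neg, sub_eq_zero]
  symm
  refine integral_mul_fderiv_eq_neg_fderiv_mul_of_integrable (f := f) (g := g) (v := v) ?_ ?_ ?_
    (fun x _ => hf.differentiable (by simp) x) (fun x _ => hg.differentiable (by simp) x)
  · exact (hf'.continuous.mul hg.continuous).integrable_of_hasCompactSupport
      ((hasCompactSupport_dirDeriv hc v).mul_right)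
  · exact (hf.continuous.mul hg'.continuous).integrable_of_hasCompactSupport hc.mul_right
  · exact (hf.continuous.mul hg.continuous).integrable_of_hasCompactSupport hc.mul_right

theorem integral_dirDeriv_dirDeriv_mul {f g : Space n → ℝ} (hf : ContDiff ℝ ∞ f)
    (hg : ContDiff ℝ ∞ g) (hc : HasCompactSupport f) (v : Space n) :
    ∫ p, dirDeriv v (dirDeriv v f) p * g p = ∫ p, f p * dirDeriv v (dirDeriv v g) p := by
  rw [integral_dirDeriv_mul (contDiff_dirDeriv hf v) hg (hasCompactSupport_dirDeriv hc v),
    integral_dirDeriv_mul hf (contDiff_dirDeriv hg v) hc, neg_neg]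

/-- The Grushin operator is symmetric. -/
theorem integral_grushin_mul {f g : Space n → ℝ} (hf : ContDiff ℝ ∞ f) (hg : ContDiff ℝ ∞ g)
    (hc : HasCompactSupport f) : ∫ p, grushin f p * g p = ∫ p, f p * grushin g p := by
  have h1 := contDiff_normSq_fst (n := n)
  -- The coefficient |x|² does not depend on t and hence passes through both t-derivatives.
  have hT : dirDeriv vecT (dirDeriv vecT fun q : Space n => ‖q.1‖ ^ 2 * g q) =
      fun q => ‖q.1‖ ^ 2 * dirDeriv vecT (dirDeriv vecT g) q := by
    have h : dirDeriv vecT (fun q : Space n => ‖q.1‖ ^ 2) = fun _ => 0 :=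
      funext dirDeriv_vecT_normSq
    funext q
    rw [dirDeriv_dirDeriv_mul h1 hg, h, dirDeriv_const]; ring
  have key := integral_dirDeriv_dirDeriv_mul hf (h1.mul hg) hc vecT
  rw [hT] at key
  have iL : ∀ v (w : Space n → ℝ), Continuous w →
      Integrable (fun p => dirDeriv v (dirDeriv v f) p * w p) := fun v w hw =>
    ((contDiff_dirDeriv (contDiff_dirDeriv hf v) v).continuous.mul hw).integrable_of_hasCompactSupport
      (hasCompactSupport_dirDeriv (hasCompactSupport_dirDeriv hc v) v).mul_right
  have iR : ∀ w : Space n → ℝ, Continuous w → Integrable (fun p => f p * w p) := fun w hw =>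
    (hf.continuous.mul hw).integrable_of_hasCompactSupport hc.mul_right
  have e1 : ∀ p, grushin f p * g p = ∑ i, dirDeriv (vecX i) (dirDeriv (vecX i) f) p * g p +
      dirDeriv vecT (dirDeriv vecT f) p * (‖p.1‖ ^ 2 * g p) := fun p => by
    rw [grushin, add_mul, Finset.sum_mul]; ring
  have e2 : ∀ p, f p * grushin g p = ∑ i, f p * dirDeriv (vecX i) (dirDeriv (vecX i) g) p +
      f p * (‖p.1‖ ^ 2 * dirDeriv vecT (dirDeriv vecT g) p) := fun p => by
    rw [grushin, mul_add, Finset.mul_sum]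
  simp only [e1, e2]
  rw [integral_add, integral_add, integral_finsetSum, integral_finsetSum, key]
  · congr 1
    exact Finset.sum_congr rfl fun i _ => integral_dirDeriv_dirDeriv_mul hf hg hc _
  · exact fun i _ => iR _ (contDiff_dirDeriv (contDiff_dirDeriv hg _) _).continuous
  · exact fun i _ => iL _ _ hg.continuous
  · exact integrable_finsetSum _ fun i _ =>
      iR _ (contDiff_dirDeriv (contDiff_dirDeriv hg _) _).continuous
  · exact iR _ (h1.continuous.mul (contDiff_dirDeriv (contDiff_dirDeriv hg _) _).continuous)
  · exact integrable_finsetSum _ fun i _ => iL _ _ hg.continuous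
  · exact iL _ _ (h1.continuous.mul hg.continuous)

/-! ### The operators of the statement in terms of directional derivatives, the homogeneous norm and
dilations. -/

theorem grushinOp_eq {f : Space n → ℝ} (hf : ContDiff ℝ ∞ f) : grushinOp f = grushin f := by
  have hd : ∀ g : Space n → ℝ, ContDiff ℝ ∞ g → ∀ (p : Space n) (v : EuclideanSpace ℝ (Fin n)),
      fderiv ℝ (fun y => g (y, p.2)) p.1 v = dirDeriv (v, 0) g p := fun g hg p v => by
    have h1 := (hg.differentiable (by simp) p).hasFDerivAt
    have h2 : HasFDerivAt (fun y : EuclideanSpace ℝ (Fin n) => (y, p.2))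
      (ContinuousLinearMap.inl ℝ _ ℝ) p.1 := hasFDerivAt_prodMk_left p.1 p.2
    have h3 := (HasFDerivAt.comp (g := g) (f := fun y => (y, p.2)) p.1 h1 h2).fderiv
    simp only [Function.comp_def] at h3
    rw [h3]; simp [dirDeriv]
  have ht : ∀ g : Space n → ℝ, ContDiff ℝ ∞ g → ∀ (p : Space n),
      deriv (fun s => g (p.1, s)) p.2 = dirDeriv vecT g p := fun g hg p => by
    have h1 := (hg.differentiable (by simp) p).hasFDerivAt
    have h2 : HasDerivAt (fun s : ℝ => (p.1, s)) (0, 1) p.2 :=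
      (hasDerivAt_const _ _).prodMk (hasDerivAt_id _)
    have h3 := (HasFDerivAt.comp_hasDerivAt (f := fun s => (p.1, s)) p.2 h1 h2).deriv
    simp only [Function.comp_def] at h3
    rw [h3]; rfl
  funext p
  have e1 : Laplacian.laplacian (fun y => f (y, p.2)) p.1
      = ∑ i, dirDeriv (vecX i) (dirDeriv (vecX i) f) p := by
    rw [InnerProductSpace.laplacian_eq_iteratedFDeriv_orthonormalBasis _ (EuclideanSpace.basisFun (Fin n) ℝ)]
    refine Finset.sum_congr rfl fun i _ => ?_
    rw [iteratedFDeriv_two_apply]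
    have hcd : ContDiff ℝ ∞ (fun y : EuclideanSpace ℝ (Fin n) => f (y, p.2)) := by fun_prop
    have hdd := (hcd.fderiv_right (m := ∞) (by simp)).differentiable (by simp) p.1
    simp only [Matrix.cons_val_zero, Matrix.cons_val_one, EuclideanSpace.basisFun_apply]
    have h4 : fderiv ℝ (fderiv ℝ fun y => f (y, p.2)) p.1 (EuclideanSpace.single i 1)
        (EuclideanSpace.single i 1) =
        fderiv ℝ (fun y => fderiv ℝ (fun y => f (y, p.2)) y (EuclideanSpace.single i 1)) p.1
          (EuclideanSpace.single i 1) := by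
      rw [fderiv_clm_apply hdd (by fun_prop)]; simp
    have h5 : (fun y => fderiv ℝ (fun y => f (y, p.2)) y (EuclideanSpace.single i 1)) =
        fun y => dirDeriv (vecX i) f (y, p.2) := funext fun y => hd f hf (y, p.2) _
    rw [h4, h5]
    exact hd _ (contDiff_dirDeriv hf (vecX i)) p _
  have e2 : iteratedDeriv 2 (fun s => f (p.1, s)) p.2 = dirDeriv vecT (dirDeriv vecT f) p := by
    rw [iteratedDeriv_succ, iteratedDeriv_one, ← ht _ (contDiff_dirDeriv hf vecT)]
    congr 1
    funext s
    exact ht f hf (p.1, s)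
  rw [grushinOp, grushin, e1, e2]

theorem quartic_nonneg (p : Space n) : 0 ≤ quartic p := by unfold quartic; positivity

theorem rho_eq (p : Space n) : rho p = quartic p ^ (1 / 4 : ℝ) := rfl

theorem rho_nonneg (p : Space n) : 0 ≤ rho p := Real.rpow_nonneg (quartic_nonneg p) _

theorem rho_pow_four (p : Space n) : rho p ^ 4 = quartic p := by
  rw [rho_eq, ← Real.rpow_natCast, ← Real.rpow_mul (quartic_nonneg p)]; norm_num

theorem continuous_rho : Continuous (rho (n := n)) := by
  have : rho (n := n) = fun p => quartic p ^ (1 / 4 : ℝ) := rfl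
  rw [this]
  exact contDiff_quartic.continuous.rpow_const fun _ => Or.inr (by norm_num)

theorem rho_pos {p : Space n} (hp : p ≠ 0) : 0 < rho p := by
  refine Real.rpow_pos_of_pos ?_ _
  by_contra h
  have h1 : ‖p.1‖ ^ 4 = 0 := by nlinarith [sq_nonneg p.2, sq_nonneg (‖p.1‖ ^ 2)]
  have h2 : p.2 ^ 2 = 0 := by nlinarith [sq_nonneg p.2, sq_nonneg (‖p.1‖ ^ 2)]
  exact hp (Prod.ext (by simpa using h1) (by simpa using h2))

theorem rho_pos_of_fst {p : Space n} (hp : p.1 ≠ 0) : 0 < rho p :=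
  rho_pos fun h => hp (by rw [h]; rfl)

theorem quartic_dil (s : ℝ) (p : Space n) : quartic (dil s p) = s ^ 4 * quartic p := by
  simp only [quartic, dil, norm_smul, mul_pow, Real.norm_eq_abs]
  rw [show |s| ^ 4 = s ^ 4 from (by decide : Even 4).pow_abs s]; ring

theorem rho_eq_of_pow_four {p : Space n} {s : ℝ} (hs : 0 ≤ s) (h : quartic p = s ^ 4) :
    rho p = s := by
  rw [rho_eq, h, ← Real.rpow_natCast, ← Real.rpow_mul hs]; norm_num

theorem rho_dil {s : ℝ} (hs : 0 ≤ s) (p : Space n) : rho (dil s p) = s * rho p := by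
  refine rho_eq_of_pow_four (mul_nonneg hs (rho_nonneg p)) ?_
  rw [quartic_dil, mul_pow, rho_pow_four]

theorem dil_dil (s r : ℝ) (p : Space n) : dil s (dil r p) = dil (s * r) p := by
  simp only [dil, smul_smul]; ring_nf

theorem dil_one (p : Space n) : dil 1 p = p := by simp [dil]

theorem continuous_dil : Continuous (fun q : ℝ × Space n => dil q.1 q.2) := by
  unfold dil; fun_prop

/-- `ψ = |x|² / ϱ²`. -/
theorem psi_eq {p : Space n} (hp : p.1 ≠ 0) : psi p = ‖p.1‖ ^ 2 / rho p ^ 2 := by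
  have hr : 0 < rho p := rho_pos_of_fst hp
  have hq : 0 < quartic p := by rw [← rho_pow_four]; positivity
  have hr3 : quartic p ^ (1 / 4 - 1 : ℝ) = (rho p ^ 3)⁻¹ := by
    rw [rho_eq, ← Real.rpow_natCast, ← Real.rpow_mul hq.le, ← Real.rpow_neg hq.le]; norm_num
  have h1 : HasGradientAt (fun y => rho (y, p.2)) ((‖p.1‖ ^ 2 / rho p ^ 3) • p.1) p.1 := by
    rw [hasGradientAt_iff_hasFDerivAt]
    have a := ((((hasStrictFDerivAt_norm_sq p.1).hasFDerivAt.pow 2).add_const (4 * p.2 ^ 2)))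
    have e : ∀ y : EuclideanSpace ℝ (Fin n), rho (y, p.2) = ((‖y‖ ^ 2) ^ 2 + 4 * p.2 ^ 2) ^ (1 / 4 : ℝ) := fun y => by
      simp only [rho]; ring_nf
    have e' : (‖p.1‖ ^ 2) ^ 2 + 4 * p.2 ^ 2 = quartic p := by simp only [quartic]; ring
    have b := a.rpow_const (p := (1 / 4 : ℝ)) (Or.inl (by
      show (‖p.1‖ ^ 2) ^ 2 + 4 * p.2 ^ 2 ≠ 0
      rw [e']; exact hq.ne'))
    simp only [e', hr3] at b
    refine (b.congr_of_eventuallyEq (Filter.Eventually.of_forall e)).congr_fderiv ?_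
    ext v
    simp
    field_simp
    norm_num
  have h2 : HasDerivAt (fun s => rho (p.1, s)) (2 * p.2 / rho p ^ 3) p.2 := by
    have a : HasDerivAt (fun s : ℝ => ‖p.1‖ ^ 4 + 4 * s ^ 2) (4 * (2 * p.2)) p.2 := by
      simpa using! ((hasDerivAt_pow 2 p.2).const_mul 4).const_add (‖p.1‖ ^ 4)
    have b := a.rpow_const (p := (1 / 4 : ℝ)) (Or.inl hq.ne')
    refine b.congr_deriv ?_
    rw [show ‖p.1‖ ^ 4 + 4 * p.2 ^ 2 = quartic p from rfl, hr3]
    field_simp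
  rw [psi, normGradSq, h1.gradient, h2.deriv, norm_smul, Real.norm_of_nonneg (by positivity)]
  have h4 := rho_pow_four p
  field_simp
  rw [quartic] at h4
  linear_combination -h4

/-- The orbit s ↦ δ_s p has velocity (x, 2st), which is 1/s times the Euler field at δ_s p. -/
theorem hasDerivAt_comp_dil {f : Space n → ℝ} (hf : ContDiff ℝ ∞ f) (p : Space n) {s : ℝ}
    (hs : s ≠ 0) : HasDerivAt (fun s => f (dil s p)) (euler f (dil s p) / s) s := by
  have h1 := (hf.differentiable (by simp) (dil s p)).hasFDerivAt
  have h2 : HasDerivAt (fun s => dil s p) (p.1, 2 * s * p.2) s := by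
    have a : HasDerivAt (fun s : ℝ => s • p.1) ((1 : ℝ) • p.1) s :=
      (hasDerivAt_id s).smul_const p.1
    have b : HasDerivAt (fun s : ℝ => s ^ 2 * p.2) (2 * s * p.2) s := by
      simpa using! (hasDerivAt_pow 2 s).mul_const p.2
    rw [one_smul] at a
    exact a.prodMk b
  refine (h1.comp_hasDerivAt s h2).congr_deriv ?_
  rw [euler, eq_div_iff hs, mul_comm, ← smul_eq_mul, ← map_smul]
  congr 1
  refine Prod.ext rfl ?_
  simp [dil]; ring

theorem radialDeriv_eq {f : Space n → ℝ} (hf : ContDiff ℝ ∞ f) {p : Space n} (hp : p ≠ 0) :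
    radialDeriv f p = euler f p / rho p := by
  have hr : rho p ≠ 0 := (rho_pos hp).ne'
  have h1 : HasDerivAt (fun s : ℝ => s / rho p) (1 / rho p) (rho p) :=
    (hasDerivAt_id _).div_const _
  have h2 := hasDerivAt_comp_dil hf p (s := rho p / rho p) (by rw [div_self hr]; simp)
  have h3 := (HasDerivAt.comp (h := fun s => s / rho p) (rho p) h2 h1).deriv
  simp only [Function.comp_def] at h3
  rw [radialDeriv, h3, div_self hr, dil_one]; ring

/-- With E = ϱ∂_ϱ one has ϱ²∂_ϱ² = E² − E, hence ϱ²(∂_ϱ² + ((Q − 1)/ϱ)∂_ϱ) = E² + (Q − 2)E, and Q −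
2 = n. -/
theorem radialGrushinOp_eq {f : Space n → ℝ} (hf : ContDiff ℝ ∞ f) {p : Space n} (hp : p ≠ 0) :
    radialGrushinOp f p = psi p * ((euler (euler f) p + n * euler f p) / rho p ^ 2) := by
  have hr0 := rho_pos hp
  have hr : rho p ≠ 0 := hr0.ne'
  have h1 : HasDerivAt (fun s : ℝ => s / rho p) (1 / rho p) (rho p) :=
    (hasDerivAt_id _).div_const _
  have h2 := hasDerivAt_comp_dil (contDiff_euler hf) p (s := rho p / rho p)
    (by rw [div_self hr]; simp)
  have h3 := (HasDerivAt.comp (h := fun s => s / rho p) (rho p) h2 h1).div (hasDerivAt_id (rho p)) hr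
  have h4 : radialDeriv (radialDeriv f) p = euler (euler f) p / rho p ^ 2 - euler f p / rho p ^ 2 := by
    rw [radialDeriv]
    -- The outer derivative requires the formula for the inner one along a neighbourhood of s = ϱ(p)
    -- on the orbit, where ϱ(δ_{s/ϱ(p)} p) = s.
    have e : (fun s => radialDeriv f (dil (s / rho p) p)) =ᶠ[nhds (rho p)]
        fun s => euler f (dil (s / rho p) p) / s := by
      filter_upwards [lt_mem_nhds hr0] with s hs
      have hs' : rho (dil (s / rho p) p) = s := by
        rw [rho_dil (by positivity)]; field_simp
      rw [radialDeriv_eq hf, hs']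
      rintro h
      rw [h] at hs'
      simp [rho] at hs'
      exact hs.ne hs'
    rw [e.deriv_eq]
    refine Eq.trans h3.deriv ?_
    simp only [Function.comp_def, div_self hr, dil_one, id]
    field_simp
  rw [radialGrushinOp, h4, radialDeriv_eq hf hp, homDim]
  push_cast
  field_simp
  ring

/-! ### Homogeneous harmonic extensions of the elements of H_k. -/

/-- `L_G`-harmonic functions that are homogeneous of degree `k` for the dilations. -/
structure IsGrushinHarmonic (k : ℕ) (H : Space n → ℝ) : Prop where
  contDiff : ContDiff ℝ ∞ H
  dil_eq : ∀ s p, H (dil s p) = s ^ k * H p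
  grushin_eq : ∀ p, grushin H p = 0

theorem euler_of_homogeneous {k : ℕ} {H : Space n → ℝ} (hH : ContDiff ℝ ∞ H)
    (hd : ∀ s p, H (dil s p) = s ^ k * H p) (p : Space n) : euler H p = k * H p := by
  have h1 := hasDerivAt_comp_dil hH p (s := 1) one_ne_zero
  have h2 : HasDerivAt (fun s : ℝ => H (dil s p)) (k * H p) 1 := by
    simp only [hd]
    simpa using! (hasDerivAt_pow k (1 : ℝ)).mul_const (H p)
  have := h1.unique h2
  rwa [div_one, dil_one] at this

theorem IsGrushinHarmonic.euler_eq {k : ℕ} {H : Space n → ℝ} (hH : IsGrushinHarmonic k H)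
    (p : Space n) : euler H p = k * H p := euler_of_homogeneous hH.contDiff hH.dil_eq p

/-- The homogeneous Gegenbauer polynomial `N^{m/2} C_m^α(2 t / N^{1/2})`. -/
def solidGegenbauer (α t N : ℝ) : ℕ → ℝ
  | 0 => 1
  | 1 => 4 * α * t
  | m + 2 => (4 * t * ((m : ℝ) + 1 + α) * solidGegenbauer α t N (m + 1)
      - ((m : ℝ) + 2 * α) * N * solidGegenbauer α t N m) / ((m : ℝ) + 2)

/-- The homogeneous extension of `harmonicFn l m Y`. -/
def solidHarm (l m : ℕ) (Y : MvPolynomial (Fin n) ℝ) (p : Space n) : ℝ :=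
  solidGegenbauer ((l : ℝ) / 2 + (n : ℝ) / 4) p.2 (quartic p) m *
    MvPolynomial.eval (fun i => p.1 i) Y

theorem solidGegenbauer_one (α t : ℝ) : ∀ m, solidGegenbauer α t 1 m = gegenbauer α (2 * t) m
  | 0 => rfl
  | 1 => by simp only [solidGegenbauer, gegenbauer]; ring
  | m + 2 => by
    simp only [solidGegenbauer, gegenbauer, solidGegenbauer_one α t (m + 1),
      solidGegenbauer_one α t m]
    ring

theorem solidGegenbauer_smul (α t N s : ℝ) :
    ∀ m, solidGegenbauer α (s ^ 2 * t) (s ^ 4 * N) m = s ^ (2 * m) * solidGegenbauer α t N m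
  | 0 => by simp [solidGegenbauer]
  | 1 => by simp only [solidGegenbauer]; ring
  | m + 2 => by
    simp only [solidGegenbauer, solidGegenbauer_smul α t N s (m + 1),
      solidGegenbauer_smul α t N s m]
    ring

theorem solidHarm_of_quartic_eq_one (l m : ℕ) (Y : MvPolynomial (Fin n) ℝ) {p : Space n}
    (hp : quartic p = 1) : solidHarm l m Y p = harmonicFn l m Y p := by
  rw [solidHarm, hp, solidGegenbauer_one, harmonicFn]

theorem eval_smul_of_isHomogeneous {l : ℕ} {Y : MvPolynomial (Fin n) ℝ} (hY : Y.IsHomogeneous l)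
    (s : ℝ) (x : Fin n → ℝ) :
    MvPolynomial.eval (fun i => s * x i) Y = s ^ l * MvPolynomial.eval x Y := by
  rw [MvPolynomial.eval_eq, MvPolynomial.eval_eq, Finset.mul_sum]
  refine Finset.sum_congr rfl fun d hd => ?_
  have hl : ∑ i ∈ d.support, d i = l := by
    rw [← Finsupp.degree_apply, Finsupp.degree_eq_weight_one]
    exact hY (by simpa using hd)
  rw [← hl]
  simp only [mul_pow, Finset.prod_mul_distrib, Finset.prod_pow_eq_pow_sum]
  ring

theorem contDiff_eval (Y : MvPolynomial (Fin n) ℝ) :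
    ContDiff ℝ ∞ (fun p : Space n => MvPolynomial.eval (fun i => p.1 i) Y) := by
  induction Y using MvPolynomial.induction_on with
  | C a => simpa using contDiff_const
  | add p q hp hq => simpa using hp.add hq
  | mul_X p i hp => simpa using hp.mul (contDiff_coord i)

theorem dirDeriv_vecX_eval (i : Fin n) (Y : MvPolynomial (Fin n) ℝ) (p : Space n) :
    dirDeriv (vecX i) (fun p => MvPolynomial.eval (fun i => p.1 i) Y) p =
      MvPolynomial.eval (fun i => p.1 i) (MvPolynomial.pderiv i Y) := by
  induction Y using MvPolynomial.induction_on with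
  | C a => simp [dirDeriv_const]
  | add q r hq hr =>
    simp only [map_add]
    rw [dirDeriv_add (contDiff_eval q) (contDiff_eval r), hq, hr]
  | mul_X q j hq =>
    simp only [map_mul, MvPolynomial.eval_X, MvPolynomial.pderiv_mul, MvPolynomial.pderiv_X, map_add]
    rw [dirDeriv_mul (contDiff_eval q) (contDiff_coord j), hq, dirDeriv_vecX_coord]
    by_cases h : i = j
    · subst h; simp; ring
    · simp [h, Ne.symm h]

theorem dirDeriv_vecT_eval (Y : MvPolynomial (Fin n) ℝ) (p : Space n) :
    dirDeriv vecT (fun p : Space n => MvPolynomial.eval (fun i => p.1 i) Y) p = 0 := by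
  induction Y using MvPolynomial.induction_on with
  | C a => simp [dirDeriv_const]
  | add q r hq hr =>
    simp only [map_add]
    rw [dirDeriv_add (contDiff_eval q) (contDiff_eval r), hq, hr, add_zero]
  | mul_X q j hq =>
    simp only [map_mul, MvPolynomial.eval_X]
    rw [dirDeriv_mul (contDiff_eval q) (contDiff_coord j), hq, dirDeriv_vecT_coord]
    ring

theorem grushin_eval {l : ℕ} {Y : MvPolynomial (Fin n) ℝ} (hY : IsSolidHarmonic l Y) (p : Space n) :
    grushin (fun p => MvPolynomial.eval (fun i => p.1 i) Y) p = 0 := by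
  have hX : ∀ i, dirDeriv (vecX i) (fun p : Space n => MvPolynomial.eval (fun i => p.1 i) Y) =
      fun p => MvPolynomial.eval (fun i => p.1 i) (MvPolynomial.pderiv i Y) :=
    fun i => funext (dirDeriv_vecX_eval i Y)
  have hT : dirDeriv vecT (fun p : Space n => MvPolynomial.eval (fun i => p.1 i) Y) = fun _ => 0 :=
    funext (dirDeriv_vecT_eval Y)
  simp only [grushin, hX, hT, dirDeriv_const, dirDeriv_vecX_eval]
  rw [← map_sum, hY.2]; simp

theorem solidHarm_zero (l : ℕ) (Y : MvPolynomial (Fin n) ℝ) :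
    solidHarm l 0 Y = fun p => MvPolynomial.eval (fun i => p.1 i) Y := by
  funext p; simp [solidHarm, solidGegenbauer]

theorem solidHarm_one (l : ℕ) (Y : MvPolynomial (Fin n) ℝ) :
    solidHarm l 1 Y = fun p => 4 * ((l : ℝ) / 2 + (n : ℝ) / 4) * (p.2 * solidHarm l 0 Y p) := by
  funext p; simp only [solidHarm, solidGegenbauer]; ring

theorem solidHarm_add_two (l m : ℕ) (Y : MvPolynomial (Fin n) ℝ) :
    solidHarm l (m + 2) Y = fun p =>
      4 * ((m : ℝ) + 1 + ((l : ℝ) / 2 + (n : ℝ) / 4)) / ((m : ℝ) + 2) *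
        (p.2 * solidHarm l (m + 1) Y p) +
      -(((m : ℝ) + 2 * ((l : ℝ) / 2 + (n : ℝ) / 4)) / ((m : ℝ) + 2)) *
        (quartic p * solidHarm l m Y p) := by
  funext p; simp only [solidHarm, solidGegenbauer]; ring

theorem contDiff_snd' : ContDiff ℝ ∞ (fun q : Space n => q.2) := contDiff_snd

theorem contDiff_solidHarm (l : ℕ) (Y : MvPolynomial (Fin n) ℝ) :
    ∀ m, ContDiff ℝ ∞ (solidHarm l m Y)
  | 0 => by rw [solidHarm_zero]; exact contDiff_eval Y
  | 1 => by
    rw [solidHarm_one, solidHarm_zero]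
    exact contDiff_const.mul (contDiff_snd'.mul (contDiff_eval Y))
  | m + 2 => by
    rw [solidHarm_add_two]
    exact (contDiff_const.mul (contDiff_snd'.mul (contDiff_solidHarm l Y (m + 1)))).add
      (contDiff_const.mul (contDiff_quartic.mul (contDiff_solidHarm l Y m)))

theorem solidHarm_dil {l : ℕ} (m : ℕ) {Y : MvPolynomial (Fin n) ℝ} (hY : Y.IsHomogeneous l)
    (s : ℝ) (p : Space n) : solidHarm l m Y (dil s p) = s ^ (l + 2 * m) * solidHarm l m Y p := by
  have h : (fun i => (dil s p).1 i) = fun i => s * p.1 i := by funext i; simp [dil]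
  rw [solidHarm, quartic_dil, h, eval_smul_of_isHomogeneous hY, solidHarm]
  change solidGegenbauer _ (s ^ 2 * p.2) _ _ * _ = _
  rw [solidGegenbauer_smul]
  ring

/-- Here x is fixed while N = |x|⁴ + 4t² varies with t, so differentiation lowers the index and
keeps the parameter α, unlike the classical rule for C_m^α. It reflects the generating function ((1
− 2tz)² + |x|⁴z²)^{−α}; the proof is a two-step induction on the recurrence. -/
theorem dirDeriv_vecT_solidHarm (l : ℕ) (Y : MvPolynomial (Fin n) ℝ) : ∀ m (p : Space n),
    dirDeriv vecT (solidHarm l (m + 1) Y) p =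
      2 * ((m : ℝ) + 2 * ((l : ℝ) / 2 + (n : ℝ) / 4)) * solidHarm l m Y p := by
  set α := (l : ℝ) / 2 + (n : ℝ) / 4 with hα
  have hc := contDiff_solidHarm l Y
  have h0 : ∀ p : Space n, dirDeriv vecT (solidHarm l 0 Y) p = 0 := fun p => by
    rw [solidHarm_zero]; exact dirDeriv_vecT_eval Y p
  have h1 : ∀ p : Space n, dirDeriv vecT (solidHarm l (0 + 1) Y) p =
      2 * (((0 : ℕ) : ℝ) + 2 * α) * solidHarm l 0 Y p := fun p => by
    rw [zero_add, solidHarm_one, dirDeriv_const_mul (contDiff_snd'.mul (hc 0)),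
      dirDeriv_mul contDiff_snd' (hc 0), h0, dirDeriv_vecT_snd]
    push_cast; ring
  have hrec : ∀ m (p : Space n), dirDeriv vecT (solidHarm l (m + 2) Y) p =
      4 * ((m : ℝ) + 1 + α) / ((m : ℝ) + 2) *
        (p.2 * dirDeriv vecT (solidHarm l (m + 1) Y) p + solidHarm l (m + 1) Y p) +
      -(((m : ℝ) + 2 * α) / ((m : ℝ) + 2)) *
        (quartic p * dirDeriv vecT (solidHarm l m Y) p + 8 * p.2 * solidHarm l m Y p) := by
    intro m p
    rw [solidHarm_add_two, dirDeriv_add (contDiff_const.mul (contDiff_snd'.mul (hc _)))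
      (contDiff_const.mul (contDiff_quartic.mul (hc _))),
      dirDeriv_const_mul (contDiff_snd'.mul (hc _)),
      dirDeriv_const_mul (contDiff_quartic.mul (hc _)), dirDeriv_mul contDiff_snd' (hc _),
      dirDeriv_mul contDiff_quartic (hc _), dirDeriv_vecT_snd, dirDeriv_vecT_quartic, one_mul]
  intro m
  induction m using Nat.twoStepInduction with
  | zero => exact h1
  | one =>
    intro p
    rw [show 1 + 1 = 0 + 2 from rfl, hrec, h1, h0, zero_add, solidHarm_one]
    push_cast
    field_simp
    ring
  | more m ih1 ih2 =>
    intro p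
    rw [show m + 2 + 1 = (m + 1) + 2 from rfl, hrec, ih1, show m + 1 + 1 = m + 2 from rfl,
      show dirDeriv vecT (solidHarm l (m + 2) Y) p = _ from ih2 p, solidHarm_add_two]
    push_cast
    have : (m : ℝ) + 1 + 2 ≠ 0 := by positivity
    have : (m : ℝ) + 2 ≠ 0 := by positivity
    field_simp
    ring

/-- Apply L_G to the three-term recurrence. The term with t gives 2|x|²∂_t of the previous function,
known from `dirDeriv_vecT_solidHarm`; the term with ϱ⁴ gives |x|²(4n + 16 + 8(l + 2m)). They cancel
because 16(m + 1 + α) = 4n + 16 + 8(l + 2m), which is what singles out α = l/2 + n/4. -/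
theorem grushin_solidHarm {l : ℕ} {Y : MvPolynomial (Fin n) ℝ} (hY : IsSolidHarmonic l Y) :
    ∀ m (p : Space n), grushin (solidHarm l m Y) p = 0
  | 0, p => by rw [solidHarm_zero]; exact grushin_eval hY p
  | 1, p => by
    have h0 : ∀ p : Space n, dirDeriv vecT (solidHarm l 0 Y) p = 0 := fun p => by
      rw [solidHarm_zero]; exact dirDeriv_vecT_eval Y p
    rw [solidHarm_one, grushin_const_mul (contDiff_snd'.mul (contDiff_solidHarm l Y 0)),
      grushin_mul contDiff_snd' (contDiff_solidHarm l Y 0), grushin_snd, carre_snd, h0,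
      grushin_solidHarm hY 0]
    ring
  | m + 2, p => by
    have hc := contDiff_solidHarm l Y
    rw [solidHarm_add_two, grushin_add (contDiff_const.mul (contDiff_snd'.mul (hc _)))
      (contDiff_const.mul (contDiff_quartic.mul (hc _))),
      grushin_const_mul (contDiff_snd'.mul (hc _)), grushin_const_mul (contDiff_quartic.mul (hc _)),
      grushin_mul contDiff_snd' (hc _), grushin_mul contDiff_quartic (hc _),
      grushin_solidHarm hY (m + 1), grushin_solidHarm hY m, grushin_snd, carre_snd, carre_quartic,
      dirDeriv_vecT_solidHarm, euler_of_homogeneous (hc m) (solidHarm_dil m hY.1), grushin_quartic]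
    push_cast
    field_simp
    ring

/-- An element of `H_k` is the restriction to `Ω` of an `L_G`-harmonic function that is
homogeneous of degree `k`. -/
theorem exists_isGrushinHarmonic {k : ℕ} {h : Space n → ℝ} (hh : h ∈ sphHarm n k) :
    ∃ H, IsGrushinHarmonic k H ∧ ∀ p, quartic p = 1 → H p = h p := by
  induction hh using Submodule.span_induction with
  | mem x hx =>
    obtain ⟨l, m, Y, rfl, hY, rfl⟩ := hx
    exact ⟨solidHarm l m Y, ⟨contDiff_solidHarm l Y m, solidHarm_dil m hY.1, grushin_solidHarm hY m⟩,
      fun p hp => solidHarm_of_quartic_eq_one l m Y hp⟩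
  | zero =>
    -- The zero function is written as a product so that `grushin_const_mul` applies.
    refine ⟨fun _ => 0 * 0, ⟨contDiff_const, by simp, fun p => ?_⟩, by simp⟩
    rw [grushin_const_mul contDiff_const, zero_mul]
  | add x y _ _ hx hy =>
    obtain ⟨H, h1, h2⟩ := hx
    obtain ⟨K, k1, k2⟩ := hy
    refine ⟨fun p => H p + K p, ⟨h1.contDiff.add k1.contDiff, fun s p => ?_, fun p => ?_⟩,
      fun p hp => ?_⟩
    · simp only [h1.dil_eq, k1.dil_eq]; ring
    · rw [grushin_add h1.contDiff k1.contDiff, h1.grushin_eq, k1.grushin_eq, add_zero]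
    · simp [h2 p hp, k2 p hp]
  | smul a x _ hx =>
    obtain ⟨H, h1, h2⟩ := hx
    refine ⟨fun p => a * H p, ⟨contDiff_const.mul h1.contDiff, fun s p => ?_, fun p => ?_⟩,
      fun p hp => ?_⟩
    · simp only [h1.dil_eq]; ring
    · rw [grushin_const_mul h1.contDiff, h1.grushin_eq, mul_zero]
    · simp [h2 p hp]

/-! ### Polar coordinates p = δ_ϱ σ. -/

theorem lintegral_eq_lintegral_sphere {E : Type*} [NormedAddCommGroup E] [NormedSpace ℝ E]
    [FiniteDimensional ℝ E] [MeasurableSpace E] [BorelSpace E] [Nontrivial E] (μ : Measure E)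
    [μ.IsAddHaarMeasure] {g : E → ENNReal} (hg : Measurable g) :
    ∫⁻ x, g x ∂μ = ∫⁻ w, (∫⁻ r in Ioi (0 : ℝ),
      ENNReal.ofReal (r ^ (Module.finrank ℝ E - 1)) * g (r • (w : E))) ∂μ.toSphere := by
  have h0 : MeasurableSet ({0}ᶜ : Set E) := (measurableSet_singleton 0).compl
  have hm : Measurable fun z : Metric.sphere (0 : E) 1 × Ioi (0 : ℝ) => g ((z.2 : ℝ) • (z.1 : E)) :=
    hg.comp (by fun_prop)
  calc ∫⁻ x, g x ∂μ = ∫⁻ x : ({0}ᶜ : Set E), g x ∂(μ.comap (↑)) := by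
        rw [lintegral_subtype_comap h0, restrict_compl_singleton]
    _ = ∫⁻ x : ({0}ᶜ : Set E), (fun z : Metric.sphere (0 : E) 1 × Ioi (0 : ℝ) =>
          g ((z.2 : ℝ) • (z.1 : E))) (homeomorphUnitSphereProd E x) ∂(μ.comap (↑)) := by
        refine lintegral_congr fun x => ?_
        have hx : ‖(x : E)‖ ≠ 0 := norm_ne_zero_iff.2 x.2
        simp [smul_smul, mul_inv_cancel₀ hx]
    _ = ∫⁻ z, g ((z.2 : ℝ) • (z.1 : E)) ∂(μ.toSphere.prod
          (Measure.volumeIoiPow (Module.finrank ℝ E - 1))) :=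
        μ.measurePreserving_homeomorphUnitSphereProd.lintegral_comp hm
    _ = _ := by
        rw [lintegral_prod _ hm.aemeasurable]
        refine lintegral_congr fun w => ?_
        have hm' : Measurable fun r : Ioi (0 : ℝ) => g ((r : ℝ) • (w : E)) :=
          hg.comp (by fun_prop)
        simp only
        rw [Measure.volumeIoiPow, lintegral_withDensity_eq_lintegral_mul _ (by fun_prop) hm']
        exact lintegral_subtype_comap measurableSet_Ioi
          (fun r : ℝ => ENNReal.ofReal (r ^ (Module.finrank ℝ E - 1)) * g (r • (w : E)))

/-- The polar coordinates `(ϱ, φ) ↦ (|x|, t)`. -/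
def planePolar (q : ℝ × ℝ) : ℝ × ℝ := (q.1 * √(Real.sin q.2), q.1 ^ 2 * Real.cos q.2 / 2)

theorem sin_pos_of_mem {q : ℝ × ℝ} (hq : q ∈ Ioi (0 : ℝ) ×ˢ Ioo 0 Real.pi) : 0 < Real.sin q.2 :=
  Real.sin_pos_of_mem_Ioo hq.2

theorem planePolar_quartic {q : ℝ × ℝ} (hq : q ∈ Ioi (0 : ℝ) ×ˢ Ioo 0 Real.pi) :
    (planePolar q).1 ^ 4 + 4 * (planePolar q).2 ^ 2 = q.1 ^ 4 := by
  have h1 := Real.sq_sqrt (sin_pos_of_mem hq).le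
  have h2 := Real.sin_sq_add_cos_sq q.2
  simp only [planePolar]
  have h3 : √(Real.sin q.2) ^ 4 = Real.sin q.2 ^ 2 := by rw [show 4 = 2 * 2 from rfl, pow_mul, h1]
  rw [mul_pow, h3]
  linear_combination q.1 ^ 4 * h2

theorem injOn_planePolar : InjOn planePolar (Ioi (0 : ℝ) ×ˢ Ioo 0 Real.pi) := by
  intro q hq q' hq' h
  have h0 : 0 < q.1 := hq.1
  have h0' : 0 < q'.1 := hq'.1
  have h1 : q.1 = q'.1 := by
    have := planePolar_quartic hq
    rw [h, planePolar_quartic hq'] at this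
    exact (pow_left_inj₀ h0'.le h0.le (by norm_num)).1 this |>.symm
  have h2 : Real.cos q.2 = Real.cos q'.2 := by
    have := congrArg Prod.snd h
    simp only [planePolar, ← h1] at this
    field_simp at this
    exact this
  exact Prod.ext h1 (Real.injOn_cos ⟨hq.2.1.le, hq.2.2.le⟩ ⟨hq'.2.1.le, hq'.2.2.le⟩ h2)

theorem image_planePolar :
    planePolar '' (Ioi (0 : ℝ) ×ˢ Ioo 0 Real.pi) = Ioi (0 : ℝ) ×ˢ univ := by
  ext ⟨r, t⟩
  simp only [mem_image, mem_prod, mem_Ioi, mem_univ, and_true]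
  constructor
  · rintro ⟨q, hq, h⟩
    have := congrArg Prod.fst h
    simp only [planePolar] at this
    rw [← this]
    exact mul_pos hq.1 (Real.sqrt_pos.2 (sin_pos_of_mem hq))
  · intro hr
    -- `N` is ϱ², so the preimage is ϱ = √N with cos φ = 2t/ϱ². Positivity of r keeps cos φ strictly
    -- between −1 and 1.
    set N := √(r ^ 4 + 4 * t ^ 2) with hN
    have hN0 : 0 < N := Real.sqrt_pos.2 (by positivity)
    have hN2 : N ^ 2 = r ^ 4 + 4 * t ^ 2 := Real.sq_sqrt (by positivity)
    have hs2 : √N ^ 2 = N := Real.sq_sqrt hN0.le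
    have hlt : (2 * t / N) ^ 2 < 1 := by
      rw [div_pow, div_lt_one (by positivity), hN2]; nlinarith [pow_pos hr 4]
    have hab := abs_lt.1 ((sq_lt_one_iff_abs_lt_one _).1 hlt)
    refine ⟨(√N, Real.arccos (2 * t / N)), ⟨Real.sqrt_pos.2 hN0, Real.arccos_pos.2 hab.2, ?_⟩, ?_⟩
    · refine lt_of_le_of_ne (Real.arccos_le_pi _) fun h => ?_
      rw [Real.arccos_eq_pi] at h
      linarith [hab.1]
    · have hsin : √(1 - (2 * t / N) ^ 2) = r ^ 2 / N := by
        rw [Real.sqrt_eq_iff_mul_self_eq (by linarith) (by positivity)]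
        field_simp
        rw [hN2]; ring
      simp only [planePolar, Real.sin_arccos, hsin, Real.cos_arccos hab.1.le hab.2.le, hs2]
      refine Prod.ext ?_ ?_
      · simp only
        rw [← Real.sqrt_mul hN0.le, mul_div_cancel₀ _ hN0.ne', Real.sqrt_sq hr.le]
      · simp only
        field_simp

theorem lintegral_planePolar (g : ℝ × ℝ → ENNReal) :
    ∫⁻ z in Ioi (0 : ℝ) ×ˢ univ, g z = ∫⁻ q in Ioi (0 : ℝ) ×ˢ Ioo 0 Real.pi,
      ENNReal.ofReal (q.1 ^ 2 / (2 * √(Real.sin q.2))) * g (planePolar q) := by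
  have hms : MeasurableSet (Ioi (0 : ℝ) ×ˢ Ioo 0 Real.pi) :=
    measurableSet_Ioi.prod measurableSet_Ioo
  let D : ℝ × ℝ → ℝ × ℝ →L[ℝ] ℝ × ℝ := fun q =>
    (Matrix.toLin (.finTwoProd ℝ) (.finTwoProd ℝ)
      !![√(Real.sin q.2), q.1 * (Real.cos q.2 / (2 * √(Real.sin q.2)));
        q.1 * Real.cos q.2, -(q.1 ^ 2 * Real.sin q.2 / 2)]).toContinuousLinearMap
  have hD : ∀ q ∈ Ioi (0 : ℝ) ×ˢ Ioo 0 Real.pi,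
      HasFDerivWithinAt planePolar (D q) (Ioi (0 : ℝ) ×ˢ Ioo 0 Real.pi) q := by
    intro q hq
    have hs := sin_pos_of_mem hq
    refine HasFDerivAt.hasFDerivWithinAt ?_
    simp only [D]
    rw [Matrix.toLin_finTwoProd_toContinuousLinearMap]
    have a : HasDerivAt (fun φ => √(Real.sin φ)) (Real.cos q.2 / (2 * √(Real.sin q.2))) q.2 :=
      (Real.hasDerivAt_sin q.2).sqrt hs.ne'
    have b : HasDerivAt (fun φ => Real.cos φ / 2) (-Real.sin q.2 / 2) q.2 :=
      (Real.hasDerivAt_cos q.2).div_const 2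
    have a' := (hasFDerivAt_fst (𝕜 := ℝ) (p := q)).mul (a.comp_hasFDerivAt q hasFDerivAt_snd)
    have b' := ((hasFDerivAt_fst (𝕜 := ℝ) (p := q)).pow 2).mul
      (b.comp_hasFDerivAt q hasFDerivAt_snd)
    have c := a'.prodMk b'
    refine (c.congr_of_eventuallyEq (Filter.Eventually.of_forall fun z => ?_)).congr_fderiv ?_
    · simp [planePolar, mul_div_assoc]
    · ext <;> simp <;> ring
  rw [← image_planePolar, lintegral_image_eq_lintegral_abs_det_fderiv_mul volume hms hD
    injOn_planePolar]
  refine setLIntegral_congr_fun hms fun q hq => ?_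
  have hs := sin_pos_of_mem hq
  have hs' := Real.sqrt_pos.2 hs
  have h1 := Real.sq_sqrt hs.le
  have h2 := Real.sin_sq_add_cos_sq q.2
  -- The determinant is −(ϱ²/2)(sin^{3/2} φ + cos² φ/sin^{1/2} φ), and sin² + cos² = 1 collapses the
  -- bracket to 1/√(sin φ).
  have hdet : (D q).det = -(q.1 ^ 2 / (2 * √(Real.sin q.2))) := by
    simp only [D, LinearMap.det_toContinuousLinearMap, LinearMap.det_toLin, Matrix.det_fin_two_of]
    field_simp
    linear_combination q.1 ^ 2 * (-Real.sin q.2 * h1 - h2)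
  rw [hdet, abs_neg, abs_of_nonneg (by positivity)]

/-- The radial factor `ϱ^{n+3}/2 dϱ` of `|x|² dx dt` in polar coordinates. -/
def radialMeasure (n : ℕ) : Measure ℝ :=
  (volume.restrict (Ioi 0)).withDensity fun r => ENNReal.ofReal (r ^ (n + 3) / 2)

theorem lintegral_radialMeasure {f : ℝ → ENNReal} (hf : Measurable f) :
    ∫⁻ r, f r ∂radialMeasure n = ∫⁻ r in Ioi (0 : ℝ), ENNReal.ofReal (r ^ (n + 3) / 2) * f r := by
  rw [radialMeasure, lintegral_withDensity_eq_lintegral_mul _ (by fun_prop) hf]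
  rfl

theorem lintegral_sphereMeasure {f : Space n → ENNReal} (hf : Measurable f) :
    ∫⁻ σ, f σ ∂sphereMeasure n = ∫⁻ φ in Ioo 0 Real.pi,
      (∫⁻ w, ENNReal.ofReal (Real.sin φ ^ ((n : ℝ) / 2)) * f (spherePoint (φ, w))
        ∂(volume : Measure (EuclideanSpace ℝ (Fin n))).toSphere) := by
  have h1 : Measurable fun q : ℝ × Metric.sphere (0 : EuclideanSpace ℝ (Fin n)) 1 =>
      ENNReal.ofReal (Real.sin q.1 ^ ((n : ℝ) / 2)) := by fun_prop
  have h2 : Measurable fun q : ℝ × Metric.sphere (0 : EuclideanSpace ℝ (Fin n)) 1 =>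
      f (spherePoint q) := hf.comp measurable_spherePoint
  rw [sphereMeasure, lintegral_map hf measurable_spherePoint,
    lintegral_withDensity_eq_lintegral_mul _ h1 h2, lintegral_prod _ (h1.mul h2).aemeasurable]
  rfl

instance : SFinite (radialMeasure n) := by unfold radialMeasure; infer_instance

theorem dil_spherePoint (r : ℝ) (q : ℝ × Metric.sphere (0 : EuclideanSpace ℝ (Fin n)) 1) :
    dil r (spherePoint q) =
      ((planePolar (r, q.1)).1 • (q.2 : EuclideanSpace ℝ (Fin n)), (planePolar (r, q.1)).2) := by
  simp [dil, spherePoint, planePolar, smul_smul, mul_div_assoc]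

theorem lintegral_eq_lintegral_sphere_prod (hn : 0 < n) {f : Space n → ENNReal}
    (hf : Measurable f) :
    ∫⁻ p, ENNReal.ofReal (‖p.1‖ ^ 2) * f p = ∫⁻ w, (∫⁻ r in Ioi (0 : ℝ), ∫⁻ t : ℝ,
      ENNReal.ofReal (r ^ (n - 1)) * (ENNReal.ofReal (r ^ 2) *
        f (r • (w : EuclideanSpace ℝ (Fin n)), t)))
        ∂(volume : Measure (EuclideanSpace ℝ (Fin n))).toSphere := by
  have : Nonempty (Fin n) := ⟨⟨0, hn⟩⟩
  have hfin : Module.finrank ℝ (EuclideanSpace ℝ (Fin n)) = n := by simp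
  have hF : Measurable fun p : Space n => ENNReal.ofReal (‖p.1‖ ^ 2) * f p := by fun_prop
  rw [Measure.volume_eq_prod, lintegral_prod _ hF.aemeasurable,
    lintegral_eq_lintegral_sphere volume hF.lintegral_prod_right', hfin]
  refine lintegral_congr fun w => setLIntegral_congr_fun measurableSet_Ioi fun r hr => ?_
  have hw : ‖(w : EuclideanSpace ℝ (Fin n))‖ = 1 := by simp
  have hm : Measurable fun t : ℝ => ENNReal.ofReal (‖r • (w : EuclideanSpace ℝ (Fin n))‖ ^ 2) *
      f (r • (w : EuclideanSpace ℝ (Fin n)), t) :=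
    measurable_const.mul (hf.comp (by fun_prop))
  rw [← lintegral_const_mul _ hm]
  simp only [norm_smul, hw, mul_one, Real.norm_eq_abs, sq_abs]

/-- On the half-plane over w, the density r^{n−1}·r² with r = ϱ√(sin φ), times the Jacobian
ϱ²/(2√(sin φ)), equals (ϱ^{n+3}/2)(sin φ)^{n/2}. The factor |x|² is thus exactly what produces the
density of dΩ. -/
theorem lintegral_halfPlane_eq {f : Space n → ENNReal} (hn : 0 < n) (hf : Measurable f)
    (w : Metric.sphere (0 : EuclideanSpace ℝ (Fin n)) 1) :
    ∫⁻ r in Ioi (0 : ℝ), ∫⁻ t : ℝ, ENNReal.ofReal (r ^ (n - 1)) * (ENNReal.ofReal (r ^ 2) *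
        f (r • (w : EuclideanSpace ℝ (Fin n)), t)) =
      ∫⁻ q in Ioi (0 : ℝ) ×ˢ Ioo 0 Real.pi, ENNReal.ofReal (q.1 ^ (n + 3) / 2) *
        (ENNReal.ofReal (Real.sin q.2 ^ ((n : ℝ) / 2)) * f (dil q.1 (spherePoint (q.2, w)))) := by
  have hm : Measurable fun z : ℝ × ℝ => ENNReal.ofReal (z.1 ^ (n - 1)) *
      (ENNReal.ofReal (z.1 ^ 2) * f (z.1 • (w : EuclideanSpace ℝ (Fin n)), z.2)) :=
    Measurable.mul (by fun_prop) (Measurable.mul (by fun_prop) (hf.comp (by fun_prop)))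
  have e : (volume : Measure (ℝ × ℝ)).restrict (Ioi (0 : ℝ) ×ˢ univ) =
      (volume.restrict (Ioi (0 : ℝ))).prod volume := by
    rw [Measure.volume_eq_prod, ← Measure.prod_restrict, Measure.restrict_univ]
  rw [← lintegral_prod (fun z : ℝ × ℝ => ENNReal.ofReal (z.1 ^ (n - 1)) *
      (ENNReal.ofReal (z.1 ^ 2) * f (z.1 • (w : EuclideanSpace ℝ (Fin n)), z.2)))
      hm.aemeasurable, ← e, lintegral_planePolar]
  refine setLIntegral_congr_fun (measurableSet_Ioi.prod measurableSet_Ioo) fun q hq => ?_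
  have hs := sin_pos_of_mem hq
  have hs' := Real.sqrt_pos.2 hs
  have hq0 : 0 < q.1 := hq.1
  have h1 : Real.sin q.2 ^ ((n : ℝ) / 2) = √(Real.sin q.2) ^ n := by
    rw [Real.sqrt_eq_rpow, ← Real.rpow_natCast, ← Real.rpow_mul hs.le]; ring_nf
  rw [dil_spherePoint]
  simp only [← mul_assoc]
  congr 1
  have hp : 0 ≤ (planePolar q).1 := mul_nonneg hq0.le hs'.le
  rw [h1, ← ENNReal.ofReal_mul (by positivity), ← ENNReal.ofReal_mul (by positivity),
    ← ENNReal.ofReal_mul (by positivity)]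
  congr 1
  simp only [planePolar]
  obtain ⟨m, rfl⟩ : ∃ m, n = m + 1 := ⟨n - 1, by omega⟩
  rw [Nat.add_sub_cancel]
  field_simp
  ring

theorem lintegral_lintegral_sphere_eq {f : Space n → ENNReal} (hf : Measurable f) :
    ∫⁻ w, (∫⁻ q in Ioi (0 : ℝ) ×ˢ Ioo 0 Real.pi, ENNReal.ofReal (q.1 ^ (n + 3) / 2) *
        (ENNReal.ofReal (Real.sin q.2 ^ ((n : ℝ) / 2)) * f (dil q.1 (spherePoint (q.2, w)))))
        ∂(volume : Measure (EuclideanSpace ℝ (Fin n))).toSphere =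
      ∫⁻ r, (∫⁻ σ, f (dil r σ) ∂sphereMeasure n) ∂radialMeasure n := by
  have hdil : Measurable fun q : ℝ × Space n => f (dil q.1 q.2) :=
    hf.comp (continuous_dil (n := n)).measurable
  have hsp : Measurable fun q : (ℝ × ℝ) × Metric.sphere (0 : EuclideanSpace ℝ (Fin n)) 1 =>
      ENNReal.ofReal (Real.sin q.1.2 ^ ((n : ℝ) / 2)) * f (dil q.1.1 (spherePoint (q.1.2, q.2))) := by
    have h1 : Measurable fun q : (ℝ × ℝ) × Metric.sphere (0 : EuclideanSpace ℝ (Fin n)) 1 =>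
        spherePoint (q.1.2, q.2) := measurable_spherePoint.comp (by fun_prop)
    have h2 : Measurable fun q : (ℝ × ℝ) × Metric.sphere (0 : EuclideanSpace ℝ (Fin n)) 1 =>
        ENNReal.ofReal (Real.sin q.1.2 ^ ((n : ℝ) / 2)) := by fun_prop
    have h3 : Measurable fun q : (ℝ × ℝ) × Metric.sphere (0 : EuclideanSpace ℝ (Fin n)) 1 =>
        (q.1.1, spherePoint (q.1.2, q.2)) := (measurable_fst.comp measurable_fst).prodMk h1
    have h4 := hdil.comp h3
    exact h2.mul h4
  have hA : (volume : Measure (ℝ × ℝ)).restrict (Ioi (0 : ℝ) ×ˢ Ioo 0 Real.pi) =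
      (volume.restrict (Ioi (0 : ℝ))).prod (volume.restrict (Ioo 0 Real.pi)) := by
    rw [Measure.volume_eq_prod, ← Measure.prod_restrict]
  have hall : Measurable fun q : (ℝ × ℝ) × Metric.sphere (0 : EuclideanSpace ℝ (Fin n)) 1 =>
      ENNReal.ofReal (q.1.1 ^ (n + 3) / 2) * (ENNReal.ofReal (Real.sin q.1.2 ^ ((n : ℝ) / 2)) *
        f (dil q.1.1 (spherePoint (q.1.2, q.2)))) := Measurable.mul (by fun_prop) hsp
  have hall' : Measurable fun q : Metric.sphere (0 : EuclideanSpace ℝ (Fin n)) 1 × (ℝ × ℝ) =>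
      ENNReal.ofReal (q.2.1 ^ (n + 3) / 2) * (ENNReal.ofReal (Real.sin q.2.2 ^ ((n : ℝ) / 2)) *
        f (dil q.2.1 (spherePoint (q.2.2, q.1)))) := by
    have h := hall.comp (measurable_swap
      (α := Metric.sphere (0 : EuclideanSpace ℝ (Fin n)) 1) (β := ℝ × ℝ))
    exact h
  have hI : Measurable fun r => ∫⁻ σ, f (dil r σ) ∂sphereMeasure n := hdil.lintegral_prod_right'
  have hJ : Measurable fun q : ℝ × ℝ => ∫⁻ w, ENNReal.ofReal (q.1 ^ (n + 3) / 2) *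
      (ENNReal.ofReal (Real.sin q.2 ^ ((n : ℝ) / 2)) * f (dil q.1 (spherePoint (q.2, w))))
      ∂(volume : Measure (EuclideanSpace ℝ (Fin n))).toSphere := hall.lintegral_prod_right'
  rw [lintegral_radialMeasure hI, lintegral_lintegral_swap hall'.aemeasurable, hA,
    lintegral_prod _ hJ.aemeasurable]
  refine setLIntegral_congr_fun measurableSet_Ioi fun r hr => ?_
  have hr' : Measurable fun σ => f (dil r σ) := hf.comp (by unfold dil; fun_prop)
  have hsr : Measurable fun q : ℝ × Metric.sphere (0 : EuclideanSpace ℝ (Fin n)) 1 =>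
      ENNReal.ofReal (Real.sin q.1 ^ ((n : ℝ) / 2)) * f (dil r (spherePoint q)) :=
    Measurable.mul (by fun_prop) (hf.comp ((by unfold dil; fun_prop : Measurable (dil r)).comp
      measurable_spherePoint))
  simp only
  have hK : Measurable fun φ => ∫⁻ w, ENNReal.ofReal (Real.sin φ ^ ((n : ℝ) / 2)) *
      f (dil r (spherePoint (φ, w))) ∂(volume : Measure (EuclideanSpace ℝ (Fin n))).toSphere :=
    hsr.lintegral_prod_right'
  rw [lintegral_sphereMeasure hr', ← lintegral_const_mul _ hK]
  refine lintegral_congr fun φ => ?_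
  have hsφ : Measurable fun w : Metric.sphere (0 : EuclideanSpace ℝ (Fin n)) 1 =>
      ENNReal.ofReal (Real.sin φ ^ ((n : ℝ) / 2)) * f (dil r (spherePoint (φ, w))) :=
    measurable_const.mul (hf.comp ((by unfold dil; fun_prop : Measurable (dil r)).comp
      (measurable_spherePoint.comp (by fun_prop))))
  exact lintegral_const_mul _ hsφ

/-- Integration in polar coordinates `p = δ_ϱ σ`. -/
theorem lintegral_polar (hn : 0 < n) {f : Space n → ENNReal} (hf : Measurable f) :
    ∫⁻ p, ENNReal.ofReal (‖p.1‖ ^ 2) * f p =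
      ∫⁻ r, (∫⁻ σ, f (dil r σ) ∂sphereMeasure n) ∂radialMeasure n := by
  rw [lintegral_eq_lintegral_sphere_prod hn hf, ← lintegral_lintegral_sphere_eq hf]
  exact lintegral_congr fun w => lintegral_halfPlane_eq hn hf w

/-- The measure `|x|² dx dt` in polar coordinates. -/
theorem map_dil_prod (hn : 0 < n) :
    ((radialMeasure n).prod (sphereMeasure n)).map (fun q => dil q.1 q.2) =
      (volume : Measure (Space n)).withDensity fun p => ENNReal.ofReal (‖p.1‖ ^ 2) := by
  have hd := (continuous_dil (n := n)).measurable
  have hm : Measurable fun p : Space n => ENNReal.ofReal (‖p.1‖ ^ 2) := by fun_prop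
  refine Measure.ext_of_lintegral _ fun f hf => ?_
  have h2 : Measurable fun q : ℝ × Space n => f (dil q.1 q.2) := hf.comp hd
  rw [lintegral_map hf hd, lintegral_withDensity_eq_lintegral_mul _ hm hf,
    lintegral_prod _ h2.aemeasurable]
  exact (lintegral_polar hn hf).symm

theorem integrable_polar_iff (hn : 0 < n) {f : Space n → ℝ} (hf : Measurable f) :
    Integrable (fun q : ℝ × Space n => f (dil q.1 q.2)) ((radialMeasure n).prod (sphereMeasure n)) ↔
      Integrable (fun p => ‖p.1‖ ^ 2 * f p) := by
  have hd := (continuous_dil (n := n)).measurable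
  have h := integrable_map_measure (μ := (radialMeasure n).prod (sphereMeasure n))
    (hf.aestronglyMeasurable (μ := _)) hd.aemeasurable
  refine h.symm.trans ?_
  rw [map_dil_prod hn, integrable_withDensity_iff_integrable_smul' (by fun_prop)
    (Filter.Eventually.of_forall fun _ => ENNReal.ofReal_lt_top)]
  simp

theorem integral_polar (hn : 0 < n) {f : Space n → ℝ} (hf : Measurable f)
    (hi : Integrable (fun p : Space n => ‖p.1‖ ^ 2 * f p)) :
    ∫ p : Space n, ‖p.1‖ ^ 2 * f p =
      ∫ r in Ioi (0 : ℝ), r ^ (n + 3) / 2 * ∫ σ, f (dil r σ) ∂sphereMeasure n := by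
  have hd := (continuous_dil (n := n)).measurable
  have h1 : ∫ p : Space n, ‖p.1‖ ^ 2 * f p =
      ∫ p, f p ∂((radialMeasure n).prod (sphereMeasure n)).map (fun q => dil q.1 q.2) := by
    rw [map_dil_prod hn, integral_withDensity_eq_integral_toReal_smul (by fun_prop)
      (Filter.Eventually.of_forall fun _ => ENNReal.ofReal_lt_top)]
    simp
  rw [h1, integral_map hd.aemeasurable hf.aestronglyMeasurable,
    integral_prod _ ((integrable_polar_iff hn hf).2 hi), radialMeasure,
    integral_withDensity_eq_integral_toReal_smul (by fun_prop)
      (Filter.Eventually.of_forall fun _ => ENNReal.ofReal_lt_top)]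
  refine setIntegral_congr_fun measurableSet_Ioi fun r hr => ?_
  have hr0 : (0 : ℝ) < r := hr
  simp only [smul_eq_mul]
  rw [ENNReal.toReal_ofReal (by positivity)]

/-! ### Pairings over Ω as functions of the radius. -/

theorem ae_sphereMeasure {P : Space n → Prop} (hP : MeasurableSet {σ | P σ})
    (h : ∀ q : ℝ × Metric.sphere (0 : EuclideanSpace ℝ (Fin n)) 1,
      0 < Real.sin q.1 → P (spherePoint q)) : ∀ᵐ σ ∂sphereMeasure n, P σ := by
  unfold sphereMeasure
  rw [ae_map_iff measurable_spherePoint.aemeasurable hP]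
  refine (withDensity_absolutelyContinuous _ _).ae_le ?_
  have h1 : ∀ᵐ φ ∂(volume : Measure ℝ).restrict (Ioo 0 Real.pi), 0 < Real.sin φ :=
    (ae_restrict_mem measurableSet_Ioo).mono fun φ hφ => Real.sin_pos_of_mem_Ioo hφ
  exact (Measure.quasiMeasurePreserving_fst.ae h1).mono fun q hq => h q hq

theorem quartic_spherePoint {q : ℝ × Metric.sphere (0 : EuclideanSpace ℝ (Fin n)) 1}
    (hq : 0 < Real.sin q.1) : quartic (spherePoint q) = 1 := by
  have hw : ‖(q.2 : EuclideanSpace ℝ (Fin n))‖ = 1 := by simp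
  simp only [quartic, spherePoint, norm_smul, hw, mul_one, Real.norm_eq_abs]
  rw [abs_of_nonneg (Real.sqrt_nonneg _), show 4 = 2 * 2 from rfl, pow_mul, Real.sq_sqrt hq.le]
  linear_combination Real.sin_sq_add_cos_sq q.1

theorem ae_quartic_eq_one : ∀ᵐ σ ∂sphereMeasure n, quartic σ = 1 :=
  ae_sphereMeasure (contDiff_quartic.continuous.measurable (measurableSet_singleton 1))
    fun _ hq => quartic_spherePoint hq

theorem rho_of_quartic_eq_one {σ : Space n} (h : quartic σ = 1) : rho σ = 1 :=
  rho_eq_of_pow_four zero_le_one (by rw [h, one_pow])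

theorem fst_spherePoint_ne_zero {q : ℝ × Metric.sphere (0 : EuclideanSpace ℝ (Fin n)) 1}
    (hq : 0 < Real.sin q.1) : (spherePoint q).1 ≠ 0 := by
  have hw : ‖(q.2 : EuclideanSpace ℝ (Fin n))‖ = 1 := by simp
  refine smul_ne_zero (Real.sqrt_pos.2 hq).ne' fun h => ?_
  rw [h, norm_zero] at hw
  exact zero_ne_one hw

theorem ae_fst_ne_zero_sphere : ∀ᵐ σ ∂sphereMeasure n, σ.1 ≠ 0 :=
  ae_sphereMeasure (measurable_fst (measurableSet_singleton 0).compl)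
    fun _ hq => fst_spherePoint_ne_zero hq

theorem ae_fst_ne_zero (hn : 0 < n) : ∀ᵐ p : Space n, p.1 ≠ 0 := by
  have : Nonempty (Fin n) := ⟨⟨0, hn⟩⟩
  have h : ∀ᵐ x : EuclideanSpace ℝ (Fin n), x ≠ 0 := by
    simp [ae_iff]
  exact Measure.quasiMeasurePreserving_fst.ae h

/-- The pairing `∫_Ω f(δ_r σ) h(σ) dΩ`. -/
def sphInt (h f : Space n → ℝ) (r : ℝ) : ℝ := ∫ σ, f (dil r σ) * h σ ∂sphereMeasure n

theorem sphereMeasure_restrict :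
    (sphereMeasure n).restrict (Metric.closedBall 0 1) = sphereMeasure n :=
  Measure.restrict_eq_self_of_ae_mem (ae_mem_closedBall n)

theorem continuous_sphInt {h f : Space n → ℝ} (hh : Continuous h) (hf : Continuous f) :
    Continuous (sphInt h f) := by
  have : sphInt h f = fun r => ∫ σ in Metric.closedBall 0 1, f (dil r σ) * h σ ∂sphereMeasure n := by
    funext r; rw [sphereMeasure_restrict]; rfl
  rw [this]
  refine continuous_parametric_integral_of_continuous ?_ (isCompact_closedBall 0 1)
  exact (hf.comp continuous_dil).mul (hh.comp continuous_snd)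

theorem integrable_sphere_of_continuous {g : Space n → ℝ} (hg : Continuous g) :
    Integrable g (sphereMeasure n) := by
  obtain ⟨C, hC⟩ := (isCompact_closedBall (0 : Space n) 1).exists_bound_of_continuousOn
    hg.continuousOn
  exact Integrable.of_bound hg.aestronglyMeasurable C ((ae_mem_closedBall n).mono fun σ h => hC σ h)

theorem continuous_dil_left (r : ℝ) : Continuous (dil (n := n) r) := by
  unfold dil; fun_prop

/-- Differentiation under the integral: r d/dr of a pairing is the pairing of the Euler derivative.
The dominating constant comes from compactness of [r/2, 2r] times the closed unit ball, which
carries dΩ. -/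
theorem hasDerivAt_sphInt {h f : Space n → ℝ} (hh : Continuous h) (hf : ContDiff ℝ ∞ f) {r : ℝ}
    (hr : 0 < r) : HasDerivAt (sphInt h f) (sphInt h (euler f) r / r) r := by
  have hE := (contDiff_euler hf).continuous
  have hc : ContinuousOn (fun q : ℝ × Space n => euler f (dil q.1 q.2) / q.1 * h q.2)
      (Icc (r / 2) (2 * r) ×ˢ Metric.closedBall 0 1) := by
    refine ContinuousOn.mul (ContinuousOn.div ?_ continuousOn_fst ?_) ?_
    · exact (hE.comp continuous_dil).continuousOn
    · rintro q ⟨⟨h1, -⟩, -⟩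
      linarith
    · exact (hh.comp continuous_snd).continuousOn
  obtain ⟨C, hC⟩ := (isCompact_Icc.prod (isCompact_closedBall 0 1)).exists_bound_of_continuousOn hc
  have hd := (hasDerivAt_integral_of_dominated_loc_of_deriv_le (μ := sphereMeasure n)
    (F := fun r σ => f (dil r σ) * h σ) (F' := fun r σ => euler f (dil r σ) / r * h σ)
    (x₀ := r) (s := Ioo (r / 2) (2 * r)) (bound := fun _ => C)
    (Ioo_mem_nhds (by linarith) (by linarith))
    (Filter.Eventually.of_forall fun s =>
      ((hf.continuous.comp (continuous_dil_left s)).mul hh).aestronglyMeasurable)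
    (integrable_sphere_of_continuous ((hf.continuous.comp (continuous_dil_left r)).mul hh))
    (((hE.comp (continuous_dil_left r)).div_const r).mul hh).aestronglyMeasurable
    ((ae_mem_closedBall n).mono fun σ hσ s hs => hC (s, σ) ⟨⟨hs.1.le, hs.2.le⟩, hσ⟩)
    (integrable_const C)
    (Filter.Eventually.of_forall fun σ s hs =>
      (hasDerivAt_comp_dil hf σ (by linarith [hs.1] : s ≠ 0)).mul_const _)).2
  refine hd.congr_deriv ?_
  rw [sphInt, ← integral_div]
  exact integral_congr_ae (Filter.Eventually.of_forall fun σ => by simp only; ring)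

theorem setIntegral_Ioi_deriv_eq_zero {g g' : ℝ → ℝ} {a b : ℝ} (ha : 0 < a) (hab : a ≤ b)
    (hd : ∀ r, 0 < r → HasDerivAt g (g' r) r) (hc : ContinuousOn g' (Ioi 0))
    (hg : ∀ r, 0 < r → r ∉ Icc a b → g r = 0) (hg' : ∀ r, 0 < r → r ∉ Icc a b → g' r = 0) :
    ∫ r in Ioi (0 : ℝ), g' r = 0 := by
  -- The interval from a/2 to b + 1 contains [a, b] with room at both ends, so `g` vanishes at its
  -- endpoints.
  have h1 : ∫ r in Ioi (0 : ℝ), g' r = ∫ r in Ioc (a / 2) (b + 1), g' r := by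
    refine setIntegral_eq_of_subset_of_forall_sdiff_eq_zero measurableSet_Ioi ?_ ?_
    · exact fun r hr => lt_trans (by positivity) hr.1
    · rintro r ⟨hr, hr'⟩
      refine hg' r hr fun h => hr' ⟨by linarith [h.1], by linarith [h.2]⟩
  have hsub : uIcc (a / 2) (b + 1) ⊆ Ioi 0 := by
    rw [uIcc_of_le (by linarith)]
    exact fun r hr => lt_of_lt_of_le (by positivity) hr.1
  rw [h1, ← intervalIntegral.integral_of_le (by linarith),
    intervalIntegral.integral_eq_sub_of_hasDerivAt (f := g) (fun r hr => hd r (hsub hr))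
      ((hc.mono hsub).intervalIntegrable),
    hg _ (by linarith) (fun h => by linarith [h.2]), hg _ (by linarith) (fun h => by linarith [h.1]),
    sub_zero]

/-- Functions supported in the shell `a ≤ ϱ ≤ b`. -/
def SupportedIn (a b : ℝ) (f : Space n → ℝ) : Prop := ∀ p, rho p ∉ Icc a b → f p = 0

theorem SupportedIn.sphInt_eq_zero {a b : ℝ} {f : Space n → ℝ} (hf : SupportedIn a b f)
    (h : Space n → ℝ) {r : ℝ} (hr : 0 < r) (hr' : r ∉ Icc a b) : sphInt h f r = 0 := by
  refine integral_eq_zero_of_ae (ae_quartic_eq_one.mono fun σ hσ => ?_)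
  simp only [Pi.zero_apply]
  rw [hf, zero_mul]
  rwa [rho_dil hr.le, rho_of_quartic_eq_one hσ, mul_one]

theorem exists_supportedIn {u : Space n → ℝ} (hc : HasCompactSupport u)
    (ho : (0 : Space n) ∉ tsupport u) :
    ∃ a b : ℝ, 0 < a ∧ a ≤ b ∧ ∀ p ∈ tsupport u, rho p ∈ Icc a b := by
  rcases (tsupport u).eq_empty_or_nonempty with h | h
  · exact ⟨1, 1, one_pos, le_rfl, by simp [h]⟩
  · obtain ⟨p, hp, hmin⟩ := hc.exists_isMinOn h continuous_rho.continuousOn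
    obtain ⟨q, hq, hmax⟩ := hc.exists_isMaxOn h continuous_rho.continuousOn
    exact ⟨rho p, rho q, rho_pos fun h0 => ho (h0 ▸ hp), hmin hq, fun z hz => ⟨hmin hz, hmax hz⟩⟩

theorem supportedIn_of_tsupport {u f : Space n → ℝ} {a b : ℝ}
    (h : ∀ p ∈ tsupport u, rho p ∈ Icc a b) (hf : tsupport f ⊆ tsupport u) : SupportedIn a b f :=
  fun p hp => image_eq_zero_of_notMem_tsupport fun hp' => hp (h p (hf hp'))

theorem tsupport_euler (f : Space n → ℝ) : tsupport (euler f) ⊆ tsupport f := by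
  refine closure_minimal (fun p hp => ?_) (isClosed_tsupport f)
  by_contra h
  refine hp ?_
  have : fderiv ℝ f p = 0 := image_eq_zero_of_notMem_tsupport fun h' => h (tsupport_fderiv_subset ℝ h')
  simp [euler, this]

/-- The function ϱ is not smooth at the origin, whereas ϱ⁴ is smooth everywhere. Radial test
functions are therefore rewritten as functions of ϱ⁴; support away from 0 makes s ↦ g(s^{1/4})
smooth. -/
theorem exists_contDiff_comp_pow_four {g : ℝ → ℝ} (hg : ContDiff ℝ ∞ g)
    (hs : tsupport g ⊆ Ioi 0) : ∃ χ : ℝ → ℝ, ContDiff ℝ ∞ χ ∧ ∀ r, 0 < r → χ (r ^ 4) = g r := by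
  refine ⟨fun s => g √√s, contDiff_iff_contDiffAt.2 fun s => ?_, fun r hr => ?_⟩
  · have h0 : ∀ᶠ r in nhds (0 : ℝ), g r = 0 :=
      (notMem_tsupport_iff_eventuallyEq.1 fun h => lt_irrefl (0 : ℝ) (hs h) : g =ᶠ[nhds 0] 0)
    by_cases h : 0 < s
    · exact hg.contDiffAt.comp s (((contDiffAt_id (x := s)).sqrt h.ne').sqrt (Real.sqrt_pos.2 h).ne')
    · have h1 : Filter.Tendsto (fun s : ℝ => √√s) (nhds s) (nhds 0) := by
        have h2 : √√s = 0 := by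
          rw [Real.sqrt_eq_zero (Real.sqrt_nonneg _), Real.sqrt_eq_zero_of_nonpos (not_lt.1 h)]
        have h3 : Continuous fun s : ℝ => √√s := by fun_prop
        have := h3.tendsto s
        rwa [h2] at this
      exact (contDiffAt_const (c := (0 : ℝ))).congr_of_eventuallyEq (h1.eventually h0)
  · have : √(r ^ 4) = r ^ 2 := by
      rw [show r ^ 4 = (r ^ 2) ^ 2 by ring, Real.sqrt_sq (by positivity)]
    simp only
    rw [this, Real.sqrt_sq hr.le]

/-! ### The action of the Grushin operator on harmonic components. -/

/-- The quotient `L_G f / |x|²`. -/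
def grushinQuot (f : Space n → ℝ) (p : Space n) : ℝ := grushin f p / ‖p.1‖ ^ 2

theorem measurable_grushinQuot {f : Space n → ℝ} (hf : ContDiff ℝ ∞ f) :
    Measurable (grushinQuot f) :=
  (contDiff_grushin hf).continuous.measurable.div (by fun_prop)

theorem IsGrushinHarmonic.sphInt_mul {k : ℕ} {H : Space n → ℝ} (hH : IsGrushinHarmonic k H)
    (f : Space n → ℝ) (g : ℝ → ℝ) (r : ℝ) :
    ∫ σ, f (dil r σ) * (g (quartic (dil r σ)) * H (dil r σ)) ∂sphereMeasure n =
      g (r ^ 4) * r ^ k * sphInt H f r := by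
  rw [sphInt, ← integral_const_mul]
  refine integral_congr_ae (ae_quartic_eq_one.mono fun σ hσ => ?_)
  simp only
  rw [quartic_dil, hσ, hH.dil_eq, mul_one]; ring

/-- Polar coordinates for the pairing of `f` with `g(ϱ⁴) H`. -/
theorem IsGrushinHarmonic.integral_polar (hn : 0 < n) {k : ℕ} {H : Space n → ℝ}
    (hH : IsGrushinHarmonic k H) {f : Space n → ℝ} (hf : Measurable f) {g : ℝ → ℝ}
    (hg : Continuous g)
    (hi : Integrable fun p : Space n => ‖p.1‖ ^ 2 * (f p * (g (quartic p) * H p))) :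
    ∫ p : Space n, ‖p.1‖ ^ 2 * (f p * (g (quartic p) * H p)) =
      ∫ r in Ioi (0 : ℝ), r ^ (n + 3) / 2 * (g (r ^ 4) * r ^ k * sphInt H f r) := by
  have hm : Measurable fun p : Space n => f p * (g (quartic p) * H p) :=
    hf.mul ((hg.comp contDiff_quartic.continuous).mul hH.contDiff.continuous).measurable
  rw [Grushin.integral_polar hn hm hi]
  simp only [hH.sphInt_mul]

theorem grushinQuot_mul (hn : 0 < n) (f g : Space n → ℝ) :
    (fun p : Space n => ‖p.1‖ ^ 2 * (grushinQuot f p * g p)) =ᵐ[volume]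
      fun p => grushin f p * g p := by
  filter_upwards [ae_fst_ne_zero hn] with p hp
  have : ‖p.1‖ ≠ 0 := norm_ne_zero_iff.2 hp
  rw [grushinQuot]; field_simp

theorem grushin_eq_zero {f : Space n → ℝ} {p : Space n} (hp : p ∉ tsupport f) :
    grushin f p = 0 := by
  have h1 : ∀ v, tsupport (dirDeriv v (dirDeriv v f)) ⊆ tsupport f := fun v =>
    (tsupport_fderiv_apply_subset ℝ v).trans (tsupport_fderiv_apply_subset ℝ v)
  have h2 : ∀ v, dirDeriv v (dirDeriv v f) p = 0 := fun v =>
    image_eq_zero_of_notMem_tsupport fun h => hp (h1 v h)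
  simp [grushin, h2]

theorem integrable_grushin_mul {f g : Space n → ℝ} (hf : ContDiff ℝ ∞ f)
    (hc : HasCompactSupport f) (hg : Continuous g) : Integrable fun p => grushin f p * g p :=
  ((contDiff_grushin hf).continuous.mul hg).integrable_of_hasCompactSupport
    (HasCompactSupport.mul_right (HasCompactSupport.intro hc fun _ hp => grushin_eq_zero hp))

/-- The quotient L_G u/|x|² may be singular on the axis x = 0, but |x|² dx dt absorbs the
singularity, and Fubini in polar coordinates gives integrability of the pairing in r. -/
theorem integrableOn_sphInt_grushinQuot (hn : 0 < n) {k : ℕ} {H u : Space n → ℝ}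
    (hH : IsGrushinHarmonic k H) (hu : ContDiff ℝ ∞ u) (hc : HasCompactSupport u) :
    IntegrableOn (fun r => r ^ (n + 3 + k) * sphInt H (grushinQuot u) r) (Ioi 0) := by
  have hm : Measurable fun p : Space n => grushinQuot u p * H p :=
    (measurable_grushinQuot hu).mul hH.contDiff.continuous.measurable
  have h1 := (integrable_polar_iff hn hm).2 ((integrable_congr (grushinQuot_mul hn u H)).2
    (integrable_grushin_mul hu hc hH.contDiff.continuous))
  have h2 := h1.integral_prod_left
  rw [radialMeasure, integrable_withDensity_iff_integrable_smul' (by fun_prop)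
    (Filter.Eventually.of_forall fun _ => ENNReal.ofReal_lt_top)] at h2
  refine (h2.const_mul 2).congr ?_
  filter_upwards [ae_restrict_mem measurableSet_Ioi] with r hr
  have hr0 : (0 : ℝ) < r := hr
  have h3 := hH.sphInt_mul (grushinQuot u) (fun _ => 1) r
  simp only [one_mul] at h3
  simp only [smul_eq_mul]
  rw [h3, ENNReal.toReal_ofReal (by positivity)]
  ring

theorem integrableOn_Ioi_of_continuousOn {f : ℝ → ℝ} {a b : ℝ} (ha : 0 < a)
    (hf : ContinuousOn f (Ioi 0)) (h0 : ∀ r, 0 < r → r ∉ Icc a b → f r = 0) :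
    IntegrableOn f (Ioi 0) := by
  have hsub : Icc a b ⊆ Ioi 0 := fun r hr => lt_of_lt_of_le ha hr.1
  have h1 : IntegrableOn f (Icc a b) := (hf.mono hsub).integrableOn_Icc
  exact h1.of_forall_sdiff_eq_zero measurableSet_Ioi fun r hr => h0 r hr.1 hr.2

/-- The radial integration by parts behind the spectral decomposition. -/
theorem setIntegral_radial_eq (hn : 0 < n) {k : ℕ} {H u : Space n → ℝ}
    (hH : IsGrushinHarmonic k H) (hu : ContDiff ℝ ∞ u) {a b : ℝ} (ha : 0 < a) (hab : a ≤ b)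
    (hs : ∀ p ∈ tsupport u, rho p ∈ Icc a b) {χ : ℝ → ℝ} (hχ : ContDiff ℝ ∞ χ) :
    ∫ r in Ioi (0 : ℝ), (r ^ (n + 3 + k) * sphInt H u r *
        (16 * r ^ 4 * deriv (deriv χ) (r ^ 4) + (4 * n + 16 + 8 * k) * deriv χ (r ^ 4)) -
      r ^ (n + k) / r * χ (r ^ 4) * (sphInt H (euler (euler u)) r + n * sphInt H (euler u) r
        - k * (k + n) * sphInt H u r)) = 0 := by
  have hHc := hH.contDiff.continuous
  have hE := contDiff_euler hu
  have hEE := contDiff_euler hE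
  have s0 := supportedIn_of_tsupport hs Subset.rfl
  have s1 := supportedIn_of_tsupport hs (tsupport_euler u)
  have s2 := supportedIn_of_tsupport hs ((tsupport_euler (euler u)).trans (tsupport_euler u))
  have hχ' : ContDiff ℝ ∞ (deriv χ) := hχ.deriv'
  have hχ'' : ContDiff ℝ ∞ (deriv (deriv χ)) := hχ'.deriv'
  have c0 := continuous_sphInt hHc hu.continuous
  have c1 := continuous_sphInt hHc hE.continuous
  have c2 := continuous_sphInt hHc hEE.continuous
  -- With α the pairing of u and v(r) = χ(r⁴)r^k, this primitive is the Green flux r^{n+1}(αv' −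
  -- α'v): indeed rv' = (4r⁴χ' + kχ)r^k and rα' is the pairing of Eu.
  refine setIntegral_Ioi_deriv_eq_zero (g := fun r => r ^ (n + k) *
    (sphInt H u r * (4 * r ^ 4 * deriv χ (r ^ 4)) - χ (r ^ 4) * sphInt H (euler u) r
      + k * sphInt H u r * χ (r ^ 4))) ha hab (fun r hr => ?_) ?_ (fun r hr hr' => ?_)
      (fun r hr hr' => ?_)
  · have d0 := hasDerivAt_sphInt hHc hu hr
    have d1 := hasDerivAt_sphInt hHc hE hr
    have p4 : HasDerivAt (fun r : ℝ => r ^ 4) (4 * r ^ 3) r := by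
      simpa using! hasDerivAt_pow 4 r
    have e0 : HasDerivAt (fun r => χ (r ^ 4)) (deriv χ (r ^ 4) * (4 * r ^ 3)) r :=
      HasDerivAt.comp (h := fun r : ℝ => r ^ 4) r
        ((hχ.differentiable (by simp) (r ^ 4)).hasDerivAt) p4
    have e1 : HasDerivAt (fun r => deriv χ (r ^ 4)) (deriv (deriv χ) (r ^ 4) * (4 * r ^ 3)) r :=
      HasDerivAt.comp (h := fun r : ℝ => r ^ 4) r
        ((hχ'.differentiable (by simp) (r ^ 4)).hasDerivAt) p4
    have pk : HasDerivAt (fun r : ℝ => r ^ (n + k)) ((n + k) * (r ^ (n + k) / r)) r := by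
      obtain ⟨j, hj⟩ : ∃ j, n + k = j + 1 := ⟨n + k - 1, by omega⟩
      have := hasDerivAt_pow (n + k) r
      refine this.congr_deriv ?_
      rw [hj, Nat.add_sub_cancel, ← Nat.cast_add, hj]; field_simp; ring
    have := pk.mul (((d0.mul ((p4.const_mul 4).mul e1)).sub (e0.mul d1)).add
      ((d0.const_mul (k : ℝ)).mul e0))
    refine this.congr_deriv ?_
    simp only [Pi.mul_apply, Pi.add_apply, Pi.sub_apply]
    field_simp
    ring
  · have hid : ContinuousOn (fun r : ℝ => r ^ (n + k) / r) (Ioi 0) :=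
      ContinuousOn.div (by fun_prop) (by fun_prop) fun r hr => (ne_of_gt hr)
    have k0 := hχ.continuous
    have k1 := hχ'.continuous
    have k2 := hχ''.continuous
    refine ContinuousOn.sub (Continuous.continuousOn (by fun_prop)) ?_
    refine (hid.mul (Continuous.continuousOn (by fun_prop))).mul
      (Continuous.continuousOn (by fun_prop))
  · rw [s0.sphInt_eq_zero H hr hr', s1.sphInt_eq_zero H hr hr']; simp
  · rw [s0.sphInt_eq_zero H hr hr', s1.sphInt_eq_zero H hr hr', s2.sphInt_eq_zero H hr hr']; simp

/-- The action of `L_G` on the harmonic components: `L_G u` in the direction of `H`. -/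
theorem ae_sphInt_grushinQuot (hn : 0 < n) {k : ℕ} {H u : Space n → ℝ}
    (hH : IsGrushinHarmonic k H) (hu : ContDiff ℝ ∞ u) (hc : HasCompactSupport u)
    (ho : (0 : Space n) ∉ tsupport u) : ∀ᵐ r : ℝ, r ∈ Ioi (0 : ℝ) →
      r ^ 4 * sphInt H (grushinQuot u) r = sphInt H (euler (euler u)) r
        + n * sphInt H (euler u) r - k * (k + n) * sphInt H u r := by
  obtain ⟨a, b, ha, hab, hs⟩ := exists_supportedIn hc ho
  have hHc := hH.contDiff.continuous
  have hE := contDiff_euler hu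
  have c0 := continuous_sphInt hHc hu.continuous
  have c1 := continuous_sphInt hHc hE.continuous
  have c2 := continuous_sphInt hHc (contDiff_euler hE).continuous
  have hW := integrableOn_sphInt_grushinQuot hn hH hu hc
  set B : ℝ → ℝ := fun r => sphInt H (euler (euler u)) r + n * sphInt H (euler u) r
        - k * (k + n) * sphInt H u r with hB
  have hBc : ContinuousOn (fun r => r ^ (n + k) / r * B r) (Ioi 0) := by
    refine ContinuousOn.mul ?_ (Continuous.continuousOn (by fun_prop))
    exact ContinuousOn.div (by fun_prop) (by fun_prop) fun r hr => ne_of_gt hr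
  have key : ∀ᵐ r : ℝ, r ∈ Ioi (0 : ℝ) →
      r ^ (n + 3 + k) * sphInt H (grushinQuot u) r - r ^ (n + k) / r * B r = 0 := by
    -- It suffices to test against smooth `g` compactly supported in (0, ∞). Each such g(r) is
    -- written χ(r⁴), and χ(ϱ⁴)H serves as the smooth test function on the whole space.
    refine isOpen_Ioi.ae_eq_zero_of_integral_contDiff_smul_eq_zero ?_ fun g hg hgc hgs => ?_
    · exact hW.locallyIntegrableOn.sub (hBc.locallyIntegrableOn measurableSet_Ioi)
    · obtain ⟨χ, hχ, hχg⟩ := exists_contDiff_comp_pow_four hg hgs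
      have hχ' : ContDiff ℝ ∞ (deriv χ) := hχ.deriv'
      have hχ'' : ContDiff ℝ ∞ (deriv (deriv χ)) := hχ'.deriv'
      have hq := contDiff_quartic (n := n)
      have hφ : ContDiff ℝ ∞ fun p => χ (quartic p) * H p := (hχ.comp hq).mul hH.contDiff
      have hsym := integral_grushin_mul hu hφ hc
      have i1 : Integrable fun p : Space n =>
          ‖p.1‖ ^ 2 * (grushinQuot u p * (χ (quartic p) * H p)) :=
        (integrable_congr (grushinQuot_mul hn u _)).2 (integrable_grushin_mul hu hc hφ.continuous)
      have e1 := hH.integral_polar hn (measurable_grushinQuot hu) hχ.continuous i1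
      rw [integral_congr_ae (grushinQuot_mul hn u _), hsym] at e1
      set η : ℝ → ℝ := fun s => 16 * s * deriv (deriv χ) s + (4 * n + 16 + 8 * k) * deriv χ s with hη
      have hηc : Continuous η := by
        have := hχ'.continuous
        have := hχ''.continuous
        fun_prop
      have e2 : (fun p => u p * grushin (fun p => χ (quartic p) * H p) p) =
          fun p => ‖p.1‖ ^ 2 * (u p * (η (quartic p) * H p)) := by
        funext p
        rw [grushin_comp_quartic_mul hH.contDiff hH.euler_eq hH.grushin_eq hχ]
        simp only [hη]; ring
      have i2 : Integrable fun p : Space n => ‖p.1‖ ^ 2 * (u p * (η (quartic p) * H p)) := by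
        refine Continuous.integrable_of_hasCompactSupport ?_
          (HasCompactSupport.mul_left (HasCompactSupport.mul_right hc))
        have := hu.continuous
        have := hηc.comp hq.continuous
        simp only [Function.comp_def] at this
        fun_prop
      rw [e2, hH.integral_polar hn hu.continuous.measurable hηc i2] at e1
      have e3 := setIntegral_radial_eq hn hH hu ha hab hs hχ
      have hχc := hχ.continuous
      have iX : IntegrableOn (fun r => r ^ (n + 3 + k) * sphInt H u r * η (r ^ 4)) (Ioi 0) := by
        refine integrableOn_Ioi_of_continuousOn (a := a) (b := b) ha (Continuous.continuousOn (by fun_prop))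
          fun r hr hr' => ?_
        rw [(supportedIn_of_tsupport hs Subset.rfl).sphInt_eq_zero H hr hr']; ring
      have iY : IntegrableOn (fun r => r ^ (n + k) / r * χ (r ^ 4) * B r) (Ioi 0) := by
        refine integrableOn_Ioi_of_continuousOn (a := a) (b := b) ha ?_ fun r hr hr' => ?_
        · have : ContinuousOn (fun r => (r ^ (n + k) / r * B r) * χ (r ^ 4)) (Ioi 0) :=
            hBc.mul (Continuous.continuousOn (by fun_prop))
          exact this.congr fun r hr => by simp only; ring
        · simp only [hB]
          rw [(supportedIn_of_tsupport hs Subset.rfl).sphInt_eq_zero H hr hr',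
            (supportedIn_of_tsupport hs (tsupport_euler u)).sphInt_eq_zero H hr hr',
            (supportedIn_of_tsupport hs ((tsupport_euler (euler u)).trans
              (tsupport_euler u))).sphInt_eq_zero H hr hr']
          ring
      have iZ : IntegrableOn (fun r => g r * (r ^ (n + 3 + k) * sphInt H (grushinQuot u) r))
          (Ioi 0) := by
        obtain ⟨C, hC⟩ := hgc.exists_bound_of_continuous hg.continuous
        exact hW.bdd_mul hg.continuous.aestronglyMeasurable (Filter.Eventually.of_forall hC)
      have hXY : ∫ r in Ioi (0 : ℝ), r ^ (n + 3 + k) * sphInt H u r * η (r ^ 4) =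
          ∫ r in Ioi (0 : ℝ), r ^ (n + k) / r * χ (r ^ 4) * B r := by
        rw [← sub_eq_zero, ← integral_sub iX iY]
        exact e3
      have hXZ : ∫ r in Ioi (0 : ℝ), r ^ (n + 3 + k) * sphInt H u r * η (r ^ 4) =
          ∫ r in Ioi (0 : ℝ), g r * (r ^ (n + 3 + k) * sphInt H (grushinQuot u) r) := by
        -- The factor 2 clears the 1/2 in the polar density.
        have e4 := congrArg (fun z : ℝ => 2 * z) e1
        simp only [← integral_const_mul] at e4
        refine Eq.trans ?_ (e4.trans ?_)
        · exact integral_congr_ae (Filter.Eventually.of_forall fun r => by simp only; ring)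
        · refine setIntegral_congr_fun measurableSet_Ioi fun r hr => ?_
          rw [← hχg r hr]; ring
      have hcompl : ∀ r ∉ Ioi (0 : ℝ), g r • (r ^ (n + 3 + k) * sphInt H (grushinQuot u) r -
          r ^ (n + k) / r * B r) = 0 := fun r hr => by
        rw [image_eq_zero_of_notMem_tsupport fun h => hr (hgs h), zero_smul]
      have hsplit : ∫ r in Ioi (0 : ℝ), g r • (r ^ (n + 3 + k) * sphInt H (grushinQuot u) r -
          r ^ (n + k) / r * B r) = (∫ r in Ioi (0 : ℝ),
            g r * (r ^ (n + 3 + k) * sphInt H (grushinQuot u) r)) -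
            ∫ r in Ioi (0 : ℝ), r ^ (n + k) / r * χ (r ^ 4) * B r := by
        rw [← integral_sub iZ iY]
        refine setIntegral_congr_fun measurableSet_Ioi fun r hr => ?_
        simp only [smul_eq_mul]
        rw [← hχg r hr]; ring
      rw [← setIntegral_eq_integral_of_forall_compl_eq_zero hcompl, hsplit, ← hXZ, hXY, sub_self]
  filter_upwards [key] with r hr hr0
  have hr1 : (0 : ℝ) < r := hr0
  have h1 := hr hr0
  have h2 : r ^ (n + k) / r * (r ^ 4 * sphInt H (grushinQuot u) r - B r) = 0 := by
    rw [← h1]; field_simp; ring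
  have h3 := (mul_eq_zero.1 h2).resolve_left (by positivity)
  linarith

theorem sphInt_congr {h h' : Space n → ℝ} (hh : ∀ σ, quartic σ = 1 → h σ = h' σ) (f : Space n → ℝ) :
    sphInt h f = sphInt h' f := by
  funext r
  exact integral_congr_ae (ae_quartic_eq_one.mono fun σ hσ => by simp only; rw [hh σ hσ])

/-- The action of `L_G` on the component of `u` along an element of `H_k`. -/
theorem ae_sphInt_grushinQuot_of_mem (hn : 0 < n) {k : ℕ} {h u : Space n → ℝ}
    (hh : h ∈ sphHarm n k) (hu : ContDiff ℝ ∞ u) (hc : HasCompactSupport u)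
    (ho : (0 : Space n) ∉ tsupport u) : ∀ᵐ r : ℝ, r ∈ Ioi (0 : ℝ) →
      r ^ 4 * sphInt h (grushinQuot u) r = sphInt h (euler (euler u)) r
        + n * sphInt h (euler u) r - k * (k + n) * sphInt h u r := by
  obtain ⟨H, hH, hHh⟩ := exists_isGrushinHarmonic hh
  have := ae_sphInt_grushinQuot hn hH hu hc ho
  simpa only [sphInt_congr hHh] using this

/-! ### Orthogonality of the harmonic spaces. -/

/-- `H_j` and `H_k` are orthogonal for `j ≠ k`. -/
theorem integral_mul_eq_zero_of_mem_sphHarm (hn : 0 < n) {j k : ℕ} (hjk : j ≠ k) {g h : Space n → ℝ}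
    (hg : g ∈ sphHarm n j) (hh : h ∈ sphHarm n k) : ∫ σ, g σ * h σ ∂sphereMeasure n = 0 := by
  obtain ⟨G, hG, hGg⟩ := exists_isGrushinHarmonic hg
  -- The harmonic extension G of g is cut off by a bump in ϱ⁴ that equals 1 for ϱ⁴ within 1/4 of 1
  -- and vanishes near the origin. Near Ω the cut-off function is G, so L_G annihilates it while E
  -- acts as multiplication by j.
  obtain ⟨B, hBin, hBout⟩ : ∃ B : ContDiffBump (1 : ℝ), B.rIn = 1 / 4 ∧ B.rOut = 1 / 2 :=
    ⟨⟨1 / 4, 1 / 2, by norm_num, by norm_num⟩, rfl, rfl⟩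
  have hB : ContDiff ℝ ∞ (B : ℝ → ℝ) := B.contDiff
  set u : Space n → ℝ := fun p => B (quartic p) * G p with hu_def
  have hq := contDiff_quartic (n := n)
  have hu : ContDiff ℝ ∞ u := (hB.comp hq).mul hG.contDiff
  have hsupp : tsupport u ⊆ {p | 1 / 2 ≤ quartic p ∧ quartic p ≤ 3 / 2} := by
    refine closure_minimal (fun p hp => ?_) ((isClosed_le continuous_const hq.continuous).inter
      (isClosed_le hq.continuous continuous_const))
    have h1 : B (quartic p) ≠ 0 := left_ne_zero_of_mul hp
    have h2 : quartic p ∈ Function.support B := h1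
    rw [B.support_eq, Metric.mem_ball, Real.dist_eq, abs_lt] at h2
    exact ⟨by linarith [h2.1], by linarith [h2.2]⟩
  have hc : HasCompactSupport u := by
    refine HasCompactSupport.of_support_subset_isCompact (isCompact_closedBall (0 : Space n) 2)
      fun p hp => ?_
    have h1 := (hsupp (subset_tsupport u hp)).2
    rw [mem_closedBall_zero_iff, Prod.norm_def, sup_le_iff, Real.norm_eq_abs]
    simp only [quartic] at h1
    refine ⟨?_, ?_⟩
    · by_contra h2
      have h3 : (2 : ℝ) ^ 4 < ‖p.1‖ ^ 4 := pow_lt_pow_left₀ (not_le.1 h2) (by norm_num) (by norm_num)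
      nlinarith [sq_nonneg p.2]
    · refine abs_le_of_sq_le_sq' ?_ (by norm_num) |> abs_le.2
      have : 0 ≤ ‖p.1‖ ^ 4 := by positivity
      linarith
  have ho : (0 : Space n) ∉ tsupport u := fun h0 => by
    have := (hsupp h0).1
    simp [quartic] at this
    linarith
  have hae := ae_sphInt_grushinQuot_of_mem hn hh hu hc ho
  have hopen : IsOpen {p : Space n | 3 / 4 < quartic p ∧ quartic p < 5 / 4} :=
    (isOpen_lt continuous_const hq.continuous).inter (isOpen_lt hq.continuous continuous_const)
  have huG : ∀ p : Space n, 3 / 4 < quartic p ∧ quartic p < 5 / 4 → u =ᶠ[nhds p] G := fun p hp => by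
    filter_upwards [hopen.mem_nhds hp] with z hz
    have : B (quartic z) = 1 := B.one_of_mem_closedBall (by
      rw [Metric.mem_closedBall, Real.dist_eq, abs_le]
      exact ⟨by linarith [hz.1], by linarith [hz.2]⟩)
    simp only [hu_def, this, one_mul]
  have hdir : ∀ v, ∀ p : Space n, 3 / 4 < quartic p ∧ quartic p < 5 / 4 →
      dirDeriv v u =ᶠ[nhds p] dirDeriv v G := fun v p hp => by
    filter_upwards [hopen.mem_nhds hp] with z hz
    simp only [dirDeriv, (huG z hz).fderiv_eq]
  have hgr : ∀ p : Space n, 3 / 4 < quartic p ∧ quartic p < 5 / 4 → grushin u p = 0 := fun p hp => by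
    rw [← hG.grushin_eq p]
    have : ∀ v, dirDeriv v (dirDeriv v u) p = dirDeriv v (dirDeriv v G) p := fun v => by
      rw [dirDeriv, (hdir v p hp).fderiv_eq]; rfl
    simp only [grushin, this]
  have heu : ∀ p : Space n, 3 / 4 < quartic p ∧ quartic p < 5 / 4 → euler u p = j * G p :=
    fun p hp => by rw [← hG.euler_eq p, euler, (huG p hp).fderiv_eq]; rfl
  have heeu : ∀ p : Space n, 3 / 4 < quartic p ∧ quartic p < 5 / 4 →
      euler (euler u) p = j * (j * G p) := fun p hp => by
    have h1 : euler u =ᶠ[nhds p] fun z => j * G z := by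
      filter_upwards [hopen.mem_nhds hp] with z hz using heu z hz
    rw [euler, h1.fderiv_eq, ← hG.euler_eq p]
    exact dirDeriv_const_mul hG.contDiff _ _ p
  obtain ⟨r, hr, hr1, hr2, hr0⟩ : ∃ r : ℝ, (r ∈ Ioi (0 : ℝ) →
      r ^ 4 * sphInt h (grushinQuot u) r = sphInt h (euler (euler u)) r
        + n * sphInt h (euler u) r - k * (k + n) * sphInt h u r) ∧ 3 / 4 < r ^ 4 ∧ r ^ 4 < 5 / 4 ∧
        0 < r := by
    -- The coefficient formula holds only for a.e. r, hence on a dense set; the interval around 1 is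
    -- small enough that r⁴ stays in (3/4, 5/4).
    obtain ⟨r, hr, hr'⟩ := (Measure.dense_of_ae hae).exists_mem_open
      (isOpen_Ioo (a := (31 / 32 : ℝ)) (b := 33 / 32)) ⟨1, by norm_num⟩
    have h1 := pow_lt_pow_left₀ hr'.1 (by norm_num) (by norm_num : 4 ≠ 0)
    have h2 := pow_lt_pow_left₀ hr'.2 (by linarith [hr'.1]) (by norm_num : 4 ≠ 0)
    exact ⟨r, hr, lt_trans (by norm_num) h1, lt_trans h2 (by norm_num), by linarith [hr'.1]⟩
  have hval : ∀ (f : Space n → ℝ) (c : ℝ), (∀ p, 3 / 4 < quartic p ∧ quartic p < 5 / 4 →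
      f p = c * G p) → sphInt h f r = c * r ^ j * ∫ σ, g σ * h σ ∂sphereMeasure n := by
    intro f c hf
    rw [sphInt, ← integral_const_mul]
    refine integral_congr_ae (ae_quartic_eq_one.mono fun σ hσ => ?_)
    simp only
    rw [hf _ (by rw [quartic_dil, hσ, mul_one]; exact ⟨hr1, hr2⟩), hG.dil_eq, hGg σ hσ]
    ring
  have h1 := hr hr0
  rw [hval (grushinQuot u) 0 fun p hp => by rw [grushinQuot, hgr p hp]; ring,
    hval u 1 fun p hp => by rw [(huG p hp).eq_of_nhds, one_mul],
    hval (euler u) j heu, hval (euler (euler u)) (j * j) fun p hp => by rw [heeu p hp]; ring] at h1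
  -- The formula for the pairing reads 0 = (j(j + n) − k(k + n)) r^j ∫gh, and the bracket factors as
  -- (j − k)(j + k + n).
  have h2 : ((j : ℝ) - k) * ((j + k + n) * (r ^ j * ∫ σ, g σ * h σ ∂sphereMeasure n)) = 0 := by
    linear_combination -h1
  have h3 : (j : ℝ) - k ≠ 0 := sub_ne_zero.2 (by exact_mod_cast hjk)
  have h4 : (j : ℝ) + k + n ≠ 0 := by positivity
  have h5 : r ^ j ≠ 0 := by positivity
  simpa [h3, h4, h5] using h2

/-! ### Totality of the harmonic spaces. -/

/-- The polynomial `|x|²`. -/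
def normSqPoly (n : ℕ) : MvPolynomial (Fin n) ℝ := ∑ i, MvPolynomial.X i ^ 2

/-- The Laplacian on polynomials. -/
def polyLaplacian (q : MvPolynomial (Fin n) ℝ) : MvPolynomial (Fin n) ℝ :=
  ∑ i, MvPolynomial.pderiv i (MvPolynomial.pderiv i q)

theorem polyLaplacian_sub (p q : MvPolynomial (Fin n) ℝ) :
    polyLaplacian (p - q) = polyLaplacian p - polyLaplacian q := by
  simp [polyLaplacian, Finset.sum_sub_distrib]

theorem polyLaplacian_C_mul (c : ℝ) (q : MvPolynomial (Fin n) ℝ) :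
    polyLaplacian (MvPolynomial.C c * q) = MvPolynomial.C c * polyLaplacian q := by
  simp [polyLaplacian, Finset.mul_sum]

theorem isHomogeneous_polyLaplacian {d : ℕ} {q : MvPolynomial (Fin n) ℝ}
    (hq : q.IsHomogeneous (d + 2)) : (polyLaplacian q).IsHomogeneous d :=
  MvPolynomial.IsHomogeneous.sum _ _ _ fun _ _ => hq.pderiv.pderiv

theorem polyLaplacian_eq_zero {d : ℕ} {q : MvPolynomial (Fin n) ℝ} (hq : q.IsHomogeneous d)
    (hd : d < 2) : polyLaplacian q = 0 := by
  refine Finset.sum_eq_zero fun i _ => ?_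
  have h : (MvPolynomial.pderiv i q).IsHomogeneous 0 := by
    have := hq.pderiv (i := i)
    rwa [show d - 1 = 0 by omega] at this
  rw [← MvPolynomial.totalDegree_zero_iff_isHomogeneous,
    MvPolynomial.totalDegree_eq_zero_iff_eq_C] at h
  rw [h, MvPolynomial.pderiv_C]

theorem isHomogeneous_normSqPoly : (normSqPoly n).IsHomogeneous 2 :=
  MvPolynomial.IsHomogeneous.sum _ _ _ fun i _ => MvPolynomial.isHomogeneous_X_pow i 2

theorem polyLaplacian_normSqPoly_mul {d : ℕ} {r : MvPolynomial (Fin n) ℝ} (hr : r.IsHomogeneous d) :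
    polyLaplacian (normSqPoly n * r) =
      MvPolynomial.C (2 * n + 4 * d : ℝ) * r + normSqPoly n * polyLaplacian r := by
  have hN : ∀ i, MvPolynomial.pderiv i (normSqPoly n) = MvPolynomial.C 2 * MvPolynomial.X i := by
    intro i
    simp only [normSqPoly, map_sum, MvPolynomial.pderiv_pow, MvPolynomial.pderiv_X]
    rw [Finset.sum_eq_single i]
    · simp [map_ofNat]
    · intro j _ hj; simp [hj.symm]
    · simp
  have h1 : ∀ i, MvPolynomial.pderiv i (MvPolynomial.pderiv i (normSqPoly n * r)) =
      MvPolynomial.C 2 * r + MvPolynomial.C 4 * (MvPolynomial.X i * MvPolynomial.pderiv i r) +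
        normSqPoly n * MvPolynomial.pderiv i (MvPolynomial.pderiv i r) := by
    intro i
    have c4 : (MvPolynomial.C 4 : MvPolynomial (Fin n) ℝ) = 2 * MvPolynomial.C 2 := by
      rw [← map_ofNat (MvPolynomial.C : ℝ →+* MvPolynomial (Fin n) ℝ) 2, ← map_mul]; norm_num
    simp only [MvPolynomial.pderiv_mul, map_add, hN, MvPolynomial.pderiv_C, MvPolynomial.pderiv_X,
      Pi.single_eq_same, c4]
    ring
  simp only [polyLaplacian, h1, Finset.sum_add_distrib, ← Finset.mul_sum, hr.sum_X_mul_pderiv]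
  simp only [Finset.sum_const, Finset.card_univ, Fintype.card_fin, nsmul_eq_mul, map_add, map_mul,
    map_natCast]
  ring

/-- `a + |x|² Δ` is onto on homogeneous polynomials for `a > 0`. -/
theorem exists_add_normSqPoly_mul_polyLaplacian (d : ℕ) : ∀ a : ℝ, 0 < a →
    ∀ p : MvPolynomial (Fin n) ℝ, p.IsHomogeneous d → ∃ q : MvPolynomial (Fin n) ℝ,
      q.IsHomogeneous d ∧ MvPolynomial.C a * q + normSqPoly n * polyLaplacian q = p := by
  induction d using Nat.strong_induction_on with
  | _ d ih =>
    intro a ha p hp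
    have hC : (MvPolynomial.C a : MvPolynomial (Fin n) ℝ) * MvPolynomial.C a⁻¹ = 1 := by
      rw [← map_mul, mul_inv_cancel₀ ha.ne', map_one]
    by_cases hd : d < 2
    · refine ⟨MvPolynomial.C a⁻¹ * p, hp.C_mul _, ?_⟩
      rw [polyLaplacian_C_mul, polyLaplacian_eq_zero hp hd]
      linear_combination p * hC
    · obtain ⟨e, rfl⟩ : ∃ e, d = e + 2 := ⟨d - 2, by omega⟩
      -- Applying Δ to aq + |x|²Δq = p gives, for r = Δq of degree e, the equation (a + 2n + 4e)r +
      -- |x|²Δr = Δp of the same type in lower degree. Its solution r determines q = a⁻¹(p − |x|²r),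
      -- and this q does satisfy Δq = r.
      obtain ⟨r, hr, hr'⟩ := ih e (by omega) (a + (2 * n + 4 * e)) (by positivity)
        (polyLaplacian p) (isHomogeneous_polyLaplacian hp)
      have hNr : (normSqPoly n * r).IsHomogeneous (e + 2) := by
        rw [add_comm]; exact isHomogeneous_normSqPoly.mul hr
      refine ⟨MvPolynomial.C a⁻¹ * (p - normSqPoly n * r), (hp.sub hNr).C_mul _, ?_⟩
      rw [polyLaplacian_C_mul, polyLaplacian_sub, polyLaplacian_normSqPoly_mul hr, ← hr', map_add]
      linear_combination (p - normSqPoly n * r + normSqPoly n * r) * hC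

/-- A homogeneous polynomial is the sum of a harmonic one and a multiple of `|x|²`. -/
theorem exists_isSolidHarmonic_sub (hn : 0 < n) {d : ℕ} {p : MvPolynomial (Fin n) ℝ}
    (hp : p.IsHomogeneous (d + 2)) : ∃ q : MvPolynomial (Fin n) ℝ, q.IsHomogeneous d ∧
      IsSolidHarmonic (d + 2) (p - normSqPoly n * q) := by
  -- The polynomial p − |x|²q is harmonic exactly when (2n + 4d)q + |x|²Δq = Δp.
  obtain ⟨q, hq, hq'⟩ := exists_add_normSqPoly_mul_polyLaplacian d (2 * n + 4 * d : ℝ)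
    (by positivity) (polyLaplacian p) (isHomogeneous_polyLaplacian hp)
  refine ⟨q, hq, hp.sub ?_, ?_⟩
  · rw [add_comm]; exact isHomogeneous_normSqPoly.mul hq
  · change polyLaplacian _ = 0
    rw [polyLaplacian_sub, polyLaplacian_normSqPoly_mul hq, hq', sub_self]

theorem eval_normSqPoly (x : EuclideanSpace ℝ (Fin n)) :
    MvPolynomial.eval (fun i => x i) (normSqPoly n) = ‖x‖ ^ 2 := by
  rw [EuclideanSpace.norm_sq_eq]; simp [normSqPoly]

theorem integrable_mul_of_continuous {F g : Space n → ℝ} (hF : Integrable F (sphereMeasure n))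
    (hg : Continuous g) : Integrable (fun σ => F σ * g σ) (sphereMeasure n) := by
  obtain ⟨C, hC⟩ := (isCompact_closedBall (0 : Space n) 1).exists_bound_of_continuousOn
    hg.continuousOn
  have := hF.bdd_mul (f := g) hg.aestronglyMeasurable ((ae_mem_closedBall n).mono fun σ h => hC σ h)
  simpa only [mul_comm] using this

/-- An integrable function annihilates `g` if it annihilates uniform approximations of `g`. -/
theorem integral_mul_eq_zero_of_approx {F g : Space n → ℝ} (hF : Integrable F (sphereMeasure n))
    (hg : Continuous g) (h : ∀ ε : ℝ, 0 < ε → ∃ p : Space n → ℝ, Continuous p ∧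
      (∀ σ ∈ Metric.closedBall (0 : Space n) 1, |p σ - g σ| < ε) ∧
      ∫ σ, F σ * p σ ∂sphereMeasure n = 0) : ∫ σ, F σ * g σ ∂sphereMeasure n = 0 := by
  by_contra hne
  set I := ∫ σ, F σ * g σ ∂sphereMeasure n with hI
  set A := ∫ σ, |F σ| ∂sphereMeasure n with hA
  have hA0 : 0 ≤ A := integral_nonneg fun σ => abs_nonneg _
  have hI0 : 0 < |I| := abs_pos.2 hne
  -- The tolerance is chosen so that A·ε < |I|, with A + 1 in the denominator to cover A = 0.
  obtain ⟨p, hp, hpg, hp0⟩ := h (|I| / (A + 1)) (by positivity)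
  have h1 : |I| ≤ A * (|I| / (A + 1)) := by
    calc |I| = |∫ σ, F σ * (p σ - g σ) ∂sphereMeasure n| := by
          rw [← abs_neg, hI, ← zero_sub, ← hp0, ← integral_sub (integrable_mul_of_continuous hF hp)
            (integrable_mul_of_continuous hF hg)]
          simp only [mul_sub]
      _ ≤ ∫ σ, |F σ * (p σ - g σ)| ∂sphereMeasure n := abs_integral_le_integral_abs
      _ ≤ ∫ σ, |F σ| * (|I| / (A + 1)) ∂sphereMeasure n := by
          refine integral_mono_ae (integrable_mul_of_continuous hF (hp.sub hg)).abs
            (hF.abs.mul_const _) ((ae_mem_closedBall n).mono fun σ hσ => ?_)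
          simp only [abs_mul]
          exact mul_le_mul_of_nonneg_left (hpg σ hσ).le (abs_nonneg _)
      _ = A * (|I| / (A + 1)) := integral_mul_const _ _
  rw [mul_div_assoc', le_div_iff₀ (by positivity)] at h1
  nlinarith

theorem snd_mul_harmonicFn_zero (hn : 0 < n) (l : ℕ) (Y : MvPolynomial (Fin n) ℝ) (σ : Space n) :
    σ.2 * harmonicFn l 0 Y σ =
      1 / (4 * ((l : ℝ) / 2 + (n : ℝ) / 4)) * harmonicFn l 1 Y σ := by
  have : (l : ℝ) / 2 + (n : ℝ) / 4 ≠ 0 := by positivity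
  simp only [harmonicFn, gegenbauer]
  field_simp
  ring

/-- The Gegenbauer recurrence solved for its middle term: multiplication by t stays within the
functions built from the same Y. -/
theorem snd_mul_harmonicFn_succ (l m : ℕ) (Y : MvPolynomial (Fin n) ℝ) (σ : Space n) :
    σ.2 * harmonicFn l (m + 1) Y σ =
      ((m : ℝ) + 2) / (4 * ((m : ℝ) + 1 + ((l : ℝ) / 2 + (n : ℝ) / 4))) * harmonicFn l (m + 2) Y σ +
      ((m : ℝ) + 2 * ((l : ℝ) / 2 + (n : ℝ) / 4)) /
        (4 * ((m : ℝ) + 1 + ((l : ℝ) / 2 + (n : ℝ) / 4))) * harmonicFn l m Y σ := by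
  have : (m : ℝ) + 1 + ((l : ℝ) / 2 + (n : ℝ) / 4) ≠ 0 := by positivity
  simp only [harmonicFn, gegenbauer]
  generalize (l : ℝ) / 2 + (n : ℝ) / 4 = α at *
  field_simp
  ring

theorem continuous_harmonicFn (l m : ℕ) (Y : MvPolynomial (Fin n) ℝ) :
    Continuous (harmonicFn l m Y) := by
  unfold harmonicFn
  exact ((continuous_gegenbauer _ m).comp (by fun_prop)).mul (contDiff_eval Y).continuous

variable {F : Space n → ℝ}

/-- Each power of t is traded for neighbouring Gegenbauer indices, so the induction on j must treat
all m at once. -/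
theorem integral_pow_mul_harmonicFn_eq_zero (hn : 0 < n) (hF : Integrable F (sphereMeasure n))
    (h : ∀ k, ∀ g ∈ sphHarm n k, ∫ σ, F σ * g σ ∂sphereMeasure n = 0) {l : ℕ}
    {Y : MvPolynomial (Fin n) ℝ} (hY : IsSolidHarmonic l Y) (j : ℕ) :
    ∀ m, ∫ σ, F σ * (σ.2 ^ j * harmonicFn l m Y σ) ∂sphereMeasure n = 0 := by
  have hi : ∀ j m, Integrable (fun σ => F σ * (σ.2 ^ j * harmonicFn l m Y σ)) (sphereMeasure n) :=
    fun j m => integrable_mul_of_continuous hF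
      ((continuous_snd.pow j).mul (continuous_harmonicFn l m Y))
  induction j with
  | zero =>
    intro m
    simpa using h (l + 2 * m) _ (Submodule.subset_span ⟨l, m, Y, rfl, hY, rfl⟩)
  | succ j ih =>
    intro m
    cases m with
    | zero =>
      have e : ∀ σ : Space n, F σ * (σ.2 ^ (j + 1) * harmonicFn l 0 Y σ) =
          1 / (4 * ((l : ℝ) / 2 + (n : ℝ) / 4)) * (F σ * (σ.2 ^ j * harmonicFn l 1 Y σ)) :=
        fun σ => by
          rw [pow_succ, mul_assoc (σ.2 ^ j), snd_mul_harmonicFn_zero hn]; ring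
      simp only [e]
      rw [integral_const_mul, ih, mul_zero]
    | succ m =>
      have e : ∀ σ : Space n, F σ * (σ.2 ^ (j + 1) * harmonicFn l (m + 1) Y σ) =
          ((m : ℝ) + 2) / (4 * ((m : ℝ) + 1 + ((l : ℝ) / 2 + (n : ℝ) / 4))) *
            (F σ * (σ.2 ^ j * harmonicFn l (m + 2) Y σ)) +
          ((m : ℝ) + 2 * ((l : ℝ) / 2 + (n : ℝ) / 4)) /
            (4 * ((m : ℝ) + 1 + ((l : ℝ) / 2 + (n : ℝ) / 4))) *
            (F σ * (σ.2 ^ j * harmonicFn l m Y σ)) := fun σ => by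
        rw [pow_succ, mul_assoc (σ.2 ^ j), snd_mul_harmonicFn_succ]; ring
      simp only [e]
      rw [integral_add ((hi j _).const_mul _) ((hi j _).const_mul _), integral_const_mul,
        integral_const_mul, ih, ih, mul_zero, mul_zero, add_zero]

theorem integral_comp_snd_mul_solidHarmonic_eq_zero (hn : 0 < n)
    (hF : Integrable F (sphereMeasure n))
    (h : ∀ k, ∀ g ∈ sphHarm n k, ∫ σ, F σ * g σ ∂sphereMeasure n = 0) {l : ℕ}
    {Y : MvPolynomial (Fin n) ℝ} (hY : IsSolidHarmonic l Y) {g : ℝ → ℝ} (hg : Continuous g) :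
    ∫ σ, F σ * (g σ.2 * MvPolynomial.eval (fun i => σ.1 i) Y) ∂sphereMeasure n = 0 := by
  have hYc := (contDiff_eval Y).continuous
  have hFY := integrable_mul_of_continuous hF hYc
  have e : ∀ (f : ℝ → ℝ), ∫ σ, F σ * (f σ.2 * MvPolynomial.eval (fun i => σ.1 i) Y) ∂sphereMeasure n =
      ∫ σ, (F σ * MvPolynomial.eval (fun i => σ.1 i) Y) * f σ.2 ∂sphereMeasure n := fun f =>
    integral_congr_ae (Filter.Eventually.of_forall fun σ => by simp only; ring)
  rw [e]
  refine integral_mul_eq_zero_of_approx hFY (hg.comp continuous_snd) fun ε hε => ?_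
  obtain ⟨p, hp⟩ := exists_polynomial_near_of_continuousOn (-1) 1 g hg.continuousOn ε hε
  refine ⟨fun σ => p.eval σ.2, p.continuous.comp continuous_snd, fun σ hσ => ?_, ?_⟩
  · refine hp _ ?_
    rw [mem_closedBall_zero_iff, Prod.norm_def, sup_le_iff] at hσ
    exact abs_le.1 hσ.2
  · have e' : ∀ σ : Space n, F σ * MvPolynomial.eval (fun i => σ.1 i) Y * p.eval σ.2 =
        ∑ j ∈ Finset.range (p.natDegree + 1), p.coeff j * (F σ * (σ.2 ^ j * harmonicFn l 0 Y σ)) :=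
      fun σ => by
        rw [Polynomial.eval_eq_sum_range, Finset.mul_sum]
        refine Finset.sum_congr rfl fun j _ => ?_
        simp only [harmonicFn, gegenbauer]
        ring
    simp only [e']
    rw [integral_finsetSum]
    · refine Finset.sum_eq_zero fun j _ => ?_
      rw [integral_const_mul, integral_pow_mul_harmonicFn_eq_zero hn hF h hY, mul_zero]
    · exact fun j _ => (integrable_mul_of_continuous hF
        ((continuous_snd.pow j).mul (continuous_harmonicFn l 0 Y))).const_mul _

theorem norm_sq_of_quartic_eq_one {σ : Space n} (hσ : quartic σ = 1) :
    ‖σ.1‖ ^ 2 = √(1 - 4 * σ.2 ^ 2) := by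
  rw [eq_comm, Real.sqrt_eq_iff_mul_self_eq _ (by positivity)]
  · rw [quartic] at hσ; linear_combination -hσ
  · rw [quartic] at hσ; nlinarith [sq_nonneg (‖σ.1‖ ^ 2)]

/-- Write q as a harmonic polynomial plus |x|²r. On Ω the factor |x|² is √(1 − 4t²) and can be moved
into the function of t. Since this factor is not polynomial in t, the induction runs over arbitrary
continuous g. -/
theorem integral_comp_snd_mul_homogeneous_eq_zero (hn : 0 < n)
    (hF : Integrable F (sphereMeasure n))
    (h : ∀ k, ∀ g ∈ sphHarm n k, ∫ σ, F σ * g σ ∂sphereMeasure n = 0) (d : ℕ) :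
    ∀ q : MvPolynomial (Fin n) ℝ, q.IsHomogeneous d → ∀ g : ℝ → ℝ, Continuous g →
      ∫ σ, F σ * (g σ.2 * MvPolynomial.eval (fun i => σ.1 i) q) ∂sphereMeasure n = 0 := by
  induction d using Nat.strong_induction_on with
  | _ d ih =>
    intro q hq g hg
    by_cases hd : d < 2
    · exact integral_comp_snd_mul_solidHarmonic_eq_zero hn hF h
        ⟨hq, polyLaplacian_eq_zero hq hd⟩ hg
    · obtain ⟨e, rfl⟩ : ∃ e, d = e + 2 := ⟨d - 2, by omega⟩
      obtain ⟨r, hr, hqr⟩ := exists_isSolidHarmonic_sub hn hq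
      have hg' : Continuous fun t : ℝ => g t * √(1 - 4 * t ^ 2) := by fun_prop
      have h1 := integral_comp_snd_mul_solidHarmonic_eq_zero hn hF h hqr hg
      have h2 := ih e (by omega) r hr _ hg'
      have i1 := integrable_mul_of_continuous hF
        ((hg.comp continuous_snd).mul (contDiff_eval (q - normSqPoly n * r)).continuous)
      have i2 := integrable_mul_of_continuous hF
        ((hg'.comp continuous_snd).mul (contDiff_eval r).continuous)
      refine Eq.trans ?_ ((integral_add i1 i2).trans ((congrArg₂ (· + ·) h1 h2).trans (add_zero 0)))
      refine integral_congr_ae (ae_quartic_eq_one.mono fun σ hσ => ?_)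
      simp only [Function.comp_apply, Pi.mul_apply]
      rw [map_sub, map_mul, eval_normSqPoly, norm_sq_of_quartic_eq_one hσ]
      ring

theorem integral_pow_mul_eval_eq_zero (hn : 0 < n) (hF : Integrable F (sphereMeasure n))
    (h : ∀ k, ∀ g ∈ sphHarm n k, ∫ σ, F σ * g σ ∂sphereMeasure n = 0) (j : ℕ)
    (q : MvPolynomial (Fin n) ℝ) :
    ∫ σ, F σ * (σ.2 ^ j * MvPolynomial.eval (fun i => σ.1 i) q) ∂sphereMeasure n = 0 := by
  have e : ∀ σ : Space n, F σ * (σ.2 ^ j * MvPolynomial.eval (fun i => σ.1 i) q) =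
      ∑ d ∈ Finset.range (q.totalDegree + 1), F σ * (σ.2 ^ j *
        MvPolynomial.eval (fun i => σ.1 i) (MvPolynomial.homogeneousComponent d q)) := fun σ => by
    conv_lhs => rw [← MvPolynomial.sum_homogeneousComponent q]
    rw [map_sum, Finset.mul_sum, Finset.mul_sum]
  simp only [e]
  rw [integral_finsetSum]
  · exact Finset.sum_eq_zero fun d _ => integral_comp_snd_mul_homogeneous_eq_zero hn hF h d _
      (MvPolynomial.homogeneousComponent_isHomogeneous d q) (fun t => t ^ j) (by fun_prop)
  · exact fun d _ => integrable_mul_of_continuous hF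
      ((continuous_snd.pow j).mul (contDiff_eval _).continuous)

/-- Stone–Weierstrass on the closed unit ball for the algebra generated by the coordinates, which is
spanned by products t^j q(x). -/
theorem integral_mul_continuous_eq_zero (hn : 0 < n) (hF : Integrable F (sphereMeasure n))
    (h : ∀ k, ∀ g ∈ sphHarm n k, ∫ σ, F σ * g σ ∂sphereMeasure n = 0) {g : Space n → ℝ}
    (hg : Continuous g) : ∫ σ, F σ * g σ ∂sphereMeasure n = 0 := by
  let cT : C(Space n, ℝ) := ⟨fun σ => σ.2, continuous_snd⟩
  let cX : Fin n → C(Space n, ℝ) := fun i => ⟨fun σ => σ.1 i, (contDiff_coord i).continuous⟩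
  let S : Set C(Space n, ℝ) := insert cT (range cX)
  have hsep : (Algebra.adjoin ℝ S).SeparatesPoints := by
    intro σ τ hne
    by_cases h2 : σ.2 = τ.2
    · have h1 : σ.1 ≠ τ.1 := fun h1 => hne (Prod.ext h1 h2)
      obtain ⟨i, hi⟩ : ∃ i, σ.1 i ≠ τ.1 i := by
        by_contra hcon
        push Not at hcon
        exact h1 (PiLp.ext hcon)
      exact ⟨_, ⟨cX i, Algebra.subset_adjoin (mem_insert_of_mem _ ⟨i, rfl⟩), rfl⟩, hi⟩
    · exact ⟨_, ⟨cT, Algebra.subset_adjoin (mem_insert _ _), rfl⟩, h2⟩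
  have hclosure : ∀ f ∈ Submonoid.closure S, ∃ (j : ℕ) (q : MvPolynomial (Fin n) ℝ),
      ∀ σ, f σ = σ.2 ^ j * MvPolynomial.eval (fun i => σ.1 i) q := by
    intro f hf
    induction hf using Submonoid.closure_induction with
    | mem f hf =>
      rcases hf with rfl | ⟨i, rfl⟩
      · exact ⟨1, 1, fun σ => by simp [cT]⟩
      · exact ⟨0, MvPolynomial.X i, fun σ => by simp [cX]⟩
    | one => exact ⟨0, 1, fun σ => by simp⟩
    | mul f g _ _ hf hg =>
      obtain ⟨j, q, hf⟩ := hf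
      obtain ⟨k, r, hg⟩ := hg
      exact ⟨j + k, q * r, fun σ => by rw [ContinuousMap.mul_apply, hf, hg, map_mul]; ring⟩
  have hadj : ∀ f ∈ Algebra.adjoin ℝ S, ∫ σ, F σ * f σ ∂sphereMeasure n = 0 := by
    intro f hf
    rw [← Subalgebra.mem_toSubmodule, Algebra.adjoin_eq_span] at hf
    induction hf using Submodule.span_induction with
    | mem f hf =>
      obtain ⟨j, q, hfq⟩ := hclosure f hf
      simp only [hfq]
      exact integral_pow_mul_eval_eq_zero hn hF h j q
    | zero => simp
    | add f g _ _ hf hg =>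
      simp only [ContinuousMap.add_apply, mul_add]
      rw [integral_add (integrable_mul_of_continuous hF f.continuous)
        (integrable_mul_of_continuous hF g.continuous), hf, hg, add_zero]
    | smul c f _ hf =>
      simp only [ContinuousMap.smul_apply, smul_eq_mul, mul_left_comm _ c]
      rw [integral_const_mul, hf, mul_zero]
  refine integral_mul_eq_zero_of_approx hF hg fun ε hε => ?_
  obtain ⟨p, hp, hpg⟩ :=
    ContinuousMap.exists_mem_subalgebra_near_continuous_of_isCompact_of_separatesPoints hsep ⟨g, hg⟩
      (isCompact_closedBall (0 : Space n) 1) hε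
  exact ⟨p, p.continuous, hpg, hadj p hp⟩

/-- The spaces `H_k` are total: an integrable function that is orthogonal to all of them
vanishes. -/
theorem ae_eq_zero_of_orthogonal (hn : 0 < n) (hF : Integrable F (sphereMeasure n))
    (h : ∀ k, ∀ g ∈ sphHarm n k, ∫ σ, F σ * g σ ∂sphereMeasure n = 0) :
    F =ᵐ[sphereMeasure n] 0 := by
  refine ae_eq_zero_of_integral_contDiff_smul_eq_zero hF.locallyIntegrable fun g hg _ => ?_
  simp only [smul_eq_mul, mul_comm (g _)]
  exact integral_mul_continuous_eq_zero hn hF h hg.continuous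

/-! ### The Hilbert basis of spherical harmonics and Parseval's identity. -/

theorem exists_spherePoint_eq {σ : Space n} (hσ : quartic σ = 1) (h0 : σ.1 ≠ 0) :
    ∃ q : ℝ × Metric.sphere (0 : EuclideanSpace ℝ (Fin n)) 1,
      q.1 ∈ Ioo 0 Real.pi ∧ spherePoint q = σ := by
  have hx : 0 < ‖σ.1‖ := norm_pos_iff.2 h0
  have h1 : (2 * σ.2) ^ 2 < 1 := by
    rw [quartic] at hσ; nlinarith [pow_pos hx 4]
  have hab := abs_lt.1 ((sq_lt_one_iff_abs_lt_one _).1 h1)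
  have hw : (‖σ.1‖⁻¹ • σ.1) ∈ Metric.sphere (0 : EuclideanSpace ℝ (Fin n)) 1 := by
    rw [mem_sphere_zero_iff_norm, norm_smul, norm_inv, norm_norm, inv_mul_cancel₀ hx.ne']
  refine ⟨(Real.arccos (2 * σ.2), ⟨_, hw⟩), ⟨Real.arccos_pos.2 hab.2, ?_⟩, ?_⟩
  · refine lt_of_le_of_ne (Real.arccos_le_pi _) fun h => ?_
    rw [Real.arccos_eq_pi] at h
    linarith [hab.1]
  · have h2 : √(1 - (2 * σ.2) ^ 2) = ‖σ.1‖ ^ 2 := by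
      rw [norm_sq_of_quartic_eq_one hσ]; ring_nf
    simp only [spherePoint, Real.sin_arccos, h2, Real.cos_arccos hab.1.le hab.2.le,
      Real.sqrt_sq hx.le, smul_smul, mul_inv_cancel₀ hx.ne', one_smul]
    exact Prod.ext rfl (by simp)

/-- Continuous functions that agree a.e. on `Ω` agree on `Ω` away from the poles. -/
theorem eq_of_ae_eq_sphereMeasure {f g : Space n → ℝ} (hf : Continuous f) (hg : Continuous g)
    (h : f =ᵐ[sphereMeasure n] g) {σ : Space n} (hσ : quartic σ = 1) (h0 : σ.1 ≠ 0) :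
    f σ = g σ := by
  have hsp : Continuous (spherePoint (n := n)) := by unfold spherePoint; fun_prop
  have h1 := ae_of_ae_map measurable_spherePoint.aemeasurable h
  rw [ae_withDensity_iff (by fun_prop)] at h1
  have e : ((volume : Measure ℝ).restrict (Ioo 0 Real.pi)).prod
      (volume : Measure (EuclideanSpace ℝ (Fin n))).toSphere = ((volume : Measure ℝ).prod
      (volume : Measure (EuclideanSpace ℝ (Fin n))).toSphere).restrict (Ioo 0 Real.pi ×ˢ univ) := by
    rw [← Measure.prod_restrict, Measure.restrict_univ]
  have hopen : IsOpen (Ioo 0 Real.pi ×ˢ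
      (univ : Set (Metric.sphere (0 : EuclideanSpace ℝ (Fin n)) 1))) := isOpen_Ioo.prod isOpen_univ
  rw [e] at h1
  have h2 : (fun q => f (spherePoint q)) =ᵐ[((volume : Measure ℝ).prod
      (volume : Measure (EuclideanSpace ℝ (Fin n))).toSphere).restrict (Ioo 0 Real.pi ×ˢ univ)]
      fun q => g (spherePoint q) := by
    -- The density (sin φ)^{n/2} is positive on (0, π), so null sets for dΩ are null for dφ dw. The
    -- latter measure charges every nonempty open set of parameters, whence continuous functions
    -- agree there everywhere.
    filter_upwards [h1, ae_restrict_mem hopen.measurableSet] with q hq hq'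
    refine hq ?_
    have := Real.rpow_pos_of_pos (Real.sin_pos_of_mem_Ioo hq'.1) ((n : ℝ) / 2)
    simpa using this
  obtain ⟨q, hq, rfl⟩ := exists_spherePoint_eq hσ h0
  exact Measure.eqOn_open_of_ae_eq h2 hopen (hf.comp hsp).continuousOn (hg.comp hsp).continuousOn
    ⟨hq, mem_univ _⟩

theorem inner_toLpHarm {k : ℕ} (f : Lp ℝ 2 (sphereMeasure n)) (g : sphHarm n k) :
    inner ℝ (toLpHarm n k g) f = ∫ σ, f σ * (g : Space n → ℝ) σ ∂sphereMeasure n := by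
  rw [L2.inner_def]
  refine integral_congr_ae ?_
  filter_upwards [(memLp_of_mem g.2).coeFn_toLp] with σ hσ
  simp only [toLpHarm, LinearMap.coe_mk, AddHom.coe_mk, hσ]
  simp

theorem integral_toLp_mul {f g : Space n → ℝ} (hf : MemLp f 2 (sphereMeasure n)) :
    ∫ σ, hf.toLp f σ * g σ ∂sphereMeasure n = ∫ σ, f σ * g σ ∂sphereMeasure n :=
  integral_congr_ae (hf.coeFn_toLp.mono fun σ h => by simp only [h])

theorem lintegral_sq_of_memLp {f : Space n → ℝ} (hf : MemLp f 2 (sphereMeasure n)) :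
    ∫⁻ σ, ENNReal.ofReal (f σ ^ 2) ∂sphereMeasure n =
      ENNReal.ofReal (inner ℝ (hf.toLp f) (hf.toLp f)) := by
  rw [L2.inner_def, ← ofReal_integral_eq_lintegral_ofReal hf.integrable_sq
    (Filter.Eventually.of_forall fun σ => sq_nonneg _)]
  congr 1
  refine integral_congr_ae (hf.coeFn_toLp.mono fun σ h => ?_)
  simp only [h]
  simp [sq]

/-- The `k`-th eigenspace as a subspace of `L²(Ω, dΩ)`. -/
def lpHarm (n k : ℕ) : Submodule ℝ (Lp ℝ 2 (sphereMeasure n)) := LinearMap.range (toLpHarm n k)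

instance (k : ℕ) : FiniteDimensional ℝ (lpHarm n k) := by unfold lpHarm; infer_instance

theorem orthogonalFamily_lpHarm (hn : 0 < n) :
    OrthogonalFamily ℝ (fun k => lpHarm n k) fun k => (lpHarm n k).subtypeₗᵢ := by
  rintro j k hjk ⟨_, f, rfl⟩ ⟨_, g, rfl⟩
  change inner ℝ (toLpHarm n j f) (toLpHarm n k g) = 0
  rw [inner_toLpHarm]
  refine (integral_toLp_mul (memLp_of_mem g.2)).trans ?_
  exact integral_mul_eq_zero_of_mem_sphHarm hn hjk.symm g.2 f.2

/-- An orthonormal basis of `H_k` in `L²(Ω, dΩ)`. -/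
def lpBasis (n k : ℕ) : OrthonormalBasis (Fin (Module.finrank ℝ (lpHarm n k))) ℝ (lpHarm n k) :=
  stdOrthonormalBasis ℝ (lpHarm n k)

/-- The index set of an orthonormal basis of spherical harmonics. -/
abbrev HarmIndex (n : ℕ) : Type := Σ k : ℕ, Fin (Module.finrank ℝ (lpHarm n k))

theorem exists_harm (j : HarmIndex n) : ∃ g : sphHarm n j.1,
    toLpHarm n j.1 g = (lpBasis n j.1 j.2 : Lp ℝ 2 (sphereMeasure n)) :=
  (lpBasis n j.1 j.2).2

/-- An orthonormal basis of spherical harmonics, as continuous functions. -/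
def harm (j : HarmIndex n) : Space n → ℝ := (exists_harm j).choose

theorem harm_mem (j : HarmIndex n) : harm j ∈ sphHarm n j.1 := (exists_harm j).choose.2

theorem continuous_harm (j : HarmIndex n) : Continuous (harm j) :=
  continuous_of_mem_sphHarm (harm_mem j)

theorem toLpHarm_harm (j : HarmIndex n) : toLpHarm n j.1 ⟨harm j, harm_mem j⟩ =
    (lpBasis n j.1 j.2 : Lp ℝ 2 (sphereMeasure n)) := (exists_harm j).choose_spec

theorem inner_lpBasis (f : Lp ℝ 2 (sphereMeasure n)) (j : HarmIndex n) :
    inner ℝ (lpBasis n j.1 j.2 : Lp ℝ 2 (sphereMeasure n)) f =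
      ∫ σ, f σ * harm j σ ∂sphereMeasure n := by
  rw [← toLpHarm_harm, inner_toLpHarm]

/-- The expansion of an element of `H_k` in the orthonormal basis. -/
theorem ae_eq_sum_harm {k : ℕ} {g : Space n → ℝ} (hg : g ∈ sphHarm n k) :
    g =ᵐ[sphereMeasure n] fun σ => ∑ i : Fin (Module.finrank ℝ (lpHarm n k)),
      (∫ τ, g τ * harm ⟨k, i⟩ τ ∂sphereMeasure n) * harm ⟨k, i⟩ σ := by
  set c : Fin (Module.finrank ℝ (lpHarm n k)) → ℝ :=
    fun i => ∫ τ, g τ * harm ⟨k, i⟩ τ ∂sphereMeasure n with hc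
  have h1 : toLpHarm n k ⟨g, hg⟩ =
      toLpHarm n k (∑ i, c i • ⟨harm ⟨k, i⟩, harm_mem ⟨k, i⟩⟩) := by
    have h2 := congrArg (Subtype.val) ((lpBasis n k).sum_repr' ⟨toLpHarm n k ⟨g, hg⟩, ⟨_, rfl⟩⟩)
    rw [map_sum]
    refine h2.symm.trans ?_
    simp only [Submodule.coe_sum, Submodule.coe_smul]
    refine Finset.sum_congr rfl fun i _ => ?_
    rw [map_smul, toLpHarm_harm ⟨k, i⟩, Submodule.coe_inner]
    congr 1
    rw [inner_lpBasis _ ⟨k, i⟩]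
    exact integral_toLp_mul (memLp_of_mem hg)
  have h2 : ⇑(toLpHarm n k ⟨g, hg⟩) =ᵐ[sphereMeasure n] g := (memLp_of_mem hg).coeFn_toLp
  have h3 := (memLp_of_mem (∑ i, c i • (⟨harm ⟨k, i⟩, harm_mem ⟨k, i⟩⟩ : sphHarm n k)).2).coeFn_toLp
  have h4 : ⇑(toLpHarm n k ⟨g, hg⟩) =ᵐ[sphereMeasure n]
    ((∑ i, c i • (⟨harm ⟨k, i⟩, harm_mem ⟨k, i⟩⟩ : sphHarm n k) : sphHarm n k) : Space n → ℝ) := by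
    rw [h1]; exact h3
  refine h2.symm.trans (h4.trans (Filter.Eventually.of_forall fun σ => ?_))
  simp [Finset.sum_apply, hc]

/-- The projection onto H_k is a choice made separately on each sphere, and an a.e. formula on each
sphere would not directly control it as a function of p. A pointwise expansion off the poles does.
-/
theorem eq_sum_harm {k : ℕ} {g : Space n → ℝ} (hg : g ∈ sphHarm n k) {σ : Space n}
    (hσ : quartic σ = 1) (h0 : σ.1 ≠ 0) : g σ = ∑ i : Fin (Module.finrank ℝ (lpHarm n k)),
      (∫ τ, g τ * harm ⟨k, i⟩ τ ∂sphereMeasure n) * harm ⟨k, i⟩ σ := by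
  refine eq_of_ae_eq_sphereMeasure (continuous_of_mem_sphHarm hg) ?_ (ae_eq_sum_harm hg) hσ h0
  exact continuous_finsetSum _ fun i _ => continuous_const.mul (continuous_harm _)

theorem integral_mul_eq_zero_of_harm {F : Space n → ℝ} (hF : Integrable F (sphereMeasure n))
    (h : ∀ j, ∫ σ, F σ * harm j σ ∂sphereMeasure n = 0) {k : ℕ} {g : Space n → ℝ}
    (hg : g ∈ sphHarm n k) : ∫ σ, F σ * g σ ∂sphereMeasure n = 0 := by
  have e : ∫ σ, F σ * g σ ∂sphereMeasure n =
      ∫ σ, ∑ i : Fin (Module.finrank ℝ (lpHarm n k)),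
        (∫ τ, g τ * harm ⟨k, i⟩ τ ∂sphereMeasure n) * (F σ * harm ⟨k, i⟩ σ) ∂sphereMeasure n := by
    refine integral_congr_ae ((ae_eq_sum_harm hg).mono fun σ hσ => ?_)
    simp only
    rw [hσ, Finset.mul_sum]
    exact Finset.sum_congr rfl fun i _ => by ring
  rw [e, integral_finsetSum]
  · refine Finset.sum_eq_zero fun i _ => ?_
    rw [integral_const_mul, h, mul_zero]
  · exact fun i _ => (integrable_mul_of_continuous hF (continuous_harm _)).const_mul _

theorem orthonormal_lpBasis (hn : 0 < n) : Orthonormal ℝ fun j : HarmIndex n =>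
    (lpBasis n j.1 j.2 : Lp ℝ 2 (sphereMeasure n)) := by
  have h := OrthogonalFamily.orthonormal_sigma_orthonormal (orthogonalFamily_lpHarm hn)
    (v_family := fun k i => lpBasis n k i) fun k => (lpBasis n k).orthonormal
  exact h

/-- The Hilbert basis of spherical harmonics. -/
def harmBasis (hn : 0 < n) : HilbertBasis (HarmIndex n) ℝ (Lp ℝ 2 (sphereMeasure n)) :=
  HilbertBasis.mkOfOrthogonalEqBot (orthonormal_lpBasis hn) (by
    rw [Submodule.eq_bot_iff]
    intro f hf
    have hfi : Integrable f (sphereMeasure n) := (Lp.memLp f).integrable one_le_two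
    refine Lp.eq_zero_iff_ae_eq_zero.2 (ae_eq_zero_of_orthogonal hn hfi fun k g hg =>
      integral_mul_eq_zero_of_harm hfi (fun j => ?_) hg)
    rw [← inner_lpBasis]
    exact hf _ (Submodule.subset_span ⟨j, rfl⟩))

theorem inner_harmBasis (hn : 0 < n) (f : Lp ℝ 2 (sphereMeasure n)) (j : HarmIndex n) :
    inner ℝ (harmBasis hn j) f = ∫ σ, f σ * harm j σ ∂sphereMeasure n := by
  rw [← inner_lpBasis, harmBasis, HilbertBasis.coe_mkOfOrthogonalEqBot]

theorem hasSum_sq_of_memLp (hn : 0 < n) {f : Space n → ℝ} (hf : MemLp f 2 (sphereMeasure n)) :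
    HasSum (fun j => (∫ σ, f σ * harm j σ ∂sphereMeasure n) ^ 2)
      (inner ℝ (hf.toLp f) (hf.toLp f)) := by
  have h := (harmBasis hn).hasSum_inner_mul_inner (hf.toLp f) (hf.toLp f)
  have e : (fun j => (∫ σ, f σ * harm j σ ∂sphereMeasure n) ^ 2) = fun j =>
      inner ℝ (hf.toLp f) (harmBasis hn j) * inner ℝ (harmBasis hn j) (hf.toLp f) := by
    funext j
    rw [real_inner_comm, inner_harmBasis, integral_toLp_mul hf, sq]
  rw [e]
  exact h

/-- Parseval's identity in `[0, ∞]` for integrable functions on `Ω`. -/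
theorem lintegral_sq_eq_tsum (hn : 0 < n) {F : Space n → ℝ} (hF : Integrable F (sphereMeasure n)) :
    ∫⁻ σ, ENNReal.ofReal (F σ ^ 2) ∂sphereMeasure n =
      ∑' j, ENNReal.ofReal ((∫ σ, F σ * harm j σ ∂sphereMeasure n) ^ 2) := by
  have hL2 : MemLp F 2 (sphereMeasure n) → ∫⁻ σ, ENNReal.ofReal (F σ ^ 2) ∂sphereMeasure n =
      ∑' j, ENNReal.ofReal ((∫ σ, F σ * harm j σ ∂sphereMeasure n) ^ 2) := fun hF2 => by
    have h := hasSum_sq_of_memLp hn hF2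
    rw [lintegral_sq_of_memLp hF2, ← h.tsum_eq,
      ENNReal.ofReal_tsum_of_nonneg (fun j => sq_nonneg _) h.summable]
  -- If the squared coefficients are summable, Riesz–Fischer supplies an L² function with the same
  -- coefficients. Totality among integrable functions forces it to equal F, so F is in L² after
  -- all.
  by_cases hs : Summable fun j => (∫ σ, F σ * harm j σ ∂sphereMeasure n) ^ 2
  · set c : HarmIndex n → ℝ := fun j => ∫ σ, F σ * harm j σ ∂sphereMeasure n with hc
    have hcm : Memℓp c 2 := by
      refine memℓp_gen ?_
      simpa using hs
    set G : Lp ℝ 2 (sphereMeasure n) := (harmBasis hn).repr.symm ⟨c, hcm⟩ with hG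
    have hGi : Integrable G (sphereMeasure n) := (Lp.memLp G).integrable one_le_two
    have hGc : ∀ j, ∫ σ, G σ * harm j σ ∂sphereMeasure n = c j := fun j => by
      rw [← inner_harmBasis hn, ← HilbertBasis.repr_apply_apply, hG,
        LinearIsometryEquiv.apply_symm_apply]
    have h0 : (fun σ => F σ - G σ) =ᵐ[sphereMeasure n] 0 := by
      refine ae_eq_zero_of_orthogonal hn (hF.sub hGi) fun k g hg =>
        integral_mul_eq_zero_of_harm (hF.sub hGi) (fun j => ?_) hg
      refine (integral_congr_ae (Filter.Eventually.of_forall fun σ => sub_mul _ _ _)).trans ?_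
      rw [integral_sub (integrable_mul_of_continuous hF (continuous_harm j))
        (integrable_mul_of_continuous hGi (continuous_harm j)), hGc, sub_self]
    have h1 : G =ᵐ[sphereMeasure n] F := h0.mono fun σ hσ => by
      simp only [Pi.zero_apply] at hσ; linarith
    exact hL2 ((memLp_congr_ae h1).1 (Lp.memLp G))
  -- Otherwise the sum is ∞; a finite left side would put F in L², and its coefficients would then
  -- be square summable.
  · have htop : ∑' j, ENNReal.ofReal ((∫ σ, F σ * harm j σ ∂sphereMeasure n) ^ 2) = ⊤ := by
      by_contra hne
      refine hs ?_
      have := ENNReal.summable_toReal hne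
      refine this.congr fun j => ?_
      rw [ENNReal.toReal_ofReal (sq_nonneg _)]
    by_contra hne
    rw [htop] at hne
    have hF2 : MemLp F 2 (sphereMeasure n) := by
      refine ⟨hF.aestronglyMeasurable, ?_⟩
      rw [eLpNorm_lt_top_iff_lintegral_rpow_enorm_lt_top (by norm_num) (by norm_num)]
      refine lt_of_le_of_lt (le_of_eq ?_) (lt_top_iff_ne_top.2 hne)
      refine lintegral_congr fun σ => ?_
      rw [Real.enorm_eq_ofReal_abs, ENNReal.toReal_ofNat, ENNReal.ofReal_rpow_of_nonneg (abs_nonneg _)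
        (by norm_num)]
      simp
    exact hs (hasSum_sq_of_memLp hn hF2).summable

/-! ### The norms of the theorem in polar coordinates. -/

theorem normSq_eq (g : Space n → ℝ) : normSq g = ∫⁻ p, ENNReal.ofReal (g p ^ 2) := by
  rw [normSq, eLpNorm_eq_lintegral_rpow_enorm_toReal (by norm_num) (by norm_num),
    ENNReal.toReal_ofNat, ← ENNReal.rpow_natCast, ← ENNReal.rpow_mul]
  norm_num
  refine lintegral_congr fun p => ?_
  rw [Real.enorm_eq_ofReal_abs, ← ENNReal.ofReal_pow (abs_nonneg _), sq_abs]

theorem rho_dil_of_quartic_eq_one {r : ℝ} (hr : 0 ≤ r) {σ : Space n} (hσ : quartic σ = 1) :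
    rho (dil r σ) = r := by
  rw [rho_dil hr, rho_of_quartic_eq_one hσ, mul_one]

/-- The squared integrands all have the form |x|²·w(ϱ)·K² off the null set x = 0, because ψ =
|x|²/ϱ². The factor |x|² is then consumed by the polar formula. -/
theorem normSq_polar (hn : 0 < n) {g K : Space n → ℝ} {w : ℝ → ℝ} (hK : Measurable K)
    (hw : Measurable w) (hw0 : ∀ r, 0 < r → 0 ≤ w r)
    (hg : ∀ p : Space n, p.1 ≠ 0 → g p ^ 2 = ‖p.1‖ ^ 2 * (w (rho p) * K p ^ 2)) :
    normSq g = ∫⁻ r in Ioi (0 : ℝ), ENNReal.ofReal (r ^ (n + 3) / 2 * w r) *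
      ∫⁻ σ, ENNReal.ofReal (K (dil r σ) ^ 2) ∂sphereMeasure n := by
  have hm : Measurable fun p : Space n => ENNReal.ofReal (w (rho p) * K p ^ 2) :=
    ((hw.comp continuous_rho.measurable).mul (hK.pow_const 2)).ennreal_ofReal
  have h1 : normSq g = ∫⁻ p : Space n,
      ENNReal.ofReal (‖p.1‖ ^ 2) * ENNReal.ofReal (w (rho p) * K p ^ 2) := by
    rw [normSq_eq]
    refine lintegral_congr_ae ((ae_fst_ne_zero hn).mono fun p hp => ?_)
    simp only
    rw [hg p hp, ENNReal.ofReal_mul (by positivity)]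
  have hI : Measurable fun r => ∫⁻ σ, ENNReal.ofReal (w (rho (dil r σ)) * K (dil r σ) ^ 2)
      ∂sphereMeasure n := by
    have h2 : Measurable fun q : ℝ × Space n =>
        ENNReal.ofReal (w (rho (dil q.1 q.2)) * K (dil q.1 q.2) ^ 2) :=
      hm.comp (continuous_dil (n := n)).measurable
    exact h2.lintegral_prod_right'
  rw [h1, lintegral_polar hn hm, lintegral_radialMeasure hI]
  refine setLIntegral_congr_fun measurableSet_Ioi fun r hr => ?_
  have hr0 : (0 : ℝ) < r := hr
  have hKr : Measurable fun σ : Space n => ENNReal.ofReal (K (dil r σ) ^ 2) :=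
    ((hK.comp (continuous_dil_left r).measurable).pow_const 2).ennreal_ofReal
  rw [ENNReal.ofReal_mul (by positivity), mul_assoc, ← lintegral_const_mul _ hKr]
  congr 1
  refine lintegral_congr_ae (ae_quartic_eq_one.mono fun σ hσ => ?_)
  simp only
  rw [rho_dil_of_quartic_eq_one hr0.le hσ, ENNReal.ofReal_mul (hw0 r hr0)]

theorem isSphProj_sphProj {k : ℕ} {f : Space n → ℝ} (hf : MemLp f 2 (sphereMeasure n)) :
    IsSphProj k f (sphProj k f) := by
  have h := exists_isSphProj (k := k) hf
  rw [sphProj, dif_pos h]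
  exact h.choose_spec

theorem integral_sphProj_mul {k : ℕ} {f h : Space n → ℝ} (hf : MemLp f 2 (sphereMeasure n))
    (hh : h ∈ sphHarm n k) :
    ∫ σ, sphProj k f σ * h σ ∂sphereMeasure n = ∫ σ, f σ * h σ ∂sphereMeasure n := by
  have h1 := isSphProj_sphProj (k := k) hf
  have hc := continuous_of_mem_sphHarm hh
  have h2 := h1.2 h hh
  have i1 := integrable_mul_of_continuous (hf.integrable one_le_two) hc
  have i2 := integrable_mul_of_continuous
    (integrable_sphere_of_continuous (continuous_of_mem_sphHarm h1.1)) hc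
  simp only [sub_mul] at h2
  rw [integral_sub i1 i2] at h2
  linarith

/-- In Parseval's identity for the projection only the block of index k survives, by orthogonality;
there the coefficients of the projection are those of f. -/
theorem lintegral_sphProj_sq (hn : 0 < n) {k : ℕ} {f : Space n → ℝ}
    (hf : MemLp f 2 (sphereMeasure n)) :
    ∫⁻ σ, ENNReal.ofReal (sphProj k f σ ^ 2) ∂sphereMeasure n =
      ∑' i : Fin (Module.finrank ℝ (lpHarm n k)),
        ENNReal.ofReal ((∫ σ, f σ * harm ⟨k, i⟩ σ ∂sphereMeasure n) ^ 2) := by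
  have hmem := (isSphProj_sphProj (k := k) hf).1
  rw [lintegral_sq_eq_tsum hn (integrable_sphere_of_continuous (continuous_of_mem_sphHarm hmem)),
    ENNReal.tsum_sigma', tsum_eq_single k]
  · exact tsum_congr fun i => by rw [integral_sphProj_mul hf (harm_mem ⟨k, i⟩)]
  · intro j hj
    refine ENNReal.tsum_eq_zero.2 fun i => ?_
    rw [integral_mul_eq_zero_of_mem_sphHarm hn hj.symm hmem (harm_mem ⟨j, i⟩)]
    simp

theorem memLp_of_continuous {f : Space n → ℝ} (hf : Continuous f) :
    MemLp f 2 (sphereMeasure n) := by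
  obtain ⟨C, hC⟩ := (isCompact_closedBall (0 : Space n) 1).exists_bound_of_continuousOn
    hf.continuousOn
  exact MemLp.of_bound hf.aestronglyMeasurable C ((ae_mem_closedBall n).mono fun σ h => hC σ h)

theorem quartic_dil_inv_rho {p : Space n} (hp : p ≠ 0) : quartic (dil (1 / rho p) p) = 1 := by
  have := rho_pos hp
  rw [quartic_dil, ← rho_pow_four]
  field_simp

/-- The radial norm `∫_0^∞ α(r)² r^{n-3}/2 dr`. -/
def radNormSq (n : ℕ) (α : ℝ → ℝ) : ENNReal :=
  ∫⁻ r in Ioi (0 : ℝ), ENNReal.ofReal (r ^ n / r ^ 3 / 2 * α r ^ 2)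

/-- Covers u (a = 1, m = 2) and u_ϱ = Eu/ϱ (a = 1/r, m = 1) together; the continuous f' carries the
regularity. The condition a²r⁴ = r^{2m} makes the weight (r^{n+3}/2)·a²/(r²r^{2m}) equal to
r^{n−3}/2. -/
theorem normSq_harmProj (hn : 0 < n) {k : ℕ} {f f' : Space n → ℝ} (hf' : Continuous f')
    {a : ℝ → ℝ} (ha : Measurable a) {m : ℕ}
    (hf : ∀ r, 0 < r → ∀ σ : Space n, quartic σ = 1 → f (dil r σ) = a r * f' (dil r σ))
    (ham : ∀ r, 0 < r → a r ^ 2 * r ^ 4 = (r ^ m) ^ 2) :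
    normSq (fun p => harmProj k f p * √(psi p) / rho p ^ m) =
      ∑' i : Fin (Module.finrank ℝ (lpHarm n k)), radNormSq n (sphInt (harm ⟨k, i⟩) f') := by
  set K : Space n → ℝ := fun p => ∑ i : Fin (Module.finrank ℝ (lpHarm n k)),
    (a (rho p) * sphInt (harm ⟨k, i⟩) f' (rho p)) * harm ⟨k, i⟩ (dil (1 / rho p) p) with hK_def
  have hρ := (continuous_rho (n := n)).measurable
  have hc : ∀ i, Continuous (sphInt (harm (n := n) i) f') := fun i =>
    continuous_sphInt (continuous_harm i) hf'
  have hdil : Measurable fun p : Space n => dil (1 / rho p) p := by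
    have h1 : Measurable fun p : Space n => (1 / rho p, p) :=
      (measurable_const.div hρ).prodMk measurable_id
    exact (continuous_dil (n := n)).measurable.comp h1
  have hK : Measurable K := by
    refine Finset.measurable_sum _ fun i _ => ?_
    exact ((ha.comp hρ).mul ((hc _).measurable.comp hρ)).mul
      ((continuous_harm _).measurable.comp hdil)
  have hmem : ∀ r, 0 < r → MemLp (fun σ => f (dil r σ)) 2 (sphereMeasure n) := fun r hr => by
    have h1 : MemLp (fun σ => a r * f' (dil r σ)) 2 (sphereMeasure n) :=
      memLp_of_continuous (continuous_const.mul (hf'.comp (continuous_dil_left r)))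
    exact (memLp_congr_ae (ae_quartic_eq_one.mono fun σ hσ => hf r hr σ hσ)).2 h1
  have hcoef : ∀ r, 0 < r → ∀ i : Fin (Module.finrank ℝ (lpHarm n k)),
      ∫ σ, f (dil r σ) * harm ⟨k, i⟩ σ ∂sphereMeasure n = a r * sphInt (harm ⟨k, i⟩) f' r := by
    intro r hr i
    rw [sphInt, ← integral_const_mul]
    refine integral_congr_ae (ae_quartic_eq_one.mono fun σ hσ => ?_)
    simp only
    rw [hf r hr σ hσ, mul_assoc]
  have hproj : ∀ r, 0 < r → ∀ σ : Space n, quartic σ = 1 → σ.1 ≠ 0 →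
      sphProj k (fun σ => f (dil r σ)) σ = ∑ i : Fin (Module.finrank ℝ (lpHarm n k)),
        (a r * sphInt (harm ⟨k, i⟩) f' r) * harm ⟨k, i⟩ σ := by
    intro r hr σ hσ h0
    rw [eq_sum_harm (isSphProj_sphProj (hmem r hr)).1 hσ h0]
    refine Finset.sum_congr rfl fun i _ => ?_
    rw [integral_sphProj_mul (hmem r hr) (harm_mem ⟨k, i⟩), hcoef r hr]
  -- Off the axis the projection, chosen sphere by sphere, coincides with the measurable function
  -- `K`.
  have hKp : ∀ p : Space n, p.1 ≠ 0 → harmProj k f p = K p := by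
    intro p hp
    have hr := rho_pos_of_fst hp
    have hp' : p ≠ 0 := fun h => hp (by rw [h]; rfl)
    rw [harmProj, hproj _ hr _ (quartic_dil_inv_rho hp')]
    exact smul_ne_zero (one_div_pos.2 hr).ne' hp
  have hKs : ∀ r, 0 < r → ∀ᵐ σ ∂sphereMeasure n,
      K (dil r σ) = sphProj k (fun σ => f (dil r σ)) σ := by
    intro r hr
    filter_upwards [ae_quartic_eq_one, ae_fst_ne_zero_sphere] with σ hσ h0
    rw [hproj r hr σ hσ h0]
    simp only [hK_def]
    rw [rho_dil_of_quartic_eq_one hr.le hσ, dil_dil, one_div, inv_mul_cancel₀ hr.ne', dil_one]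
  rw [normSq_polar hn hK (w := fun r => 1 / (r ^ 2 * (r ^ m) ^ 2)) (by fun_prop)
    (fun r _ => by positivity) fun p hp => ?_]
  · simp only [radNormSq]
    rw [← lintegral_tsum fun i => by
      have := (hc ⟨k, i⟩).measurable
      fun_prop]
    refine setLIntegral_congr_fun measurableSet_Ioi fun r hr => ?_
    have hr0 : (0 : ℝ) < r := hr
    have e1 : ∫⁻ σ, ENNReal.ofReal (K (dil r σ) ^ 2) ∂sphereMeasure n =
        ∫⁻ σ, ENNReal.ofReal (sphProj k (fun σ => f (dil r σ)) σ ^ 2) ∂sphereMeasure n :=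
      lintegral_congr_ae ((hKs r hr0).mono fun σ hσ => by simp only [hσ])
    rw [e1, lintegral_sphProj_sq hn (hmem r hr0), ← ENNReal.tsum_mul_left]
    refine tsum_congr fun i => ?_
    rw [hcoef r hr0, ← ENNReal.ofReal_mul (by positivity)]
    congr 1
    have h1 := ham r hr0
    have h2 : a r ^ 2 = (r ^ m) ^ 2 / r ^ 4 := by rw [← h1]; field_simp
    rw [mul_pow, h2]
    field_simp
    ring
  · have hr := rho_pos_of_fst hp
    rw [hKp p hp, div_pow, mul_pow, Real.sq_sqrt (by rw [psi_eq hp]; positivity), psi_eq hp]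
    field_simp

theorem dil_ne_zero {r : ℝ} (hr : 0 < r) {σ : Space n} (hσ : quartic σ = 1) : dil r σ ≠ 0 := by
  intro h
  have h1 := rho_dil_of_quartic_eq_one hr.le hσ
  have h2 := rho_pow_four (0 : Space n)
  rw [h] at h1
  rw [h1] at h2
  simp [quartic] at h2
  exact hr.ne' h2

theorem normSq_harmProj_self (hn : 0 < n) (k : ℕ) {u : Space n → ℝ} (hu : ContDiff ℝ ∞ u) :
    normSq (fun p => harmProj k u p * √(psi p) / rho p ^ 2) =
      ∑' i : Fin (Module.finrank ℝ (lpHarm n k)), radNormSq n (sphInt (harm ⟨k, i⟩) u) :=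
  normSq_harmProj hn hu.continuous (a := fun _ => 1) measurable_const
    (fun r _ σ _ => (one_mul _).symm) fun r _ => by ring

theorem normSq_harmProj_radialDeriv (hn : 0 < n) (k : ℕ) {u : Space n → ℝ}
    (hu : ContDiff ℝ ∞ u) :
    normSq (fun p => harmProj k (radialDeriv u) p * √(psi p) / rho p) =
      ∑' i : Fin (Module.finrank ℝ (lpHarm n k)),
        radNormSq n (sphInt (harm ⟨k, i⟩) (euler u)) := by
  have h := normSq_harmProj hn (k := k) (f := radialDeriv u) (contDiff_euler hu).continuous
    (a := fun r => 1 / r) (by fun_prop) (m := 1)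
    (fun r hr σ hσ => by
      rw [radialDeriv_eq hu (dil_ne_zero hr hσ), rho_dil_of_quartic_eq_one hr.le hσ]
      ring) fun r hr => by field_simp
  simpa only [pow_one] using h

/-- Parseval on almost every sphere, where mere integrability suffices. The factor r⁶w(r) converts
the density (r^{n+3}/2)w(r) into r^{n−3}/2. -/
theorem normSq_eq_tsum (hn : 0 < n) {g K : Space n → ℝ} {w : ℝ → ℝ} (hK : Measurable K)
    (hw : Measurable w) (hw0 : ∀ r, 0 < r → 0 ≤ w r)
    (hg : ∀ p : Space n, p.1 ≠ 0 → g p ^ 2 = ‖p.1‖ ^ 2 * (w (rho p) * K p ^ 2))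
    (hi : ∀ᵐ r : ℝ, r ∈ Ioi (0 : ℝ) → Integrable (fun σ => K (dil r σ)) (sphereMeasure n))
    {α : HarmIndex n → ℝ → ℝ} (hα : ∀ j, Measurable (α j))
    (h : ∀ j, ∀ᵐ r : ℝ, r ∈ Ioi (0 : ℝ) →
      r ^ 6 * w r * sphInt (harm j) K r ^ 2 = α j r ^ 2) :
    normSq g = ∑' j, radNormSq n (α j) := by
  rw [normSq_polar hn hK hw hw0 hg]
  simp only [radNormSq]
  rw [← lintegral_tsum fun j => by
    have := hα j
    fun_prop]
  refine setLIntegral_congr_fun_ae measurableSet_Ioi ?_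
  filter_upwards [hi, ae_all_iff.2 h] with r hir hr hr0
  have hr0' : (0 : ℝ) < r := hr0
  have hwr := hw0 r hr0'
  rw [lintegral_sq_eq_tsum hn (hir hr0), ← ENNReal.tsum_mul_left]
  refine tsum_congr fun j => ?_
  rw [← ENNReal.ofReal_mul (by positivity), ← hr j hr0, sphInt]
  congr 1
  field_simp
  ring

/-! ### Coefficient sums for the radial and the full operator. -/

/-- The radial part of `L_G` on the coefficient along `h`, up to the factor `ψ/ϱ²`. -/
def radialCoeff (h u : Space n → ℝ) (r : ℝ) : ℝ :=
  sphInt h (euler (euler u)) r + n * sphInt h (euler u) r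

theorem continuous_radialCoeff {h u : Space n → ℝ} (hh : Continuous h) (hu : ContDiff ℝ ∞ u) :
    Continuous (radialCoeff h u) :=
  (continuous_sphInt hh (contDiff_euler (contDiff_euler hu)).continuous).add
    (continuous_const.mul (continuous_sphInt hh (contDiff_euler hu).continuous))

theorem radialGrushinOp_div_sq {u : Space n → ℝ} (hu : ContDiff ℝ ∞ u) {p : Space n}
    (hp : p.1 ≠ 0) : (radialGrushinOp u p / √(psi p)) ^ 2 =
      ‖p.1‖ ^ 2 * (1 / rho p ^ 6 * (euler (euler u) p + n * euler u p) ^ 2) := by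
  have hr := rho_pos_of_fst hp
  have hp' : p ≠ 0 := fun h => hp (by rw [h]; rfl)
  have hx : 0 < ‖p.1‖ := norm_pos_iff.2 hp
  rw [radialGrushinOp_eq hu hp', div_pow, Real.sq_sqrt (by rw [psi_eq hp]; positivity), psi_eq hp]
  field_simp

theorem grushinOp_div_sq {u : Space n → ℝ} (hu : ContDiff ℝ ∞ u) {p : Space n}
    (hp : p.1 ≠ 0) : (grushinOp u p / √(psi p)) ^ 2 =
      ‖p.1‖ ^ 2 * (rho p ^ 2 * grushinQuot u p ^ 2) := by
  have hr := rho_pos_of_fst hp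
  have hx : 0 < ‖p.1‖ := norm_pos_iff.2 hp
  rw [grushinOp_eq hu, div_pow, Real.sq_sqrt (by rw [psi_eq hp]; positivity), psi_eq hp,
    grushinQuot]
  field_simp

theorem normSq_radialGrushinOp (hn : 0 < n) {u : Space n → ℝ} (hu : ContDiff ℝ ∞ u) :
    normSq (fun p => radialGrushinOp u p / √(psi p)) =
      ∑' j, radNormSq n (radialCoeff (harm j) u) := by
  have c1 := (contDiff_euler hu).continuous
  have c2 := (contDiff_euler (contDiff_euler hu)).continuous
  have hK : Continuous fun p => euler (euler u) p + n * euler u p := by fun_prop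
  refine normSq_eq_tsum hn hK.measurable (w := fun r => 1 / r ^ 6) (by fun_prop)
    (fun r _ => by positivity) (fun p hp => radialGrushinOp_div_sq hu hp)
    (Filter.Eventually.of_forall fun r _ =>
      integrable_sphere_of_continuous (hK.comp (continuous_dil_left r)))
    (fun j => (continuous_radialCoeff (continuous_harm j) hu).measurable)
    fun j => Filter.Eventually.of_forall fun r hr => ?_
  have hr0 : (0 : ℝ) < r := hr
  have e : sphInt (harm j) (fun p => euler (euler u) p + n * euler u p) r =
      radialCoeff (harm j) u r := by
    simp only [sphInt, radialCoeff, add_mul, mul_assoc]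
    rw [integral_add, integral_const_mul]
    · exact integrable_sphere_of_continuous
        ((c2.comp (continuous_dil_left r)).mul (continuous_harm j))
    · exact integrable_sphere_of_continuous (continuous_const.mul
        ((c1.comp (continuous_dil_left r)).mul (continuous_harm j)))
  rw [e]
  field_simp

/-- Since |x|²·(L_G u/|x|²) equals the integrable function L_G u off x = 0, Fubini in polar
coordinates gives integrability on almost every sphere. Square integrability can fail for n = 2. -/
theorem ae_integrable_grushinQuot (hn : 0 < n) {u : Space n → ℝ} (hu : ContDiff ℝ ∞ u)
    (hc : HasCompactSupport u) : ∀ᵐ r : ℝ, r ∈ Ioi (0 : ℝ) →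
      Integrable (fun σ => grushinQuot u (dil r σ)) (sphereMeasure n) := by
  have h1 : Integrable fun p : Space n => ‖p.1‖ ^ 2 * grushinQuot u p := by
    refine (integrable_congr ?_).2 (integrable_grushin_mul hu hc
      (g := fun _ => 1) continuous_const)
    simpa only [mul_one] using grushinQuot_mul hn u (fun _ => 1)
  have h2 := ((integrable_polar_iff hn (measurable_grushinQuot hu)).2 h1).prod_right_ae
  rw [radialMeasure, ae_withDensity_iff (by fun_prop), ae_restrict_iff' measurableSet_Ioi] at h2
  refine h2.mono fun r hr hr0 => hr hr0 ?_
  have hr0' : (0 : ℝ) < r := hr0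
  exact (ENNReal.ofReal_pos.2 (by positivity)).ne'

theorem normSq_grushinOp (hn : 0 < n) {u : Space n → ℝ} (hu : ContDiff ℝ ∞ u)
    (hc : HasCompactSupport u) (ho : (0 : Space n) ∉ tsupport u) :
    normSq (fun p => grushinOp u p / √(psi p)) =
      ∑' j, radNormSq n (fun r => radialCoeff (harm j) u r
        - 4 * sphEigenvalue n j.1 * sphInt (harm j) u r) := by
  refine normSq_eq_tsum hn (measurable_grushinQuot hu) (w := fun r => r ^ 2) (by fun_prop)
    (fun r _ => by positivity) (fun p hp => grushinOp_div_sq hu hp)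
    (ae_integrable_grushinQuot hn hu hc) (fun j => ?_) fun j => ?_
  · have h1 := (continuous_radialCoeff (continuous_harm j) hu).measurable
    have h2 := (continuous_sphInt (continuous_harm j) hu.continuous).measurable
    fun_prop
  · filter_upwards [ae_sphInt_grushinQuot_of_mem hn (harm_mem j) hu hc ho] with r hr hr0
    have h := hr hr0
    rw [sphEigenvalue, radialCoeff, show 4 * ((j.1 : ℝ) * (j.1 + n) / 4) = j.1 * (j.1 + n) by ring,
      ← h]
    ring

/-! ### The one-dimensional identity for a single coefficient. -/

theorem radNormSq_eq_ofReal {α : ℝ → ℝ} (hα : ContinuousOn α (Ioi 0)) {a b : ℝ} (ha : 0 < a)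
    (h0 : ∀ r, 0 < r → r ∉ Icc a b → α r = 0) :
    radNormSq n α = ENNReal.ofReal (∫ r in Ioi (0 : ℝ), r ^ n / r ^ 3 / 2 * α r ^ 2) := by
  rw [radNormSq, ofReal_integral_eq_lintegral_ofReal]
  · refine integrableOn_Ioi_of_continuousOn ha (b := b) ?_ fun r hr hr' => by rw [h0 r hr hr']; simp
    refine ContinuousOn.mul (ContinuousOn.div_const (ContinuousOn.div (by fun_prop) (by fun_prop)
      fun r hr => ?_) _) (hα.pow 2)
    have hr0 : (0 : ℝ) < r := hr
    positivity
  · refine (ae_restrict_iff' measurableSet_Ioi).2 (Filter.Eventually.of_forall fun r hr => ?_)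
    have hr0 : (0 : ℝ) < r := hr
    simp only [Pi.zero_apply]
    positivity

/-- The weights are kept as quotients because the exponent n − 3 is negative for n = 2, where
subtraction of natural numbers would truncate it to 0. -/
theorem hasDerivAt_pow_div_sq (hn : 2 ≤ n) {r : ℝ} (hr : 0 < r) :
    HasDerivAt (fun r : ℝ => r ^ n / r ^ 2) (((n : ℝ) - 2) * (r ^ n / r ^ 3)) r := by
  obtain ⟨m, rfl⟩ := Nat.exists_eq_add_of_le hn
  refine (((hasDerivAt_pow (2 + m) r).fun_div (hasDerivAt_pow 2 r) (by positivity))).congr_deriv ?_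
  rw [show 2 + m - 1 = m + 1 by omega]
  push_cast
  field_simp
  ring

theorem continuousOn_weight : ContinuousOn (fun r : ℝ => r ^ n / r ^ 3) (Ioi 0) :=
  ContinuousOn.div (by fun_prop) (by fun_prop) fun r hr => by
    have hr0 : (0 : ℝ) < r := hr
    positivity

/-- Let α, β and A be the pairings of u, Eu and E²u + nEu. Then rα' = β and rβ' = A − nβ, so
(r^{n−2}(αβ + α²))' = r^{n−3}(Aα + β² + (n − 2)α²). The added α² cancels the terms in αβ. -/
theorem setIntegral_radial_identity (hn : 2 ≤ n) {h u : Space n → ℝ} (hh : Continuous h)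
    (hu : ContDiff ℝ ∞ u) {a b : ℝ} (ha : 0 < a) (hab : a ≤ b)
    (hs : ∀ p ∈ tsupport u, rho p ∈ Icc a b) :
    ∫ r in Ioi (0 : ℝ), r ^ n / r ^ 3 * (radialCoeff h u r * sphInt h u r
      + sphInt h (euler u) r ^ 2 + ((n : ℝ) - 2) * sphInt h u r ^ 2) = 0 := by
  have hu1 := contDiff_euler hu
  have z0 := fun r hr hr' => (supportedIn_of_tsupport hs subset_rfl).sphInt_eq_zero h
    (r := r) hr hr'
  have z1 := fun r hr hr' => (supportedIn_of_tsupport hs (tsupport_euler u)).sphInt_eq_zero h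
    (r := r) hr hr'
  have c0 := continuous_sphInt hh hu.continuous
  have c1 := continuous_sphInt hh hu1.continuous
  have c2 := continuous_radialCoeff hh hu
  refine setIntegral_Ioi_deriv_eq_zero ha hab (g := fun r => r ^ n / r ^ 2 *
    (sphInt h (euler u) r * sphInt h u r + sphInt h u r ^ 2)) (fun r hr => ?_) ?_
    (fun r hr hr' => by simp [z0 r hr hr']) fun r hr hr' => by simp [z0 r hr hr', z1 r hr hr']
  · have d0 := hasDerivAt_sphInt hh hu hr
    have d1 := hasDerivAt_sphInt hh hu1 hr
    refine ((hasDerivAt_pow_div_sq hn hr).fun_mul ((d1.fun_mul d0).fun_add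
      (d0.fun_pow 2))).congr_deriv ?_
    rw [radialCoeff]
    field_simp
    ring
  · exact continuousOn_weight.mul (by fun_prop)

/-- Expansion of (A − 4lα)² leaves the cross term −4l∫r^{n−3}Aα, which `setIntegral_radial_identity`
turns into 4l∫r^{n−3}(β² + (n − 2)α²). The computation takes place among real integrals, all finite
by the compact support in (0, ∞); nonnegativity of every term, which uses n ≥ 2, then transfers it
to [0, ∞]. -/
theorem radNormSq_identity (hn : 2 ≤ n) {h u : Space n → ℝ} (hh : Continuous h)
    (hu : ContDiff ℝ ∞ u) (hc : HasCompactSupport u) (ho : (0 : Space n) ∉ tsupport u)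
    {l : ℝ} (hl : 0 ≤ l) :
    radNormSq n (fun r => radialCoeff h u r - 4 * l * sphInt h u r) =
      radNormSq n (radialCoeff h u) + 16 * (ENNReal.ofReal (l ^ 2) * radNormSq n (sphInt h u))
        + 8 * (ENNReal.ofReal l * radNormSq n (sphInt h (euler u)))
        + 8 * ENNReal.ofReal ((n : ℝ) - 2) *
          (ENNReal.ofReal l * radNormSq n (sphInt h u)) := by
  obtain ⟨a, b, ha, hab, hs⟩ := exists_supportedIn hc ho
  have hu1 := contDiff_euler hu
  have z0 := fun r hr hr' => (supportedIn_of_tsupport hs subset_rfl).sphInt_eq_zero h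
    (r := r) hr hr'
  have z1 := fun r hr hr' => (supportedIn_of_tsupport hs (tsupport_euler u)).sphInt_eq_zero h
    (r := r) hr hr'
  have z2 := fun r hr hr' => (supportedIn_of_tsupport hs
    ((tsupport_euler _).trans (tsupport_euler u))).sphInt_eq_zero h (r := r) hr hr'
  have zA : ∀ r, 0 < r → r ∉ Icc a b → radialCoeff h u r = 0 := fun r hr hr' => by
    rw [radialCoeff, z2 r hr hr', z1 r hr hr']; simp
  have c0 := continuous_sphInt hh hu.continuous
  have c1 := continuous_sphInt hh hu1.continuous
  have c2 := continuous_radialCoeff hh hu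
  have hn2 : (0 : ℝ) ≤ (n : ℝ) - 2 := by
    have : (2 : ℝ) ≤ n := by exact_mod_cast hn
    linarith
  have hI : ∀ f : ℝ → ℝ, Continuous f → (∀ r, 0 < r → r ∉ Icc a b → f r = 0) →
      IntegrableOn (fun r => r ^ n / r ^ 3 / 2 * f r ^ 2) (Ioi 0) := fun f hf h0 =>
    integrableOn_Ioi_of_continuousOn ha ((continuousOn_weight.div_const _).mul (by fun_prop))
      (b := b) fun r hr hr' => by simp [h0 r hr hr']
  have hpos : ∀ f : ℝ → ℝ, 0 ≤ ∫ r in Ioi (0 : ℝ), r ^ n / r ^ 3 / 2 * f r ^ 2 := fun f =>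
    setIntegral_nonneg measurableSet_Ioi fun r hr => by
      have hr0 : (0 : ℝ) < r := hr
      positivity
  have i0 := hI _ c0 z0
  have i1 := hI _ c1 z1
  have iA := hI _ c2 zA
  have iX : IntegrableOn (fun r => r ^ n / r ^ 3 * (radialCoeff h u r * sphInt h u r
      + sphInt h (euler u) r ^ 2 + ((n : ℝ) - 2) * sphInt h u r ^ 2)) (Ioi 0) :=
    integrableOn_Ioi_of_continuousOn ha (continuousOn_weight.mul (by fun_prop))
      (b := b) fun r hr hr' => by simp [z0 r hr hr', z1 r hr hr']
  have key : ∫ r in Ioi (0 : ℝ), r ^ n / r ^ 3 / 2 *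
      (radialCoeff h u r - 4 * l * sphInt h u r) ^ 2 =
      (∫ r in Ioi (0 : ℝ), r ^ n / r ^ 3 / 2 * radialCoeff h u r ^ 2)
      + 16 * (l ^ 2 * ∫ r in Ioi (0 : ℝ), r ^ n / r ^ 3 / 2 * sphInt h u r ^ 2)
      + 8 * (l * ∫ r in Ioi (0 : ℝ), r ^ n / r ^ 3 / 2 * sphInt h (euler u) r ^ 2)
      + 8 * ((n : ℝ) - 2) * (l * ∫ r in Ioi (0 : ℝ), r ^ n / r ^ 3 / 2 * sphInt h u r ^ 2) := by
    have h0 := setIntegral_radial_identity hn hh hu ha hab hs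
    have e : (∫ r in Ioi (0 : ℝ), r ^ n / r ^ 3 / 2 *
        (radialCoeff h u r - 4 * l * sphInt h u r) ^ 2) =
        ∫ r in Ioi (0 : ℝ), (((r ^ n / r ^ 3 / 2 * radialCoeff h u r ^ 2
        + (16 * l ^ 2 + 8 * ((n : ℝ) - 2) * l) * (r ^ n / r ^ 3 / 2 * sphInt h u r ^ 2))
        + 8 * l * (r ^ n / r ^ 3 / 2 * sphInt h (euler u) r ^ 2))
        - 4 * l * (r ^ n / r ^ 3 * (radialCoeff h u r * sphInt h u r
          + sphInt h (euler u) r ^ 2 + ((n : ℝ) - 2) * sphInt h u r ^ 2))) := by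
      congr 1
      funext r
      ring
    rw [e, integral_sub ((iA.fun_add (i0.const_mul _)).fun_add (i1.const_mul _)) (iX.const_mul _),
      integral_add (iA.fun_add (i0.const_mul _)) (i1.const_mul _),
      integral_add iA (i0.const_mul _), integral_const_mul, integral_const_mul,
      integral_const_mul, h0]
    ring
  have p0 := hpos (sphInt h u)
  have p1 := hpos (sphInt h (euler u))
  have pA := hpos (radialCoeff h u)
  rw [radNormSq_eq_ofReal (by fun_prop) ha (b := b)
      (fun r hr hr' => by simp [zA r hr hr', z0 r hr hr']), key,
    radNormSq_eq_ofReal c2.continuousOn ha zA, radNormSq_eq_ofReal c1.continuousOn ha z1,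
    radNormSq_eq_ofReal c0.continuousOn ha z0, ENNReal.ofReal_add (by positivity) (by positivity),
    ENNReal.ofReal_add (by positivity) (by positivity),
    ENNReal.ofReal_add (by positivity) (by positivity),
    ENNReal.ofReal_mul (p := 16) (by norm_num), ENNReal.ofReal_mul (p := l ^ 2) (by positivity),
    ENNReal.ofReal_mul (p := 8 * ((n : ℝ) - 2)) (by positivity),
    ENNReal.ofReal_mul (p := 8) (by norm_num), ENNReal.ofReal_mul (p := 8) (by norm_num),
    ENNReal.ofReal_mul hl, ENNReal.ofReal_mul hl, ENNReal.ofReal_ofNat, ENNReal.ofReal_ofNat]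

/-! ### Summation over the basis, and finiteness of the norms. -/

theorem sphEigenvalue_nonneg (n k : ℕ) : 0 ≤ sphEigenvalue n k := by
  unfold sphEigenvalue
  positivity

theorem normSq_grushinOp_eq (hn : 2 ≤ n) {u : Space n → ℝ} (hu : ContDiff ℝ ∞ u)
    (hc : HasCompactSupport u) (ho : (0 : Space n) ∉ tsupport u) :
    normSq (fun p => grushinOp u p / √(psi p))
        = normSq (fun p => radialGrushinOp u p / √(psi p))
          + 16 * ∑' k : ℕ, ENNReal.ofReal (sphEigenvalue n k ^ 2) *
              normSq (fun p => harmProj k u p * √(psi p) / rho p ^ 2)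
          + 8 * ∑' k : ℕ, ENNReal.ofReal (sphEigenvalue n k) *
              normSq (fun p => harmProj k (radialDeriv u) p * √(psi p) / rho p)
          + 8 * ENNReal.ofReal ((n : ℝ) - 2) *
              ∑' k : ℕ, ENNReal.ofReal (sphEigenvalue n k) *
                normSq (fun p => harmProj k u p * √(psi p) / rho p ^ 2) := by
  have hn0 : 0 < n := by omega
  -- The eigenvalue depends on k alone, so the sums over k of projection norms become sums over the
  -- whole basis, and the identity can be compared term by term.
  have e : ∀ (c : ℕ → ENNReal) (f : HarmIndex n → ENNReal),
      ∑' k, c k * ∑' i, f ⟨k, i⟩ = ∑' j : HarmIndex n, c j.1 * f j := fun c f => by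
    rw [ENNReal.tsum_sigma']
    exact tsum_congr fun k => ENNReal.tsum_mul_left.symm
  simp only [normSq_harmProj_self hn0 _ hu, normSq_harmProj_radialDeriv hn0 _ hu]
  rw [normSq_grushinOp hn0 hu hc ho, normSq_radialGrushinOp hn0 hu,
    e (fun k => ENNReal.ofReal (sphEigenvalue n k ^ 2)) fun j => radNormSq n (sphInt (harm j) u),
    e (fun k => ENNReal.ofReal (sphEigenvalue n k)) fun j => radNormSq n (sphInt (harm j) u),
    e (fun k => ENNReal.ofReal (sphEigenvalue n k))
      fun j => radNormSq n (sphInt (harm j) (euler u)),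
    ← ENNReal.tsum_mul_left, ← ENNReal.tsum_mul_left, ← ENNReal.tsum_mul_left,
    ← ENNReal.tsum_add, ← ENNReal.tsum_add, ← ENNReal.tsum_add]
  exact tsum_congr fun j =>
    radNormSq_identity hn (continuous_harm j) hu hc ho (sphEigenvalue_nonneg n j.1)

/-- The radial operator carries a factor ψ, so division by ψ^{1/2} creates no singularity on x = 0.
On the support ϱ ≥ a > 0, which bounds the remaining factor ϱ⁻⁶ by a⁻⁶. -/
theorem normSq_radialGrushinOp_ne_top (hn : 0 < n) {u : Space n → ℝ} (hu : ContDiff ℝ ∞ u)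
    (hc : HasCompactSupport u) (ho : (0 : Space n) ∉ tsupport u) :
    normSq (fun p => radialGrushinOp u p / √(psi p)) ≠ ⊤ := by
  obtain ⟨a, b, ha, hab, hs⟩ := exists_supportedIn hc ho
  have c1 := (contDiff_euler hu).continuous
  have c2 := (contDiff_euler (contDiff_euler hu)).continuous
  have hz : ∀ p, p ∉ tsupport u → euler (euler u) p + n * euler u p = 0 := fun p hp => by
    have hp1 : p ∉ tsupport (euler u) := fun h => hp (tsupport_euler u h)
    have hp2 : p ∉ tsupport (euler (euler u)) := fun h => hp1 (tsupport_euler _ h)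
    rw [image_eq_zero_of_notMem_tsupport hp1, image_eq_zero_of_notMem_tsupport hp2]
    simp
  have hi : Integrable fun p : Space n =>
      ‖p.1‖ ^ 2 * (1 / a ^ 6 * (euler (euler u) p + n * euler u p) ^ 2) := by
    refine Continuous.integrable_of_hasCompactSupport (by fun_prop) ?_
    exact HasCompactSupport.intro hc fun p hp => by simp [hz p hp]
  rw [normSq_eq]
  refine ne_top_of_le_ne_top hi.lintegral_lt_top.ne (lintegral_mono_ae
    ((ae_fst_ne_zero hn).mono fun p hp => ENNReal.ofReal_le_ofReal ?_))
  rw [radialGrushinOp_div_sq hu hp]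
  by_cases hp' : p ∈ tsupport u
  · have := (hs p hp').1
    gcongr
  · simp [hz p hp']

/-- In spherical coordinates the density is r^{n−1}/r² = r^{n−3}, with nonnegative exponent when n ≥
3. -/
theorem integrable_indicator_inv_norm_sq (hn : 3 ≤ n) (R : ℝ) :
    Integrable fun x : EuclideanSpace ℝ (Fin n) =>
      (Iic R).indicator (fun y : ℝ => 1 / y ^ 2) ‖x‖ := by
  have : Nonempty (Fin n) := ⟨⟨0, by omega⟩⟩
  rw [integrable_fun_norm_addHaar, finrank_euclideanSpace_fin]
  have h1 : IntegrableOn ((Iic R).indicator fun y : ℝ => y ^ (n - 3)) (Ioi 0) := by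
    rw [IntegrableOn, integrable_indicator_iff measurableSet_Iic, IntegrableOn,
      Measure.restrict_restrict measurableSet_Iic]
    have h2 : IntegrableOn (fun y : ℝ => y ^ (n - 3)) (Icc 0 R) :=
      (continuous_pow _).continuousOn.integrableOn_Icc
    exact h2.mono_set fun y hy => ⟨le_of_lt hy.2, hy.1⟩
  refine h1.congr_fun (fun y hy => ?_) measurableSet_Ioi
  have hy0 : (0 : ℝ) < y := hy
  by_cases hR : y ∈ Iic R
  · rw [indicator_of_mem hR, indicator_of_mem hR, show n - 1 = n - 3 + 2 by omega, smul_eq_mul]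
    field_simp
    rw [pow_add]
  · rw [indicator_of_notMem hR, indicator_of_notMem hR, smul_zero]

/-- The squared integrand is ϱ²(L_G u)²/|x|², and L_G u need not vanish on the axis x = 0. Local
integrability of |x|⁻² in ℝⁿ is therefore the point, and this is where Q ≥ 5 enters. -/
theorem normSq_grushinOp_ne_top (hn : 3 ≤ n) {u : Space n → ℝ} (hu : ContDiff ℝ ∞ u)
    (hc : HasCompactSupport u) : normSq (fun p => grushinOp u p / √(psi p)) ≠ ⊤ := by
  obtain ⟨R, hR⟩ := hc.isCompact.isBounded.subset_closedBall 0
  have hcont : Continuous fun p => rho p ^ 2 * grushin u p ^ 2 :=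
    (continuous_rho.pow 2).mul ((contDiff_grushin hu).continuous.pow 2)
  have hz : ∀ p, p ∉ tsupport u → grushin u p = 0 := fun p hp =>
    grushin_eq_zero hp
  obtain ⟨C, hC⟩ := (hc.isCompact (f := u)).exists_bound_of_continuousOn hcont.continuousOn
  have ht : Integrable ((Icc (-R) R).indicator fun _ : ℝ => |C|) :=
    (integrable_indicator_iff measurableSet_Icc).2 (by simp)
  -- The majorant is the product of |x|⁻² on |x| ≤ R and a constant on |t| ≤ R; the maximum norm of
  -- the product space places the support of u in this cylinder.
  have hi := (integrable_indicator_inv_norm_sq hn R).mul_prod ht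
  rw [normSq_eq]
  refine ne_top_of_le_ne_top hi.lintegral_lt_top.ne (lintegral_mono_ae
    ((ae_fst_ne_zero (by omega)).mono fun p hp => ENNReal.ofReal_le_ofReal ?_))
  rw [grushinOp_div_sq hu hp]
  by_cases hp' : p ∈ tsupport u
  · have h1 : ‖p‖ ≤ R := by simpa using hR hp'
    have h2 : ‖p.1‖ ∈ Iic R := (norm_fst_le p).trans h1
    have h3 : p.2 ∈ Icc (-R) R := abs_le.1 ((norm_snd_le p).trans h1)
    have hx : 0 < ‖p.1‖ := norm_pos_iff.2 hp
    rw [indicator_of_mem h2, indicator_of_mem h3, grushinQuot]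
    have h4 := ((le_abs_self _).trans (hC p hp')).trans (le_abs_self C)
    calc _ = 1 / ‖p.1‖ ^ 2 * (rho p ^ 2 * grushin u p ^ 2) := by field_simp
      _ ≤ _ := by gcongr
  · have hC0 : ∀ y, 0 ≤ (Icc (-R) R).indicator (fun _ : ℝ => |C|) y := fun y =>
      indicator_nonneg (fun _ _ => abs_nonneg C) y
    rw [grushinQuot, hz p hp']
    simp only [zero_div, ne_eq, OfNat.ofNat_ne_zero, not_false_eq_true, zero_pow, mul_zero]
    exact mul_nonneg (indicator_nonneg (fun y _ => by positivity) _) (hC0 _)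

end Grushin

end

open Grushin in
theorem theorem5p2 (n : ℕ) (hQ : 4 ≤ homDim n) (u : Space n → ℝ)
    (hu : ContDiff ℝ ∞ u) (hc : HasCompactSupport u) (ho : (0 : Space n) ∉ tsupport u) :
    normSq (fun p => grushinOp u p / √(psi p))
        = normSq (fun p => radialGrushinOp u p / √(psi p))
          + 16 * ∑' k : ℕ, ENNReal.ofReal (sphEigenvalue n k ^ 2) *
              normSq (fun p => harmProj k u p * √(psi p) / rho p ^ 2)
          + 8 * ∑' k : ℕ, ENNReal.ofReal (sphEigenvalue n k) *
              normSq (fun p => harmProj k (radialDeriv u) p * √(psi p) / rho p)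
          + 8 * ENNReal.ofReal ((homDim n : ℝ) - 4) *
              ∑' k : ℕ, ENNReal.ofReal (sphEigenvalue n k) *
                normSq (fun p => harmProj k u p * √(psi p) / rho p ^ 2)
      ∧ normSq (fun p => radialGrushinOp u p / √(psi p)) ≠ ⊤
      ∧ (5 ≤ homDim n → normSq (fun p => grushinOp u p / √(psi p)) ≠ ⊤)
      ∧ normSq (fun p => radialGrushinOp u p / √(psi p))
          ≤ normSq (fun p => grushinOp u p / √(psi p)) := by
  have hn : 2 ≤ n := by
    rw [homDim] at hQ
    omega
  have hcast : (homDim n : ℝ) - 4 = (n : ℝ) - 2 := by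
    rw [homDim]
    push_cast
    ring
  rw [hcast]
  have h := normSq_grushinOp_eq hn hu hc ho
  refine ⟨h, normSq_radialGrushinOp_ne_top (by omega) hu hc ho, fun h5 => ?_, ?_⟩
  · rw [homDim] at h5
    exact normSq_grushinOp_ne_top (by omega) hu hc
  · rw [h, add_assoc, add_assoc]
    exact le_self_add
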